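/- **Setting.** Let $\mathbb F$ be a commutative ring with unit and let $\Lambda=\Lambda_1\cup\dots\cup\Lambda_m\subset\mathbb R^3_{std}=(\mathbb R^3,\ker(dz-y\,dx))$ be a Legendrian link with generic front (whose only singularities are transverse double points and cusps), with Maslov class $0$, equipped with a $\mathbb Z$-valued Maslov potential $\mu$ and with one base point on each component. Let $(\mathcal A(\Lambda),\partial)$ be its Chekanov–Eliashberg DGA over $\mathbb F$, computed from the Lagrangian resolution of the front (a Legendrian isotopic link): it is freely generated by the Reeb chords $a$ (one for each crossing and each right cusp of the front), with $|a|=\mu(\text{upper strand})-\mu(\text{lower strand})$, and by one invertible generator $t_k$ of degree $0$ for each component, with $\partial t_k=0$; $\partial a$ is the signed count of immersed disks in the Lagrangian projection with one positive corner at $a$, each contributing the word of its negative corners and base points read counterclockwise. An augmentation $\epsilon:\mathcal A(\Lambda)\to\mathbb F$ is a unital algebra homomorphism with $\epsilon\circ\partial=0$ that vanishes on elements of nonzero degree. For a Reeb chord $a$ let $c(a)$ be the index of the component on which $a$ begins (lower end) and $r(a)$ that of the component on which it ends (upper end). **Augmentation category.** For augmentations $\epsilon^1,\epsilon^2$, $Hom_+(\epsilon^1,\epsilon^2)$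 is the free graded $\mathbb F$-module on $\check a$ ($a$ a Reeb chord), $\check x_k$, $\check y_k$ ($1\le k\le m$), with $|\check a|_+=|a|+1$, $|\check x_k|_+=1$, $|\check y_k|_+=0$. The operations come from the DGA of the perturbed $n$-copy $\Lambda^n_f$, generated by invertible $t_k^p$, by $a^{pq}$ ($1\le p,q\le n$) and by $x_k^{pq},y_k^{pq}$ ($p<q$). With the $n\times n$ matrices $A=(a^{pq})$, $\Delta_k=\mathrm{Diag}(t_k^p)$, $X_k=1+(x_k^{pq})_{p<q}$, $Y_k=(y_k^{pq})_{p<q}$, and with $\Phi$ the algebra homomorphism $\Phi(a)=A$, $\Phi(t_k)=\Delta_kX_k$, its differential $\partial^n$ vanishes on the $t_k^p$ and is given by $$\partial^n A=\Phi(\partial a)+Y_{r(a)}A+(-1)^{|a|+1}AY_{c(a)},\quad \partial^n X_k=\Delta_k^{-1}Y_k\Delta_kX_k-X_kY_k,\quad \partial^n Y_k=Y_k^2 .$$ For augmentations $\epsilon^1,\dots,\epsilon^n$ let $\partial^n_\epsilon$ be obtained from $\partial^n$ by setting $t^p_k=\epsilon^p(t_k)$ and replacing $a^{pp}$ by $a^{pp}+\epsilon^p(a)$.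 Then, $\check b$ running over generators, $$m_1(\check b)=\sum_{\check a}\mathrm{Coeff}_{b^{12}}(\partial^2_\epsilon a^{12})\,\check a,\qquad m_2(\check b_2,\check b_1)=(-1)^{1+|\check b_1|_+|\check b_2|_++|\check b_1|_+}\sum_{\check a}\mathrm{Coeff}_{b_1^{12}b_2^{23}}(\partial^3_\epsilon a^{13})\,\check a ,$$ where $m_1$ acts on $Hom_+(\epsilon^1,\epsilon^2)$ and $m_2:Hom_+(\epsilon^2,\epsilon^3)\otimes Hom_+(\epsilon^1,\epsilon^2)\to Hom_+(\epsilon^1,\epsilon^3)$; the unit of $\epsilon$ is $e_\epsilon=-\sum_k\check y_k$. Two augmentations are *equivalent in $Aug_+(\Lambda)$* if they are isomorphic in $H^*Aug_+(\Lambda)$: there are degree-$0$ cocycles $\alpha\in Hom_+(\epsilon^1,\epsilon^2)$, $\beta\in Hom_+(\epsilon^2,\epsilon^1)$ with $[m_2(\alpha,\beta)]=[e_{\epsilon^2}]$ and $[m_2(\beta,\alpha)]=[e_{\epsilon^1}]$. **Split DGA.** Put $c(t_k^{\pm1})=r(t_k^{\pm1})=k$. Let $\mathcal A_{ij}$ be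 the $\mathbb F$-module spanned by the composable words beginning on $\Lambda_i$ and ending on $\Lambda_j$, i.e. words $b_1\cdots b_s$ with $r(b_1)=j$, $c(b_p)=r(b_{p+1})$, $c(b_s)=i$; for $i=j$ the empty word is included and denoted $e_j$. Let $\mathcal A_{**}=\bigoplus_{i,j}\mathcal A_{ij}$, with concatenation $\mathcal A_{jl}\times\mathcal A_{ij}\to\mathcal A_{il}$ as product of composable elements (other products are zero) and the differential $\partial$, in which a constant term of $\partial a$ is read as a multiple of $e_{r(a)}$. The split augmentation $\epsilon_{**}:\mathcal A_{**}\to\mathbb F$ has the values of $\epsilon$ on words; in particular $\epsilon_{**}(e_j)=1$ for all $j$. Split augmentations $\epsilon^1_{**},\epsilon^2_{**}$ are *split-DGA homotopic* if there are units $\alpha_1,\dots,\alpha_m\in\mathbb F^*$ and an $\mathbb F$-linear map $K:\mathcal A_{**}\to\mathbb F$ of degree $1$ (so $K$ vanishes on elements of degree $\ne-1$) such that $$\alpha_i\,\epsilon^1_{**}(a)-\alpha_j\,\epsilon^2_{**}(a)=K(\partial a)\qquad\text{for all } i,j \text{ and all } a\in\mathcal A_{ij},$$ $$K(xy)=K(x)\,\epsilon^2_{**}(y)+(-1)^{|x|}\epsilon^1_{**}(x)\,K(y)\qquad\text{for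 all composable } x\in\mathcal A_{jl}\text{ (homogeneous)},\ y\in\mathcal A_{ij}.$$ **Proposition.** Two augmentations $\epsilon^1,\epsilon^2:\mathcal A(\Lambda)\to\mathbb F$ are equivalent in $Aug_+(\Lambda)$ if and only if the corresponding split augmentations $\epsilon^1_{**}$ and $\epsilon^2_{**}$ are split-DGA homotopic. -/

import Mathlib

open scoped ContDiff Topology

noncomputable section

namespace Legendrian

/-! ### Legendrian links in the standard contact three-space and their fronts -/

/-- A Legendrian link with `m` components in `ℝ³` with the contact form `dz - y dx`: component `c`
is the closed curve `θ ↦ (x c θ, y c θ, z c θ)` of period `1`. -/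
structure Link (m : ℕ) where
  x : Fin m → ℝ → ℝ
  y : Fin m → ℝ → ℝ
  z : Fin m → ℝ → ℝ
  smooth_x : ∀ c, ContDiff ℝ ∞ (x c)
  smooth_y : ∀ c, ContDiff ℝ ∞ (y c)
  smooth_z : ∀ c, ContDiff ℝ ∞ (z c)
  periodic_x : ∀ c, Function.Periodic (x c) 1
  periodic_y : ∀ c, Function.Periodic (y c) 1
  periodic_z : ∀ c, Function.Periodic (z c) 1
  immersed : ∀ c θ, (deriv (x c) θ, deriv (y c) θ, deriv (z c) θ) ≠ (0, 0, 0)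
  embedded : ∀ c c' θ θ', (x c θ, y c θ, z c θ) = (x c' θ', y c' θ', z c' θ') →
    c = c' ∧ ∃ n : ℤ, θ' = θ + n
  legendrian : ∀ c θ, deriv (z c) θ = y c θ * deriv (x c) θ

/-- An event met when a front is swept from left to right. Over each generic abscissa the strands
are numbered `0, 1, 2, …` from the top (largest `z`) to the bottom; `k` is the position of the
event: the two strands that are born, cross or die are those in positions `k` and `k + 1`, the
base point lies on the strand in position `k`. -/
inductive FrontEvent where
  | leftCusp (k : ℕ)
  | crossing (k : ℕ)
  | rightCusp (k : ℕ)
  | basePoint (k : ℕ)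

namespace FrontEvent

def pos : FrontEvent → ℕ
  | leftCusp k => k
  | crossing k => k
  | rightCusp k => k
  | basePoint k => k

/-- Crossings and right cusps carry the Reeb chords. -/
def isReeb : FrontEvent → Bool
  | leftCusp _ => false
  | crossing _ => true
  | rightCusp _ => true
  | basePoint _ => false

/-- The order-preserving injection of `ℕ` that misses `k` and `k + 1`. -/
def skip (k i : ℕ) : ℕ := if i < k then i else i + 2

/-- The strand in position `i` to the left of the event continues (smoothly) to the strand in
position `j` to the right of it. -/
def Joins : FrontEvent → ℕ → ℕ → Prop
  | leftCusp k, i, j => j = skip k i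
  | crossing k, i, j => j = Equiv.swap k (k + 1) i
  | rightCusp k, i, j => i = skip k j
  | basePoint _, i, j => j = i

/-- The event is possible with `n` strands on its left and `n'` on its right. -/
def Widths : FrontEvent → ℕ → ℕ → Prop
  | leftCusp k, n, n' => k ≤ n ∧ n' = n + 2
  | crossing k, n, n' => k + 1 < n ∧ n' = n
  | rightCusp k, n, n' => k ≤ n' ∧ n = n' + 2
  | basePoint k, n, n' => k < n ∧ n' = n

end FrontEvent

/-- A generic front diagram with `m` components, a `ℤ`-valued Maslov potential (so that the Maslov
class vanishes) and one base point on each component. Slice `s` is the part between the events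
`s - 1` and `s`; it meets the front in `width s` strands, the one in position `i` belongs to
component `comp s i` and has Maslov potential `pot s i`. Only `event s` for `s < numEvents`, and
`comp s i`, `pot s i` for `s ≤ numEvents` and `i < width s`, matter. -/
structure FrontDiagram (m : ℕ) where
  numEvents : ℕ
  event : ℕ → FrontEvent
  width : ℕ → ℕ
  comp : ℕ → ℕ → Fin m
  pot : ℕ → ℕ → ℤ
  width_first : width 0 = 0
  width_last : width numEvents = 0
  widths : ∀ s < numEvents, (event s).Widths (width s) (width (s + 1))
  joins : ∀ s < numEvents, ∀ i < width s, ∀ j < width (s + 1), (event s).Joins i j →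
    comp (s + 1) j = comp s i ∧ pot (s + 1) j = pot s i
  leftCusp : ∀ s < numEvents, ∀ k, event s = .leftCusp k →
    comp (s + 1) k = comp (s + 1) (k + 1) ∧ pot (s + 1) k = pot (s + 1) (k + 1) + 1
  rightCusp : ∀ s < numEvents, ∀ k, event s = .rightCusp k →
    comp s k = comp s (k + 1) ∧ pot s k = pot s (k + 1) + 1
  basePoint : ∀ c : Fin m, ∃! s, s < numEvents ∧ ∃ k, event s = .basePoint k ∧ comp s k = c

variable {m : ℕ}

namespace FrontDiagram

/-- The diagram `D` is the front of `Λ`: there are abscissae `X 0 < X 1 < …` of the events and, over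
every slice, strands `(η s i u, ζ s i u)` (the `y`- and `z`-coordinates over the abscissa `u`) that
make up the part of `Λ` over the slice, are numbered by decreasing `z`, continue across the events
as the diagram says, and come together in pairs at the cusps. -/
def IsFrontOf (D : FrontDiagram m) (Λ : Link m) : Prop :=
  ∃ (X : ℕ → ℝ) (η ζ : ℕ → ℕ → ℝ → ℝ),
    (∀ s, s + 1 < D.numEvents → X s < X (s + 1)) ∧
    (∀ s ≤ D.numEvents, ∀ u : ℝ, (∀ r < s, X r < u) → (∀ r < D.numEvents, s ≤ r → u < X r) →
      (∀ i j, i < j → j < D.width s → ζ s j u < ζ s i u) ∧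
      ∀ (c : Fin m) (y z : ℝ), (∃ θ, Λ.x c θ = u ∧ Λ.y c θ = y ∧ Λ.z c θ = z) ↔
        ∃ i < D.width s, D.comp s i = c ∧ η s i u = y ∧ ζ s i u = z) ∧
    (∀ s < D.numEvents, ∀ i < D.width s, ∀ j < D.width (s + 1), (D.event s).Joins i j →
      ∃ p : ℝ × ℝ, Filter.Tendsto (fun u => (η s i u, ζ s i u)) (𝓝[<] X s) (𝓝 p) ∧
        Filter.Tendsto (fun u => (η (s + 1) j u, ζ (s + 1) j u)) (𝓝[>] X s) (𝓝 p)) ∧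
    (∀ s < D.numEvents, ∀ k, D.event s = .leftCusp k → ∃ p : ℝ × ℝ, ∀ i, (i = k ∨ i = k + 1) →
      Filter.Tendsto (fun u => (η (s + 1) i u, ζ (s + 1) i u)) (𝓝[>] X s) (𝓝 p)) ∧
    (∀ s < D.numEvents, ∀ k, D.event s = .rightCusp k → ∃ p : ℝ × ℝ, ∀ i, (i = k ∨ i = k + 1) →
      Filter.Tendsto (fun u => (η s i u, ζ s i u)) (𝓝[<] X s) (𝓝 p))

/-! ### Reeb chords, words and gradings

The Reeb chords and disks are those of the resolution of the front, a link that is Legendrian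
isotopic to the given one and whose Lagrangian projection is obtained from the front by smoothing
each left cusp, replacing each right cusp by a crossing followed (to the right) by a small cap, and
letting at each crossing the strand that comes from the upper left be the one with larger `z`. -/

/-- The Reeb chords, one for each crossing and each right cusp. -/
def Chord (D : FrontDiagram m) : Type :=
  {s : Fin D.numEvents // (D.event s).isReeb = true}

instance (D : FrontDiagram m) : Fintype D.Chord :=
  inferInstanceAs (Fintype {s : Fin D.numEvents // (D.event s).isReeb = true})

variable {D : FrontDiagram m}

namespace Chord

def idx (a : D.Chord) : ℕ := a.1

/-- Position of the upper of the two strands that meet. -/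
def pos (a : D.Chord) : ℕ := (D.event a.idx).pos

/-- The component on which the chord begins (its lower end). -/
def source (a : D.Chord) : Fin m := D.comp a.idx (a.pos + 1)

/-- The component on which the chord ends (its upper end). -/
def target (a : D.Chord) : Fin m := D.comp a.idx a.pos

/-- The degree `|a| = μ(upper) - μ(lower)`. -/
def degree (a : D.Chord) : ℤ := D.pot a.idx a.pos - D.pot a.idx (a.pos + 1)

end Chord

/-- The chord at event `s`. -/
def chordAt {s : ℕ} (hs : s < D.numEvents) (h : (D.event s).isReeb = true) : D.Chord :=
  ⟨⟨s, hs⟩, h⟩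

/-- Words in the Reeb chords `a` and the invertible letters `t c`, one for each component. -/
abbrev Word (D : FrontDiagram m) : Type :=
  Monoid.Coprod (FreeMonoid D.Chord) (FreeGroup (Fin m))

def Word.chord (a : D.Chord) : D.Word := Monoid.Coprod.inl (FreeMonoid.of a)

def Word.base (g : FreeGroup (Fin m)) : D.Word := Monoid.Coprod.inr g

/-- The degree of a word, with `|t c| = 0`. -/
def Word.degree : D.Word →* Multiplicative ℤ :=
  Monoid.Coprod.lift (FreeMonoid.lift fun a => Multiplicative.ofAdd a.degree) 1

/-- `Composable i j w`: the word `w` begins on component `i` and ends on component `j`. A word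
`b₁ b₂ ⋯ bᵣ` is composable if each `bₚ` begins where `bₚ₊₁` ends; it ends where `b₁` ends and begins
where `bᵣ` begins. The letter `t c` begins and ends on `c`. -/
inductive Composable : Fin m → Fin m → D.Word → Prop
  | one (j : Fin m) : Composable j j 1
  | chord (a : D.Chord) : Composable a.source a.target (Word.chord a)
  | base (c : Fin m) : Composable c c (Word.base (FreeGroup.of c))
  | base_inv (c : Fin m) : Composable c c (Word.base (FreeGroup.of c)⁻¹)
  | mul {i j l : Fin m} {u v : D.Word} (hu : Composable j l u) (hv : Composable i j v) :
      Composable i l (u * v)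

/-! ### Disks -/

/-- What a rightward (`n = 1`) or leftward (`n = -1`) passage across event `s` on the strand in
position `i` contributes to a boundary word: `t c` or its inverse if a base point is met, nothing
otherwise. Components are oriented such that the strands of even Maslov potential go to the right;
`t c` is met when the base point is passed along the orientation. -/
def baseMark (D : FrontDiagram m) (s i : ℕ) (n : ℤ) : D.Word :=
  match D.event s with
  | .basePoint k =>
    if i = k then Word.base (FreeGroup.of (D.comp s k) ^ (if Even (D.pot s k) then n else -n))
    else 1
  | _ => 1

/-- `Disk D s i j`: the (isotopy classes of) immersed disks in the plane whose boundary lies on the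
Lagrangian projection of the resolution of `D`, cut off on the right by a vertical segment in slice
`s` that joins the strands in positions `i` (above) and `j` (below), smooth except for convex
negative corners (in the quadrants above and below a crossing). They are listed by what
happens at the last event to the left of the segment. -/
inductive Disk (D : FrontDiagram m) : ℕ → ℕ → ℕ → Type
  /-- The disk begins at the left cusp. -/
  | start {s k i j : ℕ} (hs : s < D.numEvents) (h : D.event s = .leftCusp k)
      (hi : i = k) (hj : j = k + 1) : Disk D (s + 1) i j
  /-- Both boundary strands continue across the event; that they do not change their order excludes
  a positive corner. -/
  | pass {s i j i' j' : ℕ} (hs : s < D.numEvents) (hi : (D.event s).Joins i i')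
      (hj : (D.event s).Joins j j') (hij : i' < j') (d : Disk D s i j) : Disk D (s + 1) i' j'
  /-- A corner on the upper boundary, in the quadrant below the crossing. -/
  | cornerBelow {s k i j : ℕ} (hs : s < D.numEvents) (h : D.event s = .crossing k)
      (hi : i = k + 1) (d : Disk D s i j) : Disk D (s + 1) i j
  /-- A corner on the lower boundary, in the quadrant above the crossing. -/
  | cornerAbove {s k i j : ℕ} (hs : s < D.numEvents) (h : D.event s = .crossing k)
      (hj : j = k) (d : Disk D s i j) : Disk D (s + 1) i j
  /-- The disk surrounds the cap of a right cusp: to its left are a disk above and a disk below.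
  At the crossing of the right cusp the former has a corner in the quadrant above if `u` is true,
  the latter has a corner in the quadrant below if `v` is true. -/
  | cap {s k i j i' j' p q : ℕ} (hs : s < D.numEvents) (h : D.event s = .rightCusp k) (u v : Bool)
      (hi : i = FrontEvent.skip k i') (hj : j = FrontEvent.skip k j')
      (hp : p = if u then k else k + 1) (hq : q = if v then k + 1 else k)
      (d : Disk D s i p) (d' : Disk D s q j) : Disk D (s + 1) i' j'

namespace Disk

theorem _root_.Legendrian.FrontDiagram.isReeb_crossing {s k : ℕ}
    (h : D.event s = .crossing k) : (D.event s).isReeb = true := by rw [h]; rfl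

theorem _root_.Legendrian.FrontDiagram.isReeb_rightCusp {s k : ℕ}
    (h : D.event s = .rightCusp k) : (D.event s).isReeb = true := by rw [h]; rfl

theorem _root_.Legendrian.FrontEvent.Joins.injective {e : FrontEvent} {i i' j : ℕ}
    (h : e.Joins i j) (h' : e.Joins i' j) : i = i' := by
  cases e with
  | leftCusp k =>
    simp only [FrontEvent.Joins, FrontEvent.skip] at h h'
    split_ifs at h h' <;> omega
  | crossing k =>
    simp only [FrontEvent.Joins] at h h'
    exact (Equiv.swap k (k + 1)).injective (h.symm.trans h')
  | rightCusp k =>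
    simp only [FrontEvent.Joins] at h h'
    exact h.trans h'.symm
  | basePoint k =>
    simp only [FrontEvent.Joins] at h h'
    exact h.symm.trans h'

/-- There are only finitely many disks, so that counting them makes sense. -/
instance finite : (s i j : ℕ) → Finite (Disk D s i j)
  | 0, i, j => by
    have : IsEmpty (Disk D 0 i j) := ⟨nofun⟩
    infer_instance
  | s + 1, i', j' => by
    have ih := finite s
    have h1 : {x : Disk D (s + 1) i' j' | ∃ k hs h hi hj, x = start (k := k) hs h hi hj}.Finite := by
      refine Set.Subsingleton.finite ?_
      rintro _ ⟨k, hs, h, rfl, hj, rfl⟩ _ ⟨k', hs', h', rfl, hj', rfl⟩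
      rfl
    have h2 : {x : Disk D (s + 1) i' j' | ∃ i j hs hi hj hij d,
        x = pass (i := i) (j := j) hs hi hj hij d}.Finite := by
      by_cases H : ∃ i j, (D.event s).Joins i i' ∧ (D.event s).Joins j j' ∧ i' < j' ∧
          s < D.numEvents
      · obtain ⟨i, j, hi, hj, hij, hs⟩ := H
        refine (Set.finite_range fun d : Disk D s i j => pass hs hi hj hij d).subset ?_
        rintro _ ⟨i₂, j₂, _, hi₂, hj₂, _, d, rfl⟩
        obtain rfl := hi.injective hi₂
        obtain rfl := hj.injective hj₂
        exact ⟨d, rfl⟩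
      · refine Set.Finite.subset Set.finite_empty ?_
        rintro _ ⟨i, j, hs, hi, hj, hij, d, rfl⟩
        exact H ⟨i, j, hi, hj, hij, hs⟩
    have h3 : {x : Disk D (s + 1) i' j' | ∃ k hs h hi d,
        x = cornerBelow (k := k) hs h hi d}.Finite := by
      by_cases H : ∃ k, D.event s = .crossing k ∧ i' = k + 1 ∧ s < D.numEvents
      · obtain ⟨k, h, hi, hs⟩ := H
        refine (Set.finite_range fun d : Disk D s i' j' => cornerBelow hs h hi d).subset ?_
        rintro _ ⟨k₂, _, h₂, hi₂, d, rfl⟩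
        obtain rfl : k = k₂ := by omega
        exact ⟨d, rfl⟩
      · refine Set.Finite.subset Set.finite_empty ?_
        rintro _ ⟨k, hs, h, hi, d, rfl⟩
        exact H ⟨k, h, hi, hs⟩
    have h4 : {x : Disk D (s + 1) i' j' | ∃ k hs h hj d,
        x = cornerAbove (k := k) hs h hj d}.Finite := by
      by_cases H : ∃ k, D.event s = .crossing k ∧ j' = k ∧ s < D.numEvents
      · obtain ⟨k, h, hj, hs⟩ := H
        refine (Set.finite_range fun d : Disk D s i' j' => cornerAbove hs h hj d).subset ?_
        rintro _ ⟨k₂, _, h₂, hj₂, d, rfl⟩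
        obtain rfl : k = k₂ := by omega
        exact ⟨d, rfl⟩
      · refine Set.Finite.subset Set.finite_empty ?_
        rintro _ ⟨k, hs, h, hj, d, rfl⟩
        exact H ⟨k, h, hj, hs⟩
    have h5 : {x : Disk D (s + 1) i' j' | ∃ k i j p q hs h u v hi hj hp hq d d',
        x = cap (k := k) (i := i) (j := j) (p := p) (q := q) hs h u v hi hj hp hq d d'}.Finite := by
      by_cases H : ∃ k, D.event s = .rightCusp k ∧ s < D.numEvents
      · obtain ⟨k, h, hs⟩ := H
        refine (Set.finite_iUnion fun u : Bool => Set.finite_iUnion fun v : Bool =>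
          Set.finite_range fun d : Disk D s (FrontEvent.skip k i') (if u then k else k + 1) ×
            Disk D s (if v then k + 1 else k) (FrontEvent.skip k j') =>
            (cap hs h u v rfl rfl rfl rfl d.1 d.2 : Disk D (s + 1) i' j')).subset ?_
        rintro _ ⟨k₂, i, j, p, q, _, h₂, u, v, rfl, rfl, rfl, rfl, d, d', rfl⟩
        obtain rfl : k = k₂ := by simpa using h.symm.trans h₂
        exact Set.mem_iUnion.2 ⟨u, Set.mem_iUnion.2 ⟨v, ⟨(d, d'), rfl⟩⟩⟩
      · refine Set.Finite.subset Set.finite_empty ?_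
        rintro _ ⟨k, i, j, p, q, hs, h, u, v, hi, hj, hp, hq, d, d', rfl⟩
        exact H ⟨k, h, hs⟩
    refine Set.finite_univ_iff.1 (((h1.union h2).union ((h3.union h4).union h5)).subset ?_)
    intro x _
    cases x with
    | start hs h hi hj => exact .inl (.inl ⟨_, hs, h, hi, hj, rfl⟩)
    | pass hs hi hj hij d => exact .inl (.inr ⟨_, _, hs, hi, hj, hij, d, rfl⟩)
    | cornerBelow hs h hi d => exact .inr (.inl (.inl ⟨_, hs, h, hi, d, rfl⟩))
    | cornerAbove hs h hj d => exact .inr (.inl (.inr ⟨_, hs, h, hj, d, rfl⟩))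
    | cap hs h u v hi hj hp hq d d' =>
      exact .inr (.inr ⟨_, _, _, _, _, hs, h, u, v, hi, hj, hp, hq, d, d', rfl⟩)

/-- The word read along the boundary in counterclockwise direction, from the upper to the lower end
of the vertical segment. -/
def word : {s i j : ℕ} → Disk D s i j → D.Word
  | _, _, _, start _ _ _ _ => 1
  | _, _, _, pass (s := s) (i := i) (j := j) _ _ _ _ d =>
      D.baseMark s i (-1) * d.word * D.baseMark s j 1
  | _, _, _, cornerBelow hs h _ d => Word.chord (chordAt hs (isReeb_crossing h)) * d.word
  | _, _, _, cornerAbove hs h _ d => d.word * Word.chord (chordAt hs (isReeb_crossing h))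
  | _, _, _, cap hs h u v _ _ _ _ d d' =>
      d.word * Word.chord (chordAt hs (isReeb_rightCusp h)) ^ u.toNat *
        (Word.chord (chordAt hs (isReeb_rightCusp h)) ^ v.toNat * d'.word)

/-- The product of the orientation signs of the corners: `-1` for a corner in the quadrant below a
chord of even degree, `1` for all others (in particular at right cusps, which have degree `1`). -/
def sign : {s i j : ℕ} → Disk D s i j → ℤ
  | _, _, _, start _ _ _ _ => 1
  | _, _, _, pass _ _ _ _ d => d.sign
  | _, _, _, cornerBelow hs h _ d =>
      (if Even (chordAt hs (isReeb_crossing h)).degree then -1 else 1) * d.sign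
  | _, _, _, cornerAbove _ _ _ d => d.sign
  | _, _, _, cap _ _ _ _ _ _ _ _ d d' => d.sign * d'.sign

end Disk

/-! ### The Chekanov–Eliashberg algebra -/

/-- The underlying algebra: the free unital algebra over `F` on the Reeb chords and the invertible
letters `t c`. -/
abbrev Alg (D : FrontDiagram m) (F : Type*) [CommRing F] : Type _ := MonoidAlgebra F D.Word

variable (D) (F : Type*) [CommRing F]

/-- The elements that are homogeneous of degree `n`. -/
def gradedPart (n : ℤ) : Submodule F (D.Alg F) :=
  Submodule.span F
    {x | ∃ w : D.Word, Word.degree w = Multiplicative.ofAdd n ∧ x = MonoidAlgebra.single w 1}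

variable {D}

/-- The differential of a chord: the signed count of the disks whose only positive corner is in the
quadrant to the left of the chord and, at a right cusp, of the disk without negative corners inside
the cap. -/
def chordDiff (a : D.Chord) : D.Alg F :=
  (∑ᶠ d : Disk D a.idx a.pos (a.pos + 1), d.sign • (MonoidAlgebra.single d.word 1 : D.Alg F)) +
    (match D.event a.idx with
      | .rightCusp _ => 1
      | _ => 0)

variable (D)

/-- The algebra homomorphism `x ↦ !![(-1)^|x| x, ∂x; 0, x]`; that it is multiplicative is the signed
Leibniz rule for `∂`. -/
def diffHom : D.Alg F →ₐ[F] Matrix (Fin 2) (Fin 2) (D.Alg F) :=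
  MonoidAlgebra.lift F (Matrix (Fin 2) (Fin 2) (D.Alg F)) D.Word
    (Monoid.Coprod.lift
      (FreeMonoid.lift fun a : D.Chord =>
        !![MonoidAlgebra.single (Word.chord a) ((-1 : Fˣ) ^ a.degree : Fˣ), chordDiff F a;
          0, MonoidAlgebra.single (Word.chord a) 1])
      (((Matrix.scalar (Fin 2)).toMonoidHom.comp (MonoidAlgebra.of F D.Word)).comp
        Monoid.Coprod.inr))

/-- The differential `∂`: the linear map with the prescribed values on the chords, `∂(t c) = 0` and
`∂(x y) = ∂x y + (-1)^|x| x ∂y`. -/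
def diff : D.Alg F →ₗ[F] D.Alg F :=
  Matrix.entryLinearMap F (D.Alg F) 0 1 ∘ₗ (D.diffHom F).toLinearMap

/-! ### The split algebra -/

/-- The piece `A_ij` of the split algebra: the span of the words that begin on component `i` and end
on component `j`. The split algebra is the external direct sum of these pieces, so that the copy of
the empty word in `A_jj` is its idempotent `e_j`; the product of two words is their concatenation if
that is composable (which maps `A_jl × A_ij` to `A_il`), and zero otherwise. -/
def splitPart (i j : Fin m) : Submodule F (D.Alg F) :=
  Submodule.span F {x | ∃ w : D.Word, Composable i j w ∧ x = MonoidAlgebra.single w 1}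

variable {D F}

theorem single_mem_splitPart {i j : Fin m} {w : D.Word} (h : Composable i j w) (r : F) :
    (MonoidAlgebra.single w r : D.Alg F) ∈ D.splitPart F i j := by
  have : (MonoidAlgebra.single w r : D.Alg F) = r • MonoidAlgebra.single w 1 := by simp
  rw [this]
  exact Submodule.smul_mem _ _ (Submodule.subset_span ⟨w, h, rfl⟩)

theorem mul_mem_splitPart {i j l : Fin m} {x y : D.Alg F} (hx : x ∈ D.splitPart F j l)
    (hy : y ∈ D.splitPart F i j) : x * y ∈ D.splitPart F i l := by
  refine Submodule.span_induction ?_ (by simp) ?_ ?_ hx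
  · rintro _ ⟨u, hu, rfl⟩
    refine Submodule.span_induction ?_ (by simp) ?_ ?_ hy
    · rintro _ ⟨v, hv, rfl⟩
      rw [MonoidAlgebra.single_mul_single, mul_one]
      exact single_mem_splitPart (hu.mul hv) 1
    · intro a b _ _ ha hb
      rw [mul_add]
      exact Submodule.add_mem _ ha hb
    · intro r a _ ha
      rw [mul_smul_comm]
      exact Submodule.smul_mem _ _ ha
  · intro a b _ _ ha hb
    rw [add_mul]
    exact Submodule.add_mem _ ha hb
  · intro r a _ ha
    rw [smul_mul_assoc]
    exact Submodule.smul_mem _ _ ha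

theorem one_mem_splitPart (j : Fin m) : (1 : D.Alg F) ∈ D.splitPart F j j :=
  single_mem_splitPart (Composable.one j) 1

theorem Composable.zpow (c : Fin m) (n : ℤ) :
    Composable (D := D) c c (Word.base (FreeGroup.of c ^ n)) := by
  have key : ∀ g : FreeGroup (Fin m), Composable (D := D) c c (Word.base g) → ∀ n : ℕ,
      Composable (D := D) c c (Word.base (g ^ n)) := by
    intro g hg n
    induction n with
    | zero => simpa [Word.base] using Composable.one c
    | succ n ih =>
      rw [pow_succ, Word.base, map_mul]
      exact ih.mul hg
  obtain ⟨n, rfl | rfl⟩ := n.eq_nat_or_neg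
  · simpa using key _ (.base c) n
  · simpa using key _ (.base_inv c) n

theorem composable_baseMark {s i : ℕ} (n : ℤ) :
    Composable (D.comp s i) (D.comp s i) (D.baseMark s i n) := by
  unfold baseMark
  split
  · split_ifs with h
    · subst h
      exact .zpow _ _
    · subst h
      exact .zpow _ _
    · exact .one _
  · exact .one _

/-- A disk over slice `s` ends between two strands of that slice, and its boundary word leads from
the component of the lower one to the component of the upper one. -/
theorem Disk.composable {s i j : ℕ} (d : Disk D s i j) :
    i < j ∧ j < D.width s ∧ Composable (D.comp s j) (D.comp s i) d.word := by
  induction d with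
  | @start s k i j hs h hi hj =>
    subst hi hj
    have hw := D.widths s hs
    rw [h] at hw
    obtain ⟨h1, h2⟩ := hw
    refine ⟨by omega, by omega, ?_⟩
    rw [word, ← (D.leftCusp s hs i h).1]
    exact .one _
  | @pass s i j i' j' hs hi hj hij d ih =>
    obtain ⟨h1, h2, h3⟩ := ih
    have hj' : j' < D.width (s + 1) := by
      have hw := D.widths s hs
      revert hw hi hj
      cases D.event s with
      | leftCusp k =>
        simp only [FrontEvent.Joins, FrontEvent.Widths, FrontEvent.skip]
        intro hi hj hw
        split_ifs at hj <;> omega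
      | crossing k =>
        simp only [FrontEvent.Joins, FrontEvent.Widths, Equiv.swap_apply_def]
        intro hi hj hw
        split_ifs at hj <;> omega
      | rightCusp k =>
        simp only [FrontEvent.Joins, FrontEvent.Widths, FrontEvent.skip]
        intro hi hj hw
        split_ifs at hj <;> omega
      | basePoint k =>
        simp only [FrontEvent.Joins, FrontEvent.Widths]
        intro hi hj hw
        omega
    refine ⟨hij, hj', ?_⟩
    rw [(D.joins s hs i (by omega) i' (by omega) hi).1, (D.joins s hs j h2 j' hj' hj).1, word]
    exact ((composable_baseMark _).mul h3).mul (composable_baseMark _)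
  | @cornerBelow s k i j hs h hi d ih =>
    obtain ⟨h1, h2, h3⟩ := ih
    have hw := D.widths s hs
    rw [h] at hw
    obtain ⟨hw1, hw2⟩ := hw
    subst hi
    refine ⟨h1, by omega, ?_⟩
    have e1 := (D.joins s hs j h2 j (by omega) (by
      rw [h]; exact (Equiv.swap_apply_of_ne_of_ne (by omega) (by omega)).symm)).1
    have e2 := (D.joins s hs k (by omega) (k + 1) (by omega) (by
      rw [h]; exact (Equiv.swap_apply_left _ _).symm)).1
    rw [e1, e2, word]
    have hc := Composable.chord (chordAt hs (isReeb_crossing h))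
    simp only [Chord.source, Chord.target, Chord.pos, Chord.idx, chordAt, h, FrontEvent.pos] at hc
    exact hc.mul h3
  | @cornerAbove s k i j hs h hj d ih =>
    obtain ⟨h1, h2, h3⟩ := ih
    have hw := D.widths s hs
    rw [h] at hw
    obtain ⟨hw1, hw2⟩ := hw
    subst hj
    refine ⟨h1, by omega, ?_⟩
    have e1 := (D.joins s hs i (by omega) i (by omega) (by
      rw [h]; exact (Equiv.swap_apply_of_ne_of_ne (by omega) (by omega)).symm)).1
    have e2 := (D.joins s hs (j + 1) (by omega) j (by omega) (by
      rw [h]; exact (Equiv.swap_apply_right _ _).symm)).1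
    rw [e1, e2, word]
    have hc := Composable.chord (chordAt hs (isReeb_crossing h))
    simp only [Chord.source, Chord.target, Chord.pos, Chord.idx, chordAt, h, FrontEvent.pos] at hc
    exact h3.mul hc
  | @cap s k i j i' j' p q hs h u v hi hj hp hq d d' ih ih' =>
    obtain ⟨h1, h2, h3⟩ := ih
    obtain ⟨h1', h2', h3'⟩ := ih'
    have hw := D.widths s hs
    rw [h] at hw
    obtain ⟨hw1, hw2⟩ := hw
    have hc := Composable.chord (chordAt hs (isReeb_rightCusp h))
    simp only [Chord.source, Chord.target, Chord.pos, Chord.idx, chordAt, h, FrontEvent.pos] at hc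
    have hk := (D.rightCusp s hs k h).1
    rw [← hk] at hc
    have hij : i' < j' ∧ j' < D.width (s + 1) := by
      simp only [FrontEvent.skip] at hi hj
      cases u <;> cases v <;> simp at hp hq <;> split_ifs at hi hj <;> omega
    refine ⟨hij.1, hij.2, ?_⟩
    have e1 := (D.joins s hs i (by omega) i' (by omega) (by rw [h]; exact hi)).1
    have e2 := (D.joins s hs j h2' j' hij.2 (by rw [h]; exact hj)).1
    rw [e1, e2, word]
    have hp' : D.comp s p = D.comp s k := by subst hp; split <;> simp [hk]
    have hq' : D.comp s q = D.comp s k := by subst hq; split <;> simp [hk]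
    rw [hp'] at h3
    rw [hq'] at h3'
    have hpow : ∀ b : Bool, Composable (D.comp s k) (D.comp s k)
        (Word.chord (chordAt hs (isReeb_rightCusp h)) ^ b.toNat) := by
      intro b
      cases b
      · rw [Bool.toNat_false, pow_zero]
        exact Composable.one _
      · rw [Bool.toNat_true, pow_one]
        exact hc
    exact (h3.mul (hpow u)).mul ((hpow v).mul h3')

theorem chordDiff_mem_splitPart (a : D.Chord) :
    chordDiff F a ∈ D.splitPart F a.source a.target := by
  refine Submodule.add_mem _ ?_ ?_
  · refine finsum_induction (· ∈ D.splitPart F a.source a.target) (Submodule.zero_mem _)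
      (fun _ _ => Submodule.add_mem _) fun d => ?_
    exact zsmul_mem (single_mem_splitPart d.composable.2.2 1) _
  · split
    · next k h =>
      have hk := (D.rightCusp a.idx a.1.2 k h).1
      have : a.source = a.target := by
        simp only [Chord.source, Chord.target, Chord.pos, h, FrontEvent.pos, hk]
      rw [this]
      exact one_mem_splitPart _
    · exact Submodule.zero_mem _

/-- The differential respects the splitting. -/
theorem diff_mem_splitPart {i j : Fin m} {x : D.Alg F} (hx : x ∈ D.splitPart F i j) :
    D.diff F x ∈ D.splitPart F i j := by
  have key : ∀ (i j : Fin m) (w : D.Word), Composable i j w → ∀ p q : Fin 2,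
      D.diffHom F (MonoidAlgebra.single w 1) p q ∈ D.splitPart F i j := by
    intro i j w hw
    induction hw with
    | one j =>
      intro p q
      rw [← MonoidAlgebra.one_def, map_one, Matrix.one_apply]
      split_ifs
      · exact one_mem_splitPart j
      · exact Submodule.zero_mem _
    | chord a =>
      intro p q
      rw [diffHom, MonoidAlgebra.lift_single, one_smul, Word.chord, Monoid.Coprod.lift_apply_inl,
        FreeMonoid.lift_eval_of]
      fin_cases p <;> fin_cases q
      · exact single_mem_splitPart (.chord a) _
      · exact chordDiff_mem_splitPart a
      · exact Submodule.zero_mem _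
      · exact single_mem_splitPart (.chord a) _
    | base c =>
      intro p q
      rw [diffHom, MonoidAlgebra.lift_single, one_smul, Word.base, Monoid.Coprod.lift_apply_inr]
      simp only [MonoidHom.comp_apply, RingHom.toMonoidHom_eq_coe, MonoidHom.coe_coe,
        Matrix.scalar_apply, Matrix.diagonal_apply]
      split_ifs
      · exact single_mem_splitPart (.base c) 1
      · exact Submodule.zero_mem _
    | base_inv c =>
      intro p q
      rw [diffHom, MonoidAlgebra.lift_single, one_smul, Word.base, Monoid.Coprod.lift_apply_inr]
      simp only [MonoidHom.comp_apply, RingHom.toMonoidHom_eq_coe, MonoidHom.coe_coe,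
        Matrix.scalar_apply, Matrix.diagonal_apply]
      split_ifs
      · exact single_mem_splitPart (.base_inv c) 1
      · exact Submodule.zero_mem _
    | @mul i j l u v hu hv ihu ihv =>
      intro p q
      have : (MonoidAlgebra.single (u * v) 1 : D.Alg F) =
          MonoidAlgebra.single u 1 * MonoidAlgebra.single v 1 := by
        rw [MonoidAlgebra.single_mul_single, mul_one]
      rw [this, map_mul, Matrix.mul_apply]
      exact Submodule.sum_mem _ fun r _ => mul_mem_splitPart (ihu p r) (ihv r q)
  refine Submodule.span_induction ?_ (by simp) ?_ ?_ hx
  · rintro _ ⟨w, hw, rfl⟩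
    exact key i j w hw 0 1
  · intro a b _ _ ha hb
    rw [map_add]
    exact Submodule.add_mem _ ha hb
  · intro r a _ ha
    rw [map_smul]
    exact Submodule.smul_mem _ _ ha

/-- The differential of the split algebra. -/
def splitDiff (i j : Fin m) : D.splitPart F i j →ₗ[F] D.splitPart F i j :=
  (D.diff F).restrict fun _ => diff_mem_splitPart

/-- The product of the split algebra on composable factors. -/
def splitMul {i j l : Fin m} (x : D.splitPart F j l) (y : D.splitPart F i j) :
    D.splitPart F i l :=
  ⟨x.1 * y.1, mul_mem_splitPart x.2 y.2⟩

/-! ### Augmentations and split-DGA homotopy -/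

variable (D F)

/-- An augmentation: a DGA morphism to `F`, which lies in degree `0` and has differential zero. -/
structure Augmentation where
  toHom : D.Alg F →ₐ[F] F
  degree_zero : ∀ n : ℤ, n ≠ 0 → ∀ x ∈ D.gradedPart F n, toHom x = 0
  map_diff : ∀ x, toHom (D.diff F x) = 0

variable {D F}

/-- The unit `ε(t c)`. -/
def Augmentation.baseValue (ε : D.Augmentation F) (c : Fin m) : Fˣ where
  val := ε.toHom (MonoidAlgebra.single (Word.base (FreeGroup.of c)) 1)
  inv := ε.toHom (MonoidAlgebra.single (Word.base (FreeGroup.of c)⁻¹) 1)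
  val_inv := by
    rw [← map_mul, MonoidAlgebra.single_mul_single, Word.base, Word.base, ← map_mul,
      mul_inv_cancel, map_one, mul_one, ← MonoidAlgebra.one_def, map_one]
  inv_val := by
    rw [← map_mul, MonoidAlgebra.single_mul_single, Word.base, Word.base, ← map_mul,
      inv_mul_cancel, map_one, mul_one, ← MonoidAlgebra.one_def, map_one]

/-- The split augmentation of `ε`: it has the values of `ε` on the words, in particular it is `1` on
each of the idempotents `e_j`. -/
def Augmentation.split (ε : D.Augmentation F) (i j : Fin m) : D.splitPart F i j →ₗ[F] F :=
  ε.toHom.toLinearMap ∘ₗ (D.splitPart F i j).subtype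

/-- Split-DGA homotopy of two split morphisms `f₁`, `f₂` to `F`: there are units `α i`, one for each
component, and a linear map `K` of degree `1` on the split algebra such that
`α i • f₁ - α j • f₂ = K ∘ ∂` on `A_ij` (the differential of `F` is zero) and
`K (x y) = K x f₂ y + (-1)^|x| f₁ x K y` for composable factors. -/
def SplitDGAHomotopic (f₁ f₂ : ∀ i j : Fin m, D.splitPart F i j →ₗ[F] F) : Prop :=
  ∃ (α : Fin m → Fˣ) (K : ∀ i j : Fin m, D.splitPart F i j →ₗ[F] F),
    (∀ (i j : Fin m) (n : ℤ), n + 1 ≠ 0 → ∀ x : D.splitPart F i j, x.1 ∈ D.gradedPart F n →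
      K i j x = 0) ∧
    (∀ (i j : Fin m) (x : D.splitPart F i j),
      (α i : F) * f₁ i j x - (α j : F) * f₂ i j x = K i j (splitDiff i j x)) ∧
    (∀ (i j l : Fin m) (n : ℤ) (x : D.splitPart F j l) (y : D.splitPart F i j),
      x.1 ∈ D.gradedPart F n →
      K i l (splitMul x y) =
        K j l x * f₂ i j y + (((-1 : Fˣ) ^ n : Fˣ) : F) * f₁ j l x * K i j y)

/-! ### The DGA of the perturbed copies -/

variable (D)

/-- The noninvertible generators of the DGA of the `n`-copy, perturbed by a Morse function with one
maximum and one minimum on each component, next to its base point: `a^{pq}` for each chord `a`, and,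
for `p < q`, one chord `x^{pq}` for each maximum and one chord `y^{pq}` for each minimum. -/
inductive CopyGen (n : ℕ) : Type
  | chord (a : D.Chord) (p q : Fin n) : CopyGen n
  | max (c : Fin m) (p q : Fin n) (h : p < q) : CopyGen n
  | min (c : Fin m) (p q : Fin n) (h : p < q) : CopyGen n

/-- The algebra of the `n`-copy, with invertible letters `t c p`. -/
abbrev CopyAlg (n : ℕ) (F : Type*) [CommRing F] : Type _ :=
  MonoidAlgebra F (Monoid.Coprod (FreeMonoid (D.CopyGen n)) (FreeGroup (Fin m × Fin n)))

variable (F)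

/-- A generator as an element of the algebra of the `n`-copy. -/
def copyGen {n : ℕ} (g : D.CopyGen n) : D.CopyAlg n F :=
  MonoidAlgebra.single (Monoid.Coprod.inl (FreeMonoid.of g)) 1

def copyBase {n : ℕ} (g : FreeGroup (Fin m × Fin n)) : D.CopyAlg n F :=
  MonoidAlgebra.single (Monoid.Coprod.inr g) 1

/-- The matrix `A` of the chords `a^{pq}`. -/
def chordMatrix (n : ℕ) (a : D.Chord) : Matrix (Fin n) (Fin n) (D.CopyAlg n F) :=
  Matrix.of fun p q => D.copyGen F (.chord a p q)

/-- The upper unitriangular matrix `X_c` of the chords `x_c^{pq}`, minus the identity. -/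
def maxMatrix (n : ℕ) (c : Fin m) : Matrix (Fin n) (Fin n) (D.CopyAlg n F) :=
  Matrix.of fun p q => if h : p < q then D.copyGen F (.max c p q h) else 0

/-- The strictly upper triangular matrix `Y_c` of the chords `y_c^{pq}`. -/
def minMatrix (n : ℕ) (c : Fin m) : Matrix (Fin n) (Fin n) (D.CopyAlg n F) :=
  Matrix.of fun p q => if h : p < q then D.copyGen F (.min c p q h) else 0

/-- The diagonal matrix `Δ_c` of the letters `t c p`. -/
def baseMatrix (n : ℕ) (c : Fin m) : (Matrix (Fin n) (Fin n) (D.CopyAlg n F))ˣ where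
  val := Matrix.diagonal fun p => D.copyBase F (FreeGroup.of (c, p))
  inv := Matrix.diagonal fun p => D.copyBase F (FreeGroup.of (c, p))⁻¹
  val_inv := by
    rw [Matrix.diagonal_mul_diagonal, ← Matrix.diagonal_one]
    congr 1
    funext p
    simp [copyBase, MonoidAlgebra.single_mul_single, ← map_mul, MonoidAlgebra.one_def]
  inv_val := by
    rw [Matrix.diagonal_mul_diagonal, ← Matrix.diagonal_one]
    congr 1
    funext p
    simp [copyBase, MonoidAlgebra.single_mul_single, ← map_mul, MonoidAlgebra.one_def]

theorem isNilpotent_maxMatrix (n : ℕ) (c : Fin m) : IsNilpotent (D.maxMatrix F n c) := by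
  have key : ∀ (r : ℕ) (p q : Fin n), q.1 < p.1 + r → (D.maxMatrix F n c ^ r) p q = 0 := by
    intro r
    induction r with
    | zero =>
      intro p q h
      rw [pow_zero, Matrix.one_apply_ne (by intro e; subst e; simp at h)]
    | succ r ih =>
      intro p q h
      rw [pow_succ, Matrix.mul_apply]
      refine Finset.sum_eq_zero fun s _ => ?_
      by_cases hs : s.1 < p.1 + r
      · rw [ih p s hs, zero_mul]
      · have : ¬ s < q := by rw [Fin.lt_def]; omega
        simp [maxMatrix, this]
  exact ⟨n, by refine Matrix.ext fun p q => ?_; exact key n p q (by omega)⟩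

/-- The invertible matrix `X_c`. -/
def unitMaxMatrix (n : ℕ) (c : Fin m) : (Matrix (Fin n) (Fin n) (D.CopyAlg n F))ˣ :=
  (D.isNilpotent_maxMatrix F n c).isUnit_one_add.unit

/-- The homomorphism `Φ` with `Φ(a) = A` and `Φ(t c) = Δ_c X_c`. -/
def copyHom (n : ℕ) : D.Alg F →ₐ[F] Matrix (Fin n) (Fin n) (D.CopyAlg n F) :=
  MonoidAlgebra.lift F (Matrix (Fin n) (Fin n) (D.CopyAlg n F)) D.Word
    (Monoid.Coprod.lift (FreeMonoid.lift (D.chordMatrix F n))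
      ((Units.coeHom _).comp
        (FreeGroup.lift fun c => D.baseMatrix F n c * D.unitMaxMatrix F n c)))

variable {D}

/-- The differential of the DGA of the `n`-copy on its generators (it vanishes on the invertible
letters): the entries of
`∂A = Φ(∂a) + Y_{target a} A + (-1)^{|a|+1} A Y_{source a}`, `∂X = Δ⁻¹ Y Δ X - X Y`, `∂Y = Y²`. -/
def copyDiff {n : ℕ} : D.CopyGen n → D.CopyAlg n F
  | .chord a p q =>
    (D.copyHom F n (chordDiff F a) + D.minMatrix F n a.target * D.chordMatrix F n a +
      (((-1 : ℤˣ) ^ (a.degree + 1) : ℤˣ) : ℤ) •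
        (D.chordMatrix F n a * D.minMatrix F n a.source)) p q
  | .max c p q _ =>
    ((D.baseMatrix F n c)⁻¹.val * D.minMatrix F n c * (D.baseMatrix F n c).val *
        (D.unitMaxMatrix F n c).val - (D.unitMaxMatrix F n c).val * D.minMatrix F n c) p q
  | .min c p q _ => (D.minMatrix F n c * D.minMatrix F n c) p q

variable {F}

/-- The homomorphism `φ_ε` to the free algebra on the noninvertible generators for a tuple of
augmentations, one for each copy: `t c p ↦ ε_p(t c)`, `a^{pp} ↦ a^{pp} + ε_p(a)`, and all mixed
generators are fixed. -/
def twist {n : ℕ} (ε : Fin n → D.Augmentation F) :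
    D.CopyAlg n F →ₐ[F] MonoidAlgebra F (FreeMonoid (D.CopyGen n)) :=
  MonoidAlgebra.lift F (MonoidAlgebra F (FreeMonoid (D.CopyGen n))) _
    (Monoid.Coprod.lift
      (FreeMonoid.lift fun g => MonoidAlgebra.single (FreeMonoid.of g) 1 +
        (match g with
          | .chord a p q =>
            if p = q then
              algebraMap F (MonoidAlgebra F (FreeMonoid (D.CopyGen n)))
                ((ε p).toHom (MonoidAlgebra.single (Word.chord a) 1))
            else 0
          | _ => (0 : MonoidAlgebra F (FreeMonoid (D.CopyGen n)))))
      ((Units.coeHom _).comp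
        (FreeGroup.lift fun cp =>
          Units.map (algebraMap F (MonoidAlgebra F (FreeMonoid (D.CopyGen n)))).toMonoidHom
            ((ε cp.2).baseValue cp.1))))

/-! ### The augmentation category -/

variable (D)

/-- The generators of the morphism spaces of the augmentation category: one for each chord of the
link, and one for each maximum and each minimum of the Morse function. -/
inductive HomGen : Type
  | chord (a : D.Chord)
  | max (c : Fin m)
  | min (c : Fin m)

variable {D}

namespace HomGen

/-- The grading `|·|₊` of the morphism spaces. -/
def degree : D.HomGen → ℤ
  | chord a => a.degree + 1
  | max _ => 1
  | min _ => 0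

/-- The chord from copy `q` to copy `p` in the `n`-copy. -/
def copy {n : ℕ} (g : D.HomGen) (p q : Fin n) (h : p < q) : D.CopyGen n :=
  match g with
  | chord a => .chord a p q
  | max c => .max c p q h
  | min c => .min c p q h

def equivSum : D.HomGen ≃ D.Chord ⊕ (Fin m ⊕ Fin m) where
  toFun
    | chord a => .inl a
    | max c => .inr (.inl c)
    | min c => .inr (.inr c)
  invFun
    | .inl a => chord a
    | .inr (.inl c) => max c
    | .inr (.inr c) => min c
  left_inv g := by cases g <;> rfl
  right_inv g := by rcases g with a | c | c <;> rfl

instance : Fintype D.HomGen := Fintype.ofEquiv _ equivSum.symm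

end HomGen

/-- The morphism space `Hom₊(ε₁, ε₂)`, the free module on the generators. -/
abbrev HomPlus (_ε₁ _ε₂ : D.Augmentation F) : Type _ := D.HomGen → F

/-- Homogeneous morphisms of degree `n`. -/
def IsHomogeneous {ε₁ ε₂ : D.Augmentation F} (f : HomPlus ε₁ ε₂) (n : ℤ) : Prop :=
  ∀ g, f g ≠ 0 → g.degree = n

/-- The composition `m₁`; its matrix entry from `b` to `a` is the coefficient of `b¹²` in
`∂_ε a¹²`. -/
def mOne {ε₁ ε₂ : D.Augmentation F} (f : HomPlus ε₁ ε₂) : HomPlus ε₁ ε₂ := fun a =>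
  ∑ b : D.HomGen, f b *
    (twist ![ε₁, ε₂] (copyDiff F (a.copy 0 1 (by decide)))).coeff
      (FreeMonoid.of (b.copy 0 1 (by decide)))

/-- The composition `m₂ : Hom₊(ε₂, ε₃) ⊗ Hom₊(ε₁, ε₂) → Hom₊(ε₁, ε₃)`; its coefficient at `a` on
the generators `b₂ ⊗ b₁` is the coefficient of `b₁¹² b₂²³` in `∂_ε a¹³`, with the sign
`(-1)^{1 + |b₁|₊ |b₂|₊ + |b₁|₊}`. -/
def mTwo {ε₁ ε₂ ε₃ : D.Augmentation F} (f₂ : HomPlus ε₂ ε₃) (f₁ : HomPlus ε₁ ε₂) :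
    HomPlus ε₁ ε₃ := fun a =>
  ∑ b₂ : D.HomGen, ∑ b₁ : D.HomGen, f₂ b₂ * f₁ b₁ *
    ((((-1 : Fˣ) ^ (1 + b₁.degree * b₂.degree + b₁.degree) : Fˣ) : F) *
      (twist ![ε₁, ε₂, ε₃] (copyDiff F (a.copy 0 2 (by decide)))).coeff
        (FreeMonoid.of (b₁.copy 0 1 (by decide)) * FreeMonoid.of (b₂.copy 1 2 (by decide))))

/-- The unit of `Hom₊(ε, ε)`: minus the sum of the generators of the minima. -/
def unit (ε : D.Augmentation F) : HomPlus ε ε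
  | .min _ => -1
  | _ => 0

/-- Two cocycles of degree `0` represent the same class in `H⁰ Hom₊(ε₁, ε₂)`. -/
def Cohomologous {ε₁ ε₂ : D.Augmentation F} (f g : HomPlus ε₁ ε₂) : Prop :=
  ∃ h : HomPlus ε₁ ε₂, IsHomogeneous h (-1) ∧ f - g = mOne h

/-- Equivalence in the augmentation category: the augmentations are isomorphic in its cohomology
category. -/
def AugEquivalent (ε₁ ε₂ : D.Augmentation F) : Prop :=
  ∃ (f : HomPlus ε₁ ε₂) (g : HomPlus ε₂ ε₁),
    IsHomogeneous f 0 ∧ mOne f = 0 ∧ IsHomogeneous g 0 ∧ mOne g = 0 ∧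
    Cohomologous (mTwo f g) (unit ε₂) ∧ Cohomologous (mTwo g f) (unit ε₁)

end FrontDiagram
end Legendrian
end

/-!
Let `t`, `S` be values for the invertible letters and the chords in a ring, and `Y` an element for
each component. Call `obstruction F t S Y a` the defect of `∂ + [Y, ·]` at the chord `a`. The disks
cut off at a slice of the front are counted by a matrix indexed by the strands of that slice, and
this matrix satisfies a Maurer–Cartan equation as long as the obstructions at all chords further to
the left vanish (`maurerCartan_diskSum`): crossings and base points conjugate it, cusps add or
cancel a block. Read between the two strands at the next chord, the equation is the Bianchi identity
for the next obstruction (`obstruction_closed`); this is the form in which `∂² = 0` is used.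

Apply this with upper triangular matrices: augmentations `ε p` on the diagonal and coefficients of
morphisms from `ε p` to `ε q` at the entry `p q` give a representation `copyEval ε κ` of the algebra
of the link, and by the formula for the differential of the copies the entries of its obstruction
are the compositions `m₁` and `m₂` (`mOne_chord`, `mTwo_chord`).

For two augmentations, a morphism of degree `0` is a function `f` on the chords of degree `-1`
together with a coefficient `α c` at each minimum, and its obstruction at a chord is the homotopy
equation there for the entry `0 1` of `copyEval`, which is a derivation and hence the only possible
`K`. If the morphism is closed, the equation propagates to all composable words (`copyEval_diff`);
the equation at the maxima says that the values at the invertible letters agree, once `α` is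
invertible, and `α` is invertible because the composition at a minimum is, up to sign, the product.
Conversely a split-DGA homotopy `K` is determined by its values on chords (`homotopy_eq_copyEval`),
so it defines a closed morphism.

It remains to invert a closed morphism `f` with invertible `α`. Put `f`, `g`, `f` between four
copies `ε₁, ε₂, ε₁, ε₂`, with a further morphism `h` from the second to the fourth. Going through
the chords from left to right, the values of `g` and `h` can be chosen such that the obstruction
vanishes in the entries `0 2` and `0 3`, as `α` is invertible (`exists_zigzag`). Since `f` is
closed, the entries `0 1` and `2 3` vanish, and then so do `1 2` and `1 3`, by the Bianchi identity
and the invertibility of `α` once more (`zigzag_obstruction_eq_zero`). The blocks of the vanishing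
obstruction say that `g` is closed, that `m₂ (g, f)` is the unit, and that `m₂ (f, g)` is the unit
up to `m₁ h`.
-/

noncomputable section

namespace Legendrian

/-! ### Maurer–Cartan matrices -/

namespace FrontEvent

theorem skip_ne (k i : ℕ) : skip k i ≠ k := by
  simp only [skip]; split_ifs <;> omega

theorem skip_ne_succ (k i : ℕ) : skip k i ≠ k + 1 := by
  simp only [skip]; split_ifs <;> omega

theorem skip_lt_skip {k i j : ℕ} : skip k i < skip k j ↔ i < j := by
  simp only [skip]; split_ifs <;> omega

theorem skip_lt {k n : ℕ} (hk : k ≤ n) {i : ℕ} : skip k i < n + 2 ↔ i < n := by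
  simp only [skip]; split_ifs <;> omega

theorem eq_or_eq_skip {k n : ℕ} (hk : k ≤ n) {i : ℕ} (hi : i < n + 2) :
    k = i ∨ k + 1 = i ∨ ∃ p < n, skip k p = i := by
  rcases lt_trichotomy i k with h | h | h
  · exact .inr (.inr ⟨i, by omega, by simp [skip, h]⟩)
  · exact .inl h.symm
  · by_cases h' : i = k + 1
    · exact .inr (.inl h'.symm)
    · refine .inr (.inr ⟨i - 2, by omega, ?_⟩)
      simp only [skip]; split_ifs <;> omega

theorem sum_range_skip {M : Type*} [AddCommMonoid M] {k n : ℕ} (hk : k ≤ n) (f : ℕ → M) :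
    ∑ l ∈ Finset.range (n + 2), f l = f k + f (k + 1) + ∑ l ∈ Finset.range n, f (skip k l) := by
  have h : Finset.range (n + 2) =
      insert k (insert (k + 1) ((Finset.range n).image (skip k))) := by
    ext i
    simp only [Finset.mem_range, Finset.mem_insert, Finset.mem_image]
    constructor
    · intro hi
      rcases eq_or_eq_skip hk hi with h | h | ⟨p, hp, h⟩
      · exact .inl h.symm
      · exact .inr (.inl h.symm)
      · exact .inr (.inr ⟨p, hp, h⟩)
    · rintro (h | h | ⟨p, hp, rfl⟩)
      · omega
      · omega
      · exact (skip_lt hk).2 hp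
  rw [h, Finset.sum_insert, Finset.sum_insert, Finset.sum_image, add_assoc]
  · intro i _ j _ e
    by_contra hne
    rcases Nat.lt_or_gt_of_ne hne with h | h
    · exact absurd (skip_lt_skip (k := k).2 h) (by simp [e])
    · exact absurd (skip_lt_skip (k := k).2 h) (by simp [e])
  · simp [skip_ne_succ]
  · simp [skip_ne]

end FrontEvent

open FrontEvent

section Pairing

variable {R : Type*} [Ring R]

/-- The signed pairing `∑ σ_l u_l v_l` of a row and a column. -/
def pairing (n : ℕ) (σ : ℕ → ℤ) (u v : ℕ → R) : R :=
  ∑ l ∈ Finset.range n, σ l • (u l * v l)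

variable {n : ℕ} {σ : ℕ → ℤ} {u u' v v' : ℕ → R}

theorem pairing_add_left : pairing n σ (fun l => u l + u' l) v =
    pairing n σ u v + pairing n σ u' v := by
  simp only [pairing, add_mul, smul_add, Finset.sum_add_distrib]

theorem pairing_add_right : pairing n σ u (fun l => v l + v' l) =
    pairing n σ u v + pairing n σ u v' := by
  simp only [pairing, mul_add, smul_add, Finset.sum_add_distrib]

theorem pairing_mul_left (a : R) : pairing n σ (fun l => a * u l) v = a * pairing n σ u v := by
  simp only [pairing, mul_assoc, Finset.mul_sum, mul_smul_comm]

theorem pairing_mul_right (a : R) : pairing n σ u (fun l => v l * a) = pairing n σ u v * a := by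
  simp only [pairing, mul_assoc, Finset.sum_mul, smul_mul_assoc]

theorem pairing_smul_left (c : ℤ) : pairing n σ (fun l => c • u l) v = c • pairing n σ u v := by
  simp only [pairing, smul_mul_assoc, Finset.smul_sum]
  exact Finset.sum_congr rfl fun _ _ => smul_comm _ _ _

theorem pairing_eq_zero (h : ∀ l < n, u l * v l = 0) : pairing n σ u v = 0 :=
  Finset.sum_eq_zero fun l hl => by rw [h l (Finset.mem_range.1 hl), smul_zero]

theorem pairing_congr {σ' : ℕ → ℤ} (hσ : ∀ l < n, σ l = σ' l) (hu : ∀ l < n, u l = u' l)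
    (hv : ∀ l < n, v l = v' l) : pairing n σ u v = pairing n σ' u' v' :=
  Finset.sum_congr rfl fun l hl => by
    have hl := Finset.mem_range.1 hl
    rw [hσ l hl, hu l hl, hv l hl]

theorem pairing_skip {k : ℕ} (hk : k ≤ n) (u v : ℕ → R) :
    pairing (n + 2) σ u v = σ k • (u k * v k) + σ (k + 1) • (u (k + 1) * v (k + 1)) +
      pairing n (fun l => σ (skip k l)) (fun l => u (skip k l)) (fun l => v (skip k l)) :=
  sum_range_skip hk _

end Pairing

/-- The Maurer–Cartan equation: for the upper triangular `n × n` matrix `M` with diagonal `y` and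
off-diagonal part `z`, and the diagonal matrix `σ` of signs, the product `M σ M` is diagonal. -/
structure MaurerCartan {R : Type*} [Ring R] (n : ℕ) (σ : ℕ → ℤ) (y : ℕ → R) (z : ℕ → ℕ → R) :
    Prop where
  upper : ∀ i j, ¬ i < j → z i j = 0
  sign : ∀ l, σ l = 1 ∨ σ l = -1
  eq : ∀ i < n, ∀ j < n, pairing n σ (z i) (fun l => z l j) + σ i • (y i * z i j) +
    σ j • (z i j * y j) = 0

namespace MaurerCartan

variable {R : Type*} [Ring R] {n : ℕ} {σ σ' : ℕ → ℤ} {y y' : ℕ → R} {z z' : ℕ → ℕ → R}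

theorem mk_of_lt (upper : ∀ i j, ¬ i < j → z i j = 0) (sign : ∀ l, σ l = 1 ∨ σ l = -1)
    (eq : ∀ i j, i < j → j < n → pairing n σ (z i) (fun l => z l j) + σ i • (y i * z i j) +
      σ j • (z i j * y j) = 0) : MaurerCartan n σ y z where
  upper := upper
  sign := sign
  eq i _ j hj := by
    by_cases h : i < j
    · exact eq i j h hj
    · rw [upper i j h, pairing_eq_zero]
      · simp
      · intro l _
        by_cases h' : i < l
        · rw [upper l j (by omega), mul_zero]
        · rw [upper i l h', zero_mul]

theorem congr (h : MaurerCartan n σ y z) (upper : ∀ i j, ¬ i < j → z' i j = 0)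
    (sign : ∀ l, σ' l = 1 ∨ σ' l = -1) (hσ : ∀ l < n, σ' l = σ l) (hy : ∀ l < n, y' l = y l)
    (hz : ∀ i j, i < n → j < n → z' i j = z i j) : MaurerCartan n σ' y' z' where
  upper := upper
  sign := sign
  eq i hi j hj := by
    rw [hz i j hi hj, hσ i hi, hσ j hj, hy i hi, hy j hj,
      pairing_congr hσ (fun l hl => hz i l hi hl) (fun l hl => hz l j hl hj), h.eq i hi j hj]

/-- Next to the diagonal the quadratic term is empty. -/
theorem eq_succ (h : MaurerCartan n σ y z) {k : ℕ} (hk : k + 1 < n) :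
    σ k • (y k * z k (k + 1)) + σ (k + 1) • (z k (k + 1) * y (k + 1)) = 0 := by
  have := h.eq k (by omega) (k + 1) hk
  rwa [pairing_eq_zero, zero_add] at this
  intro l _
  by_cases h' : k < l
  · rw [h.upper l (k + 1) (by omega), mul_zero]
  · rw [h.upper k l h', zero_mul]

/-- Conjugation by a diagonal matrix that commutes with `y`, as it happens at a base point. -/
theorem conj (h : MaurerCartan n σ y z) {u v : ℕ → R} (huv : ∀ l < n, v l * u l = 1)
    (hu : ∀ l < n, Commute (y l) (u l)) (hv : ∀ l < n, Commute (v l) (y l)) :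
    MaurerCartan n σ y (fun i j => u i * z i j * v j) where
  upper i j hij := by rw [h.upper i j hij, mul_zero, zero_mul]
  sign := h.sign
  eq i hi j hj := by
    have e : pairing n σ (fun l => u i * z i l * v l) (fun l => u l * z l j * v j) =
        u i * pairing n σ (z i) (fun l => z l j) * v j := by
      rw [← pairing_mul_left, ← pairing_mul_right]
      refine Finset.sum_congr rfl fun l hl => ?_
      congr 1
      calc u i * z i l * v l * (u l * z l j * v j) =
          u i * z i l * (v l * u l) * z l j * v j := by simp only [mul_assoc]
        _ = _ := by rw [huv l (Finset.mem_range.1 hl), mul_one]; simp only [mul_assoc]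
    have e₁ : y i * (u i * z i j * v j) = u i * (y i * z i j) * v j := by
      simp only [← mul_assoc, (hu i hi).eq]
    have e₂ : u i * z i j * v j * y j = u i * (z i j * y j) * v j := by
      simp only [mul_assoc, (hv j hj).eq]
    have := congrArg (fun x => u i * x * v j) (h.eq i hi j hj)
    simp only [mul_add, add_mul, mul_smul_comm, smul_mul_assoc, mul_zero, zero_mul] at this
    rw [e, e₁, e₂]
    exact this

/-- The equation at `i j`, solved for the sum over the strands other than `k` and `k + 1`. -/
theorem eq_skip {k : ℕ} (hk : k ≤ n) (h : MaurerCartan (n + 2) σ y z) {i j : ℕ} (hi : i < n + 2)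
    (hj : j < n + 2) :
    pairing n (fun l => σ (skip k l)) (fun l => z i (skip k l)) (fun l => z (skip k l) j) =
      -(σ k • (z i k * z k j) + σ (k + 1) • (z i (k + 1) * z (k + 1) j) +
        σ i • (y i * z i j) + σ j • (z i j * y j)) := by
  have := h.eq i hi j hj
  rw [pairing_skip hk] at this
  rw [eq_neg_iff_add_eq_zero, ← this]
  abel

/-- At a left cusp a block with the single entry `1` is added. -/
theorem leftCusp {k : ℕ} (hk : k ≤ n) (h : MaurerCartan n σ y z)
    (sign : ∀ l, σ' l = 1 ∨ σ' l = -1) (hσ : ∀ l < n, σ' (skip k l) = σ l)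
    (hσk : σ' (k + 1) = -σ' k) (hy : ∀ l < n, y' (skip k l) = y l) (hyk : y' (k + 1) = y' k)
    (hz : ∀ i j, z' (skip k i) (skip k j) = z i j) (hone : z' k (k + 1) = 1)
    (hzero : ∀ i j, (i = k ∨ i = k + 1 ∨ j = k ∨ j = k + 1) → ¬ (i = k ∧ j = k + 1) →
      z' i j = 0)
    (upper : ∀ i j, ¬ i < j → z' i j = 0) :
    MaurerCartan (n + 2) σ' y' z' := by
  refine mk_of_lt upper sign fun i j hij hj => ?_
  rw [pairing_skip hk]
  have e : ∀ p, skip k p ≠ k := skip_ne k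
  have e' : ∀ p, skip k p ≠ k + 1 := skip_ne_succ k
  have z1 : ∀ p, z' k (skip k p) = 0 := fun p => hzero _ _ (by simp) (by simp [e'])
  have z2 : ∀ p, z' (k + 1) (skip k p) = 0 := fun p => hzero _ _ (by simp) (by simp)
  have z3 : ∀ p, z' (skip k p) k = 0 := fun p => hzero _ _ (by simp) (by simp)
  have z4 : ∀ p, z' (skip k p) (k + 1) = 0 := fun p => hzero _ _ (by simp) (by simp [e])
  have z5 : z' k k = 0 := upper _ _ (by simp)
  have z6 : z' (k + 1) (k + 1) = 0 := upper _ _ (by simp)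
  rcases eq_or_eq_skip hk (hij.trans hj) with rfl | rfl | ⟨p, hp, rfl⟩ <;>
    rcases eq_or_eq_skip hk hj with rfl | rfl | ⟨q, hq, rfl⟩
  · omega
  · rw [pairing_eq_zero (by simp [z1]), z5, hσk, hone, hyk]
    simp [z6]
  · rw [pairing_eq_zero (by simp [z1])]; simp [z1, z2]
  · omega
  · omega
  · rw [pairing_eq_zero (by simp [z2])]; simp [z1, z2]
  · rw [pairing_eq_zero (by simp [z3])]; simp [z3, z4]
  · rw [pairing_eq_zero (by simp [z4])]; simp [z3, z4]
  · rw [pairing_congr hσ (fun l _ => hz p l) (fun l _ => hz l q), z3, z4, hσ p hp, hσ q hq, hz,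
      hy p hp, hy q hq]
    simpa using h.eq p hp q hq

/-- At a crossing the matrix is conjugated by an elementary matrix, which clears the entry at
`k (k + 1)` by the hypothesis `ha`, and the strands `k` and `k + 1` are exchanged. -/
theorem crossing {k : ℕ} (hk : k ≤ n) {a : R} {c : ℤ} (h : MaurerCartan (n + 2) σ y z)
    (hc : c = -(σ k * σ (k + 1)))
    (ha : z k (k + 1) + y k * a + c • (a * y (k + 1)) = 0)
    (sign : ∀ l, σ' l = 1 ∨ σ' l = -1)
    (hσ : ∀ l < n + 2, σ' l = σ (Equiv.swap k (k + 1) l))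
    (hy : ∀ l < n + 2, y' l = y (Equiv.swap k (k + 1) l))
    (hz : ∀ i j, i < j → z' i j = z (Equiv.swap k (k + 1) i) (Equiv.swap k (k + 1) j) +
      (if i = k + 1 then c • (a * z i j) else 0) + (if j = k then z i j * a else 0))
    (upper : ∀ i j, ¬ i < j → z' i j = 0) :
    MaurerCartan (n + 2) σ' y' z' := by
  have e : ∀ p, skip k p ≠ k := skip_ne k
  have e' : ∀ p, skip k p ≠ k + 1 := skip_ne_succ k
  have sw : ∀ p, Equiv.swap k (k + 1) (skip k p) = skip k p := fun p =>
    Equiv.swap_apply_of_ne_of_ne (e p) (e' p)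
  have z1 : ∀ p q, z' (skip k p) (skip k q) = z (skip k p) (skip k q) := by
    intro p q
    by_cases hpq : skip k p < skip k q
    · rw [hz _ _ hpq]; simp [sw, e, e']
    · rw [h.upper _ _ hpq, upper _ _ hpq]
  have z2 : ∀ p, z' (skip k p) k = z (skip k p) (k + 1) + z (skip k p) k * a := by
    intro p
    by_cases hp : skip k p < k
    · rw [hz _ _ hp]; simp [sw, e']
    · rw [h.upper _ _ hp, upper _ _ hp, h.upper _ _ (by have := e p; omega)]; simp
  have z3 : ∀ p, z' (skip k p) (k + 1) = z (skip k p) k := by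
    intro p
    by_cases hp : skip k p < k + 1
    · rw [hz _ _ hp]; simp [sw, e']
    · rw [upper _ _ hp, h.upper _ _ (by have := e p; omega)]
  have z4 : ∀ p, z' k (skip k p) = z (k + 1) (skip k p) := by
    intro p
    by_cases hp : k < skip k p
    · rw [hz _ _ hp]; simp [sw, e]
    · rw [upper _ _ hp, h.upper _ _ (by have := e' p; omega)]
  have z5 : ∀ p, z' (k + 1) (skip k p) = z k (skip k p) + a * (c • z (k + 1) (skip k p)) := by
    intro p
    by_cases hp : k + 1 < skip k p
    · rw [hz _ _ hp]; simp only [sw, e, Equiv.swap_apply_right, if_true, if_false, add_zero,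
        mul_smul_comm]
    · rw [upper _ _ hp, h.upper _ _ hp, h.upper _ _ (by have := e' p; omega)]; simp
  have z6 : z' k (k + 1) = 0 := by
    rw [hz _ _ (by omega)]; simp [h.upper (k + 1) k (by omega)]
  have z7 : z' (k + 1) k = 0 := upper _ _ (by omega)
  have z8 : z' k k = 0 := upper _ _ (by omega)
  have z9 : z' (k + 1) (k + 1) = 0 := upper _ _ (by omega)
  have s1 : σ' k = σ (k + 1) := by rw [hσ k (by omega)]; simp
  have s2 : σ' (k + 1) = σ k := by rw [hσ (k + 1) (by omega)]; simp
  have y1 : y' k = y (k + 1) := by rw [hy k (by omega)]; simp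
  have y2 : y' (k + 1) = y k := by rw [hy (k + 1) (by omega)]; simp
  have s3 : ∀ p < n, σ' (skip k p) = σ (skip k p) := fun p hp => by
    rw [hσ _ ((skip_lt hk).2 hp), sw]
  have y3 : ∀ p < n, y' (skip k p) = y (skip k p) := fun p hp => by
    rw [hy _ ((skip_lt hk).2 hp), sw]
  have hb : z k (k + 1) = -(y k * a) - c • (a * y (k + 1)) := by
    rw [← sub_eq_zero, ← ha]; abel
  have u1 : z (k + 1) k = 0 := h.upper _ _ (by omega)
  have u2 : z k k = 0 := h.upper _ _ (by omega)
  have u3 : z (k + 1) (k + 1) = 0 := h.upper _ _ (by omega)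
  have l1 : k < n + 2 := by omega
  have l2 : k + 1 < n + 2 := by omega
  refine mk_of_lt upper sign fun i j hij hj => ?_
  rw [pairing_skip hk]
  rcases eq_or_eq_skip hk (hij.trans hj) with rfl | rfl | ⟨p, hp, rfl⟩ <;>
    rcases eq_or_eq_skip hk hj with rfl | rfl | ⟨q, hq, rfl⟩
  · omega
  · rw [pairing_eq_zero, z6, z8, z9]
    · simp
    · intro l _
      rw [z4, z3]
      by_cases hl : k + 1 < skip k l
      · rw [h.upper (skip k l) _ (by omega), mul_zero]
      · rw [h.upper _ _ hl, zero_mul]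
  · have := h.eq_skip hk l2 hj
    rw [pairing_congr s3 (fun l _ => z4 l) (fun l _ => z1 l q), this, z8, z6, u1, u3, z4, s1, y1,
      s3 q hq, y3 q hq]
    simp
  · omega
  · omega
  · have h1 := h.eq_skip hk l2 hj
    have h2 := h.eq_skip hk l1 hj
    rw [pairing_congr s3 (fun l _ => z5 l) (fun l _ => z1 l q), pairing_add_left, pairing_mul_left,
      pairing_smul_left, h1, h2, z7, z9, z5, s2, y2, s3 q hq, y3 q hq, u1, u2, u3, hb, hc]
    rcases h.sign k with t₀ | t₀ <;> rcases h.sign (k + 1) with t₁ | t₁ <;>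
      rcases h.sign (skip k q) with t₂ | t₂ <;>
      simp only [t₀, t₁, t₂, mul_one, one_smul, neg_smul, mul_neg, neg_neg] <;>
      noncomm_ring
  · have h1 := h.eq_skip hk (hij.trans hj) l2
    have h2 := h.eq_skip hk (hij.trans hj) l1
    rw [pairing_congr s3 (fun l _ => z1 p l) (fun l _ => z2 l), pairing_add_right,
      pairing_mul_right, h1, h2, z7, z8, z2, s1, y1, s3 p hp, y3 p hp, u1, u2, u3, hb, hc]
    rcases h.sign k with t₀ | t₀ <;> rcases h.sign (k + 1) with t₁ | t₁ <;>
      rcases h.sign (skip k p) with t₂ | t₂ <;>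
      simp only [t₀, t₁, t₂, mul_one, one_smul, neg_smul, mul_neg, neg_neg] <;>
      noncomm_ring
  · have h1 := h.eq_skip hk (hij.trans hj) l1
    rw [pairing_congr s3 (fun l _ => z1 p l) (fun l _ => z3 l), h1, z6, z9, z3, s2, y2, s3 p hp,
      y3 p hp, u1, u2]
    simp
  · have h1 := h.eq_skip hk (hij.trans hj) hj
    rw [pairing_congr s3 (fun l _ => z1 p l) (fun l _ => z1 l q), h1, z1, z2, z3, z4, z5, s1, s2,
      s3 p hp, y3 p hp, s3 q hq, y3 q hq, hc]
    rcases h.sign k with t₀ | t₀ <;> rcases h.sign (k + 1) with t₁ | t₁ <;>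
      rcases h.sign (skip k p) with t₂ | t₂ <;>
      rcases h.sign (skip k q) with t₃ | t₃ <;>
      simp only [t₀, t₁, t₂, t₃, mul_one, one_smul, neg_smul, mul_neg, neg_neg] <;>
      noncomm_ring

/-- At a right cusp the hypothesis `ha` says that the entry at `k (k + 1)` is `-1` up to terms in
`y`, and with it the strands `k` and `k + 1` are eliminated. -/
theorem rightCusp {k : ℕ} (hk : k ≤ n) {a : R} (h : MaurerCartan (n + 2) σ y z)
    (hσk : σ (k + 1) = -σ k) (hyk : y (k + 1) = y k)
    (ha : z k (k + 1) + 1 + y k * a + a * y k = 0)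
    (sign : ∀ l, σ' l = 1 ∨ σ' l = -1) (hσ : ∀ l < n, σ' l = σ (skip k l))
    (hy : ∀ l < n, y' l = y (skip k l))
    (hz : ∀ i j, z' i j = z (skip k i) (skip k j) +
      (z (skip k i) (k + 1) + z (skip k i) k * a) * (z k (skip k j) + a * z (k + 1) (skip k j)))
    (upper : ∀ i j, ¬ i < j → z' i j = 0) :
    MaurerCartan n σ' y' z' := by
  refine ⟨upper, sign, fun i hi j hj => ?_⟩
  have hb : z k (k + 1) = -1 - y k * a - a * y k := by
    rw [← sub_eq_zero, ← ha]; abel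
  have u1 : z (k + 1) k = 0 := h.upper _ _ (by omega)
  have u2 : z k k = 0 := h.upper _ _ (by omega)
  have u3 : z (k + 1) (k + 1) = 0 := h.upper _ _ (by omega)
  have l1 : k < n + 2 := by omega
  have l2 : k + 1 < n + 2 := by omega
  have li := (skip_lt hk).2 hi
  have lj := (skip_lt hk).2 hj
  set P : ℕ → R := fun i => z (skip k i) (k + 1) + z (skip k i) k * a with hP
  set Q : ℕ → R := fun j => z k (skip k j) + a * z (k + 1) (skip k j) with hQ
  -- A strand lies either above or below the cusp.
  have hQP : ∀ l, Q l * P l = 0 := by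
    intro l
    rcases Nat.lt_or_gt_of_ne (skip_ne k l) with hl | hl
    · simp [hQ, h.upper k (skip k l) (by omega), h.upper (k + 1) (skip k l) (by omega)]
    · simp [hP, h.upper (skip k l) k (by omega),
        h.upper (skip k l) (k + 1) (by have := skip_ne_succ k l; omega)]
  have expand : pairing n σ' (z' i) (fun l => z' l j) =
      pairing n (fun l => σ (skip k l)) (fun l => z (skip k i) (skip k l))
        (fun l => z (skip k l) (skip k j)) +
      pairing n (fun l => σ (skip k l)) (fun l => z (skip k i) (skip k l)) P * Q j +
      P i * pairing n (fun l => σ (skip k l)) Q (fun l => z (skip k l) (skip k j)) := by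
    rw [← pairing_mul_left, ← pairing_mul_right, pairing, pairing, pairing, pairing,
      ← Finset.sum_add_distrib, ← Finset.sum_add_distrib]
    refine Finset.sum_congr rfl fun l hl => ?_
    rw [hσ l (Finset.mem_range.1 hl), hz, hz, ← smul_add, ← smul_add]
    congr 1
    calc (z (skip k i) (skip k l) + P i * Q l) * (z (skip k l) (skip k j) + P l * Q j) =
        z (skip k i) (skip k l) * z (skip k l) (skip k j) +
          z (skip k i) (skip k l) * (P l * Q j) + P i * Q l * z (skip k l) (skip k j) +
          P i * (Q l * P l) * Q j := by noncomm_ring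
      _ = _ := by rw [hQP]; simp only [mul_zero, zero_mul, add_zero]
  have h1 := h.eq_skip hk li lj
  have h2 := h.eq_skip hk li l1
  have h3 := h.eq_skip hk li l2
  have h4 := h.eq_skip hk l1 lj
  have h5 := h.eq_skip hk l2 lj
  rw [expand, hz, hσ i hi, hσ j hj, hy i hi, hy j hj]
  simp only [hP, hQ]
  rw [pairing_add_left, pairing_mul_left, pairing_add_right, pairing_mul_right, h1, h2, h3, h4, h5,
    hσk, hyk, hb, u1, u2, u3]
  rcases h.sign k with s₀ | s₀ <;> rcases h.sign (skip k i) with s₁ | s₁ <;>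
    rcases h.sign (skip k j) with s₂ | s₂ <;>
      simp only [s₀, s₁, s₂, one_smul, neg_smul, neg_neg] <;> noncomm_ring

end MaurerCartan

namespace FrontDiagram

variable {m : ℕ} {D : FrontDiagram m}

/-! ### Evaluating words in a ring -/

theorem Word.induction {p : D.Word → Prop} (w : D.Word) (one : p 1)
    (chord : ∀ a, p (Word.chord a)) (base : ∀ c, p (Word.base (FreeGroup.of c)))
    (base_inv : ∀ c, p (Word.base (FreeGroup.of c)⁻¹))
    (mul : ∀ u v, p u → p v → p (u * v)) : p w := by
  induction w using Monoid.Coprod.induction_on with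
  | inl x =>
    induction x using FreeMonoid.inductionOn' with
    | one => simpa using one
    | of_mul b a ih => rw [map_mul]; exact mul _ _ (chord b) ih
  | inr x =>
    induction x using FreeGroup.induction_on with
    | C1 => simpa using one
    | of c => exact base c
    | inv_of c _ => exact base_inv c
    | mul x y hx hy => rw [map_mul]; exact mul _ _ hx hy
  | mul u v hu hv => exact mul u v hu hv

/-- The monoid homomorphism from words to a ring with prescribed values `S` on the chords and `t` on
the invertible letters. -/
def wordEval {R : Type*} [Monoid R] (t : Fin m → Rˣ) (S : D.Chord → R) : D.Word →* R :=
  Monoid.Coprod.lift (FreeMonoid.lift S) ((Units.coeHom R).comp (FreeGroup.lift t))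

section WordEval

variable {R : Type*} [Monoid R] (t : Fin m → Rˣ) (S : D.Chord → R)

@[simp] theorem wordEval_chord (a : D.Chord) : wordEval t S (Word.chord a) = S a := by
  simp [wordEval, Word.chord]

@[simp] theorem wordEval_base (c : Fin m) :
    wordEval t S (Word.base (FreeGroup.of c)) = (t c : R) := by
  simp [wordEval, Word.base]

@[simp] theorem wordEval_base_inv (c : Fin m) :
    wordEval t S (Word.base (FreeGroup.of c)⁻¹) = ((t c)⁻¹ : Rˣ) := by
  simp [wordEval, Word.base]

end WordEval

/-- The algebra homomorphism with prescribed values on the generators. -/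
def eval (F : Type*) [CommRing F] {R : Type*} [Ring R] [Algebra F R] (t : Fin m → Rˣ)
    (S : D.Chord → R) : D.Alg F →ₐ[F] R :=
  MonoidAlgebra.lift F R D.Word (wordEval t S)

theorem eval_single {F : Type*} [CommRing F] {R : Type*} [Ring R] [Algebra F R] (t : Fin m → Rˣ)
    (S : D.Chord → R) (w : D.Word) :
    eval F t S (MonoidAlgebra.single w 1) = wordEval t S w := by
  rw [eval, MonoidAlgebra.lift_single, one_smul]

/-! ### Sums over disks, slice by slice -/

section DiskSum

variable {R : Type*} [Ring R] (φ : D.Word →* R)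

/-- The signed count of the disks that end in slice `s` between the strands `i` and `j`, with their
boundary words evaluated in a ring. -/
def diskSum (s i j : ℕ) : R := ∑ᶠ d : Disk D s i j, d.sign • φ d.word

theorem diskSum_eq_zero {s i j : ℕ} (h : ¬ (i < j ∧ j < D.width s)) : diskSum φ s i j = 0 := by
  have : IsEmpty (Disk D s i j) := ⟨fun d => h ⟨d.composable.1, d.composable.2.1⟩⟩
  exact finsum_of_isEmpty _

theorem diskSum_eq_finsum {s i j : ℕ} {ι : Type*} (e : ι → Disk D s i j)
    (he : Function.Bijective e) :
    diskSum φ s i j = ∑ᶠ x : ι, (e x).sign • φ (e x).word :=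
  (finsum_eq_of_bijective e he fun _ => rfl).symm

theorem finsum_sumElim {α β M : Type*} [Finite α] [Finite β] [AddCommMonoid M] (f : α ⊕ β → M) :
    ∑ᶠ x, f x = ∑ᶠ a, f (.inl a) + ∑ᶠ b, f (.inr b) := by
  have := Fintype.ofFinite α
  have := Fintype.ofFinite β
  simp [finsum_eq_sum_of_fintype]

theorem baseMark_eq_one {s : ℕ} (h : ∀ k, D.event s ≠ .basePoint k) (i : ℕ) (n : ℤ) :
    D.baseMark s i n = 1 := by
  unfold baseMark
  split
  · next k hk => exact absurd hk (h k)
  · rfl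

variable {s k : ℕ}

/-- The two strands that are born at a left cusp bound only the disk that starts there. -/
theorem diskSum_leftCusp_eq_zero (h : D.event s = .leftCusp k) {i j : ℕ}
    (hij : i = k ∨ i = k + 1 ∨ j = k ∨ j = k + 1) (hne : ¬ (i = k ∧ j = k + 1)) :
    diskSum φ (s + 1) i j = 0 := by
  have : IsEmpty (Disk D (s + 1) i j) := by
    refine ⟨fun x => ?_⟩
    cases x with
    | start _ h' hi' hj' =>
      obtain rfl : k = _ := by simpa [h] using h'
      exact hne ⟨hi', hj'⟩
    | pass _ hi' hj' _ d =>
      rw [h] at hi' hj'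
      simp only [FrontEvent.Joins, FrontEvent.skip] at hi' hj'
      split_ifs at hi' hj' <;> omega
    | cornerBelow _ h' => simp [h] at h'
    | cornerAbove _ h' => simp [h] at h'
    | cap _ h' => simp [h] at h'
  exact finsum_of_isEmpty _

variable (hs : s < D.numEvents)

include hs

theorem diskSum_basePoint (h : D.event s = .basePoint k) (i j : ℕ) :
    diskSum φ (s + 1) i j =
      φ (D.baseMark s i (-1)) * diskSum φ s i j * φ (D.baseMark s j 1) := by
  by_cases hij : i < j
  swap
  · rw [diskSum_eq_zero φ (by tauto), diskSum_eq_zero φ (by tauto)]; simp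
  have hi : ∀ i, (D.event s).Joins i i := fun i => by rw [h]; rfl
  rw [diskSum_eq_finsum φ (fun d : Disk D s i j => Disk.pass hs (hi i) (hi j) hij d)]
  · have := Fintype.ofFinite (Disk D s i j)
    simp only [diskSum, finsum_eq_sum_of_fintype, Finset.mul_sum, Finset.sum_mul]
    refine Finset.sum_congr rfl fun d _ => ?_
    simp only [Disk.sign, Disk.word, map_mul, mul_smul_comm, smul_mul_assoc]
  · refine ⟨fun d d' e => by simpa using e, fun x => ?_⟩
    cases x with
    | start _ h' => simp [h] at h'
    | pass _ hi' hj' _ d =>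
      obtain rfl := (hi i).injective hi'
      obtain rfl := (hi j).injective hj'
      exact ⟨d, rfl⟩
    | cornerBelow _ h' => simp [h] at h'
    | cornerAbove _ h' => simp [h] at h'
    | cap _ h' => simp [h] at h'

theorem diskSum_leftCusp_start (h : D.event s = .leftCusp k) {i j : ℕ} (hi : i = k)
    (hj : j = k + 1) : diskSum φ (s + 1) i j = 1 := by
  rw [diskSum_eq_finsum φ (fun _ : Unit => Disk.start hs h hi hj)]
  · simp [finsum_eq_sum_of_fintype, Disk.sign, Disk.word]
  · refine ⟨fun _ _ _ => rfl, fun x => ?_⟩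
    cases x with
    | start _ h' hi' hj' =>
      obtain rfl : k = _ := by simpa [h] using h'
      exact ⟨(), rfl⟩
    | pass _ hi' hj' _ d =>
      rw [h] at hi'
      simp only [FrontEvent.Joins, FrontEvent.skip] at hi'
      split_ifs at hi' <;> omega
    | cornerBelow _ h' => simp [h] at h'
    | cornerAbove _ h' => simp [h] at h'
    | cap _ h' => simp [h] at h'

theorem diskSum_leftCusp_skip (h : D.event s = .leftCusp k) {i j i' j' : ℕ}
    (hi : i' = FrontEvent.skip k i) (hj : j' = FrontEvent.skip k j) :
    diskSum φ (s + 1) i' j' = diskSum φ s i j := by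
  have hmono : i' < j' ↔ i < j := by
    simp only [hi, hj, FrontEvent.skip]; split_ifs <;> omega
  by_cases hij : i < j
  swap
  · rw [diskSum_eq_zero φ (by tauto), diskSum_eq_zero φ (by tauto)]
  have hi₀ : (D.event s).Joins i i' := by rw [h]; exact hi
  have hj₀ : (D.event s).Joins j j' := by rw [h]; exact hj
  rw [diskSum_eq_finsum φ
    (fun d : Disk D s i j => Disk.pass hs hi₀ hj₀ (hmono.2 hij) d)]
  · simp [diskSum, Disk.sign, Disk.word, baseMark_eq_one, h]
  · refine ⟨fun d d' e => by simpa using e, fun x => ?_⟩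
    cases x with
    | start _ h' hi' hj' =>
      obtain rfl : k = _ := by simpa [h] using h'
      simp only [FrontEvent.skip] at hi
      split_ifs at hi <;> omega
    | pass _ hi' hj' _ d =>
      obtain rfl := hi₀.injective hi'
      obtain rfl := hj₀.injective hj'
      exact ⟨d, rfl⟩
    | cornerBelow _ h' => simp [h] at h'
    | cornerAbove _ h' => simp [h] at h'
    | cap _ h' => simp [h] at h'

/-- After a crossing the disks that continue across it, with their strands exchanged, are joined by
those with a new corner on the upper or on the lower boundary. -/
theorem diskSum_crossing (h : D.event s = .crossing k) {i j : ℕ} (hij : i < j) :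
    diskSum φ (s + 1) i j =
      diskSum φ s (Equiv.swap k (k + 1) i) (Equiv.swap k (k + 1) j) +
      (if i = k + 1 then
        (if Even (chordAt hs (isReeb_crossing h)).degree then -1 else 1 : ℤ) •
          (φ (Word.chord (chordAt hs (isReeb_crossing h))) * diskSum φ s i j) else 0) +
      (if j = k then
        diskSum φ s i j * φ (Word.chord (chordAt hs (isReeb_crossing h))) else 0) := by
  have hJ : ∀ i, (D.event s).Joins (Equiv.swap k (k + 1) i) i := fun i => by
    rw [h]; simp [FrontEvent.Joins]
  have hb : ∀ i n, D.baseMark s i n = 1 := baseMark_eq_one (by simp [h])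
  set a := chordAt hs (isReeb_crossing h) with ha
  set i₀ := Equiv.swap k (k + 1) i
  set j₀ := Equiv.swap k (k + 1) j
  by_cases hi : i = k + 1
  · have hj : j ≠ k := by omega
    rw [if_pos hi, if_neg hj, add_zero]
    rw [diskSum_eq_finsum φ (Sum.elim
      (fun d : Disk D s i₀ j₀ => Disk.pass hs (hJ i) (hJ j) hij d)
      (fun d : Disk D s i j => Disk.cornerBelow hs h hi d)), finsum_sumElim]
    · congr 1
      · simp [diskSum, Disk.sign, Disk.word, hb]
      · have := Fintype.ofFinite (Disk D s i j)
        simp only [diskSum, finsum_eq_sum_of_fintype, Finset.mul_sum, Finset.smul_sum]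
        refine Finset.sum_congr rfl fun d _ => ?_
        simp only [Sum.elim_inr, Disk.sign, Disk.word, mul_smul, map_mul, mul_smul_comm, ← ha]
    · constructor
      · rintro (d | d) (d' | d') e <;> simp at e <;> rw [e]
      · intro x
        have hi₀ := hJ i
        have hj₀ := hJ j
        cases x with
        | start _ h' => simp [h] at h'
        | pass _ hi' hj' _ d =>
          obtain rfl := hi₀.injective hi'
          obtain rfl := hj₀.injective hj'
          exact ⟨.inl d, rfl⟩
        | cornerBelow _ h' hi' d =>
          obtain rfl : k = _ := by simpa [h] using h'
          exact ⟨.inr d, rfl⟩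
        | cornerAbove _ h' hj' =>
          obtain rfl : k = _ := by simpa [h] using h'
          exact absurd hj' hj
        | cap _ h' => simp [h] at h'
  by_cases hj : j = k
  · rw [if_neg hi, if_pos hj, add_zero]
    rw [diskSum_eq_finsum φ (Sum.elim
      (fun d : Disk D s i₀ j₀ => Disk.pass hs (hJ i) (hJ j) hij d)
      (fun d : Disk D s i j => Disk.cornerAbove hs h hj d)), finsum_sumElim]
    · congr 1
      · simp [diskSum, Disk.sign, Disk.word, hb]
      · have := Fintype.ofFinite (Disk D s i j)
        simp only [diskSum, finsum_eq_sum_of_fintype, Finset.sum_mul]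
        refine Finset.sum_congr rfl fun d _ => ?_
        simp only [Sum.elim_inr, Disk.sign, Disk.word, map_mul, smul_mul_assoc, ← ha]
    · constructor
      · rintro (d | d) (d' | d') e <;> simp at e <;> rw [e]
      · intro x
        have hi₀ := hJ i
        have hj₀ := hJ j
        cases x with
        | start _ h' => simp [h] at h'
        | pass _ hi' hj' _ d =>
          obtain rfl := hi₀.injective hi'
          obtain rfl := hj₀.injective hj'
          exact ⟨.inl d, rfl⟩
        | cornerBelow _ h' hi' d =>
          obtain rfl : k = _ := by simpa [h] using h'
          exact absurd hi' hi
        | cornerAbove _ h' hj' d =>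
          obtain rfl : k = _ := by simpa [h] using h'
          exact ⟨.inr d, rfl⟩
        | cap _ h' => simp [h] at h'
  · rw [if_neg hi, if_neg hj, add_zero, add_zero]
    rw [diskSum_eq_finsum φ (fun d : Disk D s i₀ j₀ => Disk.pass hs (hJ i) (hJ j) hij d)]
    · simp [diskSum, Disk.sign, Disk.word, hb]
    · refine ⟨fun d d' e => by simpa using e, fun x => ?_⟩
      have hi₀ := hJ i
      have hj₀ := hJ j
      cases x with
      | start _ h' => simp [h] at h'
      | pass _ hi' hj' _ d =>
        obtain rfl := hi₀.injective hi'
        obtain rfl := hj₀.injective hj'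
        exact ⟨d, rfl⟩
      | cornerBelow _ h' hi' d =>
        obtain rfl : k = _ := by simpa [h] using h'
        exact absurd hi' hi
      | cornerAbove _ h' hj' d =>
        obtain rfl : k = _ := by simpa [h] using h'
        exact absurd hj' hj
      | cap _ h' => simp [h] at h'

/-- After a right cusp the disks that continue across it are joined by those that surround its cap.
-/
theorem diskSum_rightCusp (h : D.event s = .rightCusp k) (i j : ℕ) :
    diskSum φ (s + 1) i j =
      diskSum φ s (FrontEvent.skip k i) (FrontEvent.skip k j) +
      (diskSum φ s (FrontEvent.skip k i) (k + 1) +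
        diskSum φ s (FrontEvent.skip k i) k * φ (Word.chord (chordAt hs (isReeb_rightCusp h)))) *
      (diskSum φ s k (FrontEvent.skip k j) +
        φ (Word.chord (chordAt hs (isReeb_rightCusp h))) *
          diskSum φ s (k + 1) (FrontEvent.skip k j)) := by
  have hmono : FrontEvent.skip k i < FrontEvent.skip k j ↔ i < j := by
    simp only [FrontEvent.skip]; split_ifs <;> omega
  have hJ : ∀ i, (D.event s).Joins (FrontEvent.skip k i) i := fun i => by rw [h]; rfl
  have hb : ∀ i n, D.baseMark s i n = 1 := baseMark_eq_one (by simp [h])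
  set a := chordAt hs (isReeb_rightCusp h) with ha
  let U : Bool → ℕ := fun u => if u then k else k + 1
  let V : Bool → ℕ := fun v => if v then k + 1 else k
  let ι : Type := Disk D s (FrontEvent.skip k i) (FrontEvent.skip k j) ⊕
    (Σ u : Bool, Disk D s (FrontEvent.skip k i) (U u)) ×
      (Σ v : Bool, Disk D s (V v) (FrontEvent.skip k j))
  let e : ι → Disk D (s + 1) i j := Sum.elim
    (fun d => Disk.pass hs (hJ i) (hJ j) (hmono.1 d.composable.1) d)
    (fun d => Disk.cap hs h d.1.1 d.2.1 rfl rfl rfl rfl d.1.2 d.2.2)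
  rw [diskSum_eq_finsum φ e, finsum_sumElim]
  · congr 1
    · simp [e, diskSum, Disk.sign, Disk.word, hb]
    · have i1 := fun i j => Fintype.ofFinite (Disk D s i j)
      simp only [diskSum, finsum_eq_sum_of_fintype, e, Sum.elim_inr, Disk.sign, Disk.word, ← ha]
      have key : ∀ x : (Σ u : Bool, Disk D s (FrontEvent.skip k i) (U u)) ×
          (Σ v : Bool, Disk D s (V v) (FrontEvent.skip k j)),
          (x.1.2.sign * x.2.2.sign) • φ (x.1.2.word * Word.chord a ^ x.1.1.toNat *
            (Word.chord a ^ x.2.1.toNat * x.2.2.word)) =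
          (x.1.2.sign • (φ x.1.2.word * φ (Word.chord a) ^ x.1.1.toNat)) *
            (x.2.2.sign • (φ (Word.chord a) ^ x.2.1.toNat * φ x.2.2.word)) := by
        intro x
        simp only [map_mul, map_pow, smul_mul_smul_comm]
      simp only [key]
      rw [Fintype.sum_prod_type]
      simp only [← Finset.mul_sum, ← Finset.sum_mul]
      congr 1
      · rw [Fintype.sum_sigma]
        simp only [Fintype.sum_bool, Bool.toNat_true, Bool.toNat_false, pow_zero, mul_one,
          pow_one, Finset.sum_mul, smul_mul_assoc]
        rw [add_comm]
        rfl
      · rw [Fintype.sum_sigma]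
        simp only [Fintype.sum_bool, Bool.toNat_true, Bool.toNat_false, pow_zero, one_mul,
          pow_one, Finset.mul_sum, mul_smul_comm]
        rw [add_comm]
        rfl
  · constructor
    · rintro (d | ⟨⟨u, d⟩, ⟨v, d'⟩⟩) (c | ⟨⟨u', c⟩, ⟨v', c'⟩⟩) H
      · simp only [e, Sum.elim_inl, Disk.pass.injEq, heq_eq_eq, true_and] at H
        rw [H]
      · simp [e] at H
      · simp [e] at H
      · simp only [e, Sum.elim_inr, Disk.cap.injEq] at H
        obtain ⟨-, -, -, -, -, rfl, rfl, H⟩ := H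
        obtain ⟨rfl, rfl⟩ : d = c ∧ d' = c' := by simpa using H
        rfl
    · intro x
      have hi₀ := hJ i
      have hj₀ := hJ j
      cases x with
      | start _ h' => simp [h] at h'
      | pass _ hi' hj' _ d =>
        obtain rfl := hi₀.injective hi'
        obtain rfl := hj₀.injective hj'
        exact ⟨.inl d, rfl⟩
      | cornerBelow _ h' => simp [h] at h'
      | cornerAbove _ h' => simp [h] at h'
      | cap _ h' u v hi' hj' hp hq d d' =>
        obtain rfl : k = _ := by simpa [h] using h'
        subst hi' hj' hp hq
        exact ⟨.inr ⟨⟨u, d⟩, ⟨v, d'⟩⟩, rfl⟩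

end DiskSum

/-! ### The Maurer–Cartan equation over the slices of a front -/

section

open FrontEvent

variable {F : Type*} [CommRing F] {R : Type*} [Ring R] [Algebra F R]

theorem eval_chordDiff (t : Fin m → Rˣ) (S : D.Chord → R) (a : D.Chord) :
    eval F t S (chordDiff F a) = diskSum (wordEval t S) a.idx a.pos (a.pos + 1) +
      (match D.event a.idx with
        | .rightCusp _ => 1
        | _ => 0) := by
  rw [chordDiff, map_add, diskSum]
  have := Fintype.ofFinite (Disk D a.idx a.pos (a.pos + 1))
  simp only [finsum_eq_sum_of_fintype, map_sum, map_zsmul, eval_single]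
  congr 1
  rcases D.event a.idx <;> simp

/-- The obstruction at a chord `a` for the values `S` on the chords and `t` on the invertible
letters to intertwine `∂` with the graded commutator with `Y`, where the component `c` has its own
element `Y c`. -/
def obstruction (F : Type*) [CommRing F] {R : Type*} [Ring R] [Algebra F R] (t : Fin m → Rˣ)
    (S : D.Chord → R) (Y : Fin m → R) (a : D.Chord) : R :=
  eval F t S (chordDiff F a) + Y a.target * S a +
    (((-1 : ℤˣ) ^ (a.degree + 1) : ℤˣ) : ℤ) • (S a * Y a.source)

/-- The sign of the strand in position `l` of slice `s`. -/
def strandSign (D : FrontDiagram m) (s l : ℕ) : ℤ := (((-1 : ℤˣ) ^ D.pot s l : ℤˣ) : ℤ)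

theorem strandSign_eq (s l : ℕ) : D.strandSign s l = 1 ∨ D.strandSign s l = -1 := by
  rcases Int.units_eq_one_or ((-1 : ℤˣ) ^ D.pot s l) with h | h <;> simp [strandSign, h]

theorem joins_sign {s : ℕ} (hs : s < D.numEvents) {i j : ℕ} (hi : i < D.width s)
    (hj : j < D.width (s + 1)) (h : (D.event s).Joins i j) :
    D.strandSign (s + 1) j = D.strandSign s i ∧ D.comp (s + 1) j = D.comp s i := by
  obtain ⟨h1, h2⟩ := D.joins s hs i hi j hj h
  exact ⟨by rw [strandSign, strandSign, h2], h1⟩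

theorem degree_sign {s k : ℕ} (hs : s < D.numEvents) (h : (D.event s).isReeb = true)
    (hk : (D.event s).pos = k) :
    (((-1 : ℤˣ) ^ ((chordAt hs h).degree + 1) : ℤˣ) : ℤ) =
      -(D.strandSign s k * D.strandSign s (k + 1)) := by
  simp only [Chord.degree, Chord.pos, Chord.idx, chordAt, hk, strandSign]
  rw [zpow_add, zpow_sub, zpow_one, Int.units_inv_eq_self]
  push_cast
  ring

/-- The Maurer–Cartan equation for the counts of disks. An induction over the slices: a crossing
conjugates by an elementary matrix and permutes, a base point conjugates by a diagonal matrix, a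
left cusp adds a `2 × 2` block, a right cusp cancels one. -/
theorem maurerCartan_diskSum (t : Fin m → Rˣ) (S : D.Chord → R) (Y : Fin m → R)
    (hY : ∀ c, Commute (Y c) (t c : R)) (s : ℕ) (hs : s ≤ D.numEvents)
    (hS : ∀ a : D.Chord, a.idx < s → obstruction F t S Y a = 0) :
    MaurerCartan (D.width s) (D.strandSign s) (fun l => Y (D.comp s l))
      (diskSum (wordEval t S) s) := by
  have upper : ∀ s i j, ¬ i < j → diskSum (wordEval t S) s i j = 0 := fun s i j h =>
    diskSum_eq_zero _ (by tauto)
  induction s with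
  | zero =>
    rw [D.width_first]
    exact ⟨upper 0, strandSign_eq 0, fun i hi => by omega⟩
  | succ s ih =>
    have hs' : s < D.numEvents := by omega
    have ih := ih hs'.le fun a ha => hS a (by omega)
    have hw := D.widths s hs'
    have hJ := fun i j hi hj h => joins_sign (D := D) hs' (i := i) (j := j) hi hj h
    rcases h : D.event s with k | k | k | k <;> rw [h] at hw hJ <;> obtain ⟨hk, hn⟩ := hw <;>
      simp only [Joins] at hJ
    · have hc := D.leftCusp s hs' k h
      have hsk : ∀ l < D.width s, skip k l < D.width (s + 1) := fun l hl => by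
        rw [hn]; exact (skip_lt hk).2 hl
      rw [hn]
      refine ih.leftCusp hk (strandSign_eq _) (fun l hl => (hJ l _ hl (hsk l hl) rfl).1) ?_
        (fun l hl => by rw [(hJ l _ hl (hsk l hl) rfl).2]) (by rw [hc.1])
        (fun i j => diskSum_leftCusp_skip _ hs' h rfl rfl) (diskSum_leftCusp_start _ hs' h rfl rfl)
        (fun i j => diskSum_leftCusp_eq_zero _ h) (upper _)
      simp only [strandSign]
      rw [hc.2, zpow_add, zpow_one]
      simp
    · obtain ⟨n, hn'⟩ : ∃ n, D.width s = n + 2 := ⟨D.width s - 2, by omega⟩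
      have hsw : ∀ l < n + 2, Equiv.swap k (k + 1) l < n + 2 := fun l hl => by
        rw [Equiv.swap_apply_def]; split_ifs <;> omega
      have hO := hS (chordAt hs' (isReeb_crossing h)) (Nat.lt_succ_self s)
      rw [hn, hn']
      rw [hn, hn'] at hJ
      rw [hn'] at ih
      rw [obstruction, eval_chordDiff, degree_sign hs' _ (by rw [h, FrontEvent.pos])] at hO
      simp only [Chord.pos, Chord.idx, Chord.target, Chord.source, chordAt, h, FrontEvent.pos,
        add_zero] at hO
      refine ih.crossing (by omega) rfl hO (strandSign_eq _)
        (fun l hl => (hJ _ l (hsw l hl) hl (by simp)).1)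
        (fun l hl => by rw [(hJ _ l (hsw l hl) hl (by simp)).2]) (fun i j hij => ?_) (upper _)
      rw [diskSum_crossing _ hs' h hij,
        ← degree_sign hs' (isReeb_crossing h) (by rw [h, FrontEvent.pos]), wordEval_chord]
      have : (((-1 : ℤˣ) ^ ((chordAt hs' (isReeb_crossing h)).degree + 1) : ℤˣ) : ℤ) =
          if Even (chordAt hs' (isReeb_crossing h)).degree then -1 else 1 := by
        rw [zpow_add, zpow_one]
        split_ifs with he
        · simp [he.neg_one_zpow]
        · simp [(Int.not_even_iff_odd.1 he).neg_one_zpow]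
      rw [this]
      rfl
    · have hc := D.rightCusp s hs' k h
      have hsk : ∀ l < D.width (s + 1), skip k l < D.width s := fun l hl => by
        rw [hn]; exact (skip_lt hk).2 hl
      have hσ : D.strandSign s (k + 1) = -D.strandSign s k := by
        simp only [strandSign]
        rw [hc.2, zpow_add, zpow_one]
        simp
      have hO := hS (chordAt hs' (isReeb_rightCusp h)) (Nat.lt_succ_self s)
      rw [obstruction, eval_chordDiff, degree_sign hs' _ (by rw [h, FrontEvent.pos])] at hO
      simp only [Chord.pos, Chord.idx, Chord.target, Chord.source, chordAt, h, FrontEvent.pos]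
        at hO
      have hone : -(D.strandSign s k * D.strandSign s (k + 1)) = 1 := by
        rw [hσ]
        rcases strandSign_eq (D := D) s k with h | h <;> rw [h] <;> norm_num
      rw [hone, one_smul, ← hc.1] at hO
      rw [hn] at ih
      refine ih.rightCusp hk hσ (by rw [hc.1]) hO (strandSign_eq _)
        (fun l hl => (hJ _ l (hsk l hl) hl rfl).1)
        (fun l hl => by rw [(hJ _ l (hsk l hl) hl rfl).2])
        (fun i j => by rw [diskSum_rightCusp _ hs' h, wordEval_chord]; rfl) (upper _)
    · have hu : ∀ l n, Commute (Y (D.comp s l)) (wordEval t S (D.baseMark s l n)) := by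
        intro l n
        have key : ∀ (c : Fin m) (r : ℤ), Commute (Y c)
            (wordEval t S (Word.base (FreeGroup.of c ^ r))) := by
          intro c r
          have : wordEval t S (Word.base (FreeGroup.of c ^ r)) = ((t c ^ r : Rˣ) : R) := by
            simp [wordEval, Word.base]
          rw [this]
          exact (hY c).units_zpow_right r
        simp only [baseMark, h]
        split_ifs with e e'
        · subst e; exact key _ _
        · subst e; exact key _ _
        · rw [map_one]; exact Commute.one_right _
      have huv : ∀ l, wordEval t S (D.baseMark s l 1) * wordEval t S (D.baseMark s l (-1)) = 1 := by
        intro l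
        rw [← map_mul]
        simp only [baseMark, h]
        split_ifs with e e'
        · rw [Word.base, Word.base, ← map_mul, ← zpow_add]; simp
        · rw [Word.base, Word.base, ← map_mul, ← zpow_add]; simp
        · simp
      rw [hn]
      rw [hn] at hJ
      refine (ih.conj (fun l _ => huv l) (fun l _ => hu l (-1)) (fun l _ => (hu l 1).symm)).congr
        (upper _) (strandSign_eq _) (fun l hl => (hJ l l hl hl rfl).1)
        (fun l hl => by rw [(hJ l l hl hl rfl).2])
        (fun i j _ _ => diskSum_basePoint _ hs' h i j)

/-- The Maurer–Cartan equation between the two strands that meet at a chord: up to the elements `Y`,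
`∂² = 0`. -/
theorem obstruction_closed (t : Fin m → Rˣ) (S : D.Chord → R) (Y : Fin m → R)
    (hY : ∀ c, Commute (Y c) (t c : R)) (a : D.Chord)
    (hS : ∀ b : D.Chord, b.idx < a.idx → obstruction F t S Y b = 0) :
    Y a.target * eval F t S (chordDiff F a) =
      (((-1 : ℤˣ) ^ (a.degree + 1) : ℤˣ) : ℤ) • (eval F t S (chordDiff F a) * Y a.source) := by
  obtain ⟨s, hs, ha, rfl⟩ : ∃ s hs ha, a = chordAt (s := s) hs ha := ⟨a.1.1, a.1.2, a.2, rfl⟩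
  have hMC := maurerCartan_diskSum (F := F) t S Y hY s hs.le hS
  have hw := D.widths s hs
  have hsgn := degree_sign hs ha rfl
  have hsol : ∀ (k : ℕ), k + 1 < D.width s →
      Y (D.comp s k) * diskSum (wordEval t S) s k (k + 1) =
        (-(D.strandSign s k * D.strandSign s (k + 1))) •
          (diskSum (wordEval t S) s k (k + 1) * Y (D.comp s (k + 1))) := by
    intro k hk
    have := hMC.eq_succ hk
    rcases strandSign_eq (D := D) s k with h | h <;>
      rcases strandSign_eq (D := D) s (k + 1) with h' | h' <;> rw [h, h'] at this ⊢ <;>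
      simp only [one_smul, neg_smul, mul_one, mul_neg, neg_neg] at this ⊢ <;>
      first
        | linear_combination (norm := abel1) this
        | linear_combination (norm := abel1) -this
  rw [eval_chordDiff]
  change Y (D.comp s (D.event s).pos) * (diskSum _ s (D.event s).pos _ + _) =
    (((-1 : ℤˣ) ^ ((chordAt hs ha).degree + 1) : ℤˣ) : ℤ) •
      ((diskSum _ s (D.event s).pos _ + _) * Y (D.comp s ((D.event s).pos + 1)))
  rw [hsgn]
  change Y (D.comp s (D.event s).pos) * (diskSum _ s (D.event s).pos ((D.event s).pos + 1) +
    (match D.event s with | .rightCusp _ => 1 | _ => 0)) = _ • ((diskSum _ s (D.event s).pos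
      ((D.event s).pos + 1) + (match D.event s with | .rightCusp _ => 1 | _ => 0)) * _)
  rcases h : D.event s with k | k | k | k
  · simp [h, isReeb] at ha
  · rw [h] at hw
    simp only [FrontEvent.pos, add_zero]
    exact hsol k hw.1
  · rw [h] at hw
    have hc := D.rightCusp s hs k h
    have hone : -(D.strandSign s k * D.strandSign s (k + 1)) = 1 := by
      simp only [strandSign]
      rw [hc.2, zpow_add, zpow_one]
      rcases Int.units_eq_one_or ((-1 : ℤˣ) ^ D.pot s (k + 1)) with h | h <;> simp [h]
    have := hsol k (by have := hw.1; have := hw.2; omega)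
    simp only [FrontEvent.pos]
    rw [hone, one_smul, ← hc.1] at *
    rw [mul_add, add_mul, this, mul_one, one_mul]
  · simp [h, isReeb] at ha

end

/-! ### Degree and locality of the boundary words of disks -/

theorem Word.degree_chord (a : D.Chord) :
    Word.degree (Word.chord a) = Multiplicative.ofAdd a.degree := by
  simp [Word.degree, Word.chord]

theorem Word.degree_base (g : FreeGroup (Fin m)) : Word.degree (D := D) (Word.base g) = 1 := by
  simp [Word.degree, Word.base]

theorem degree_baseMark (s i : ℕ) (n : ℤ) : Word.degree (D.baseMark s i n) = 1 := by
  unfold baseMark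
  split
  · split_ifs
    · exact Word.degree_base _
    · exact Word.degree_base _
    · exact map_one _
  · exact map_one _

theorem Disk.degree_word {s i j : ℕ} (d : Disk D s i j) :
    Word.degree d.word = Multiplicative.ofAdd (D.pot s i - D.pot s j - 1) := by
  induction d with
  | @start s k i j hs h hi hj =>
    subst hi hj
    rw [word, map_one, (D.leftCusp s hs i h).2]
    simp
  | @pass s i j i' j' hs hi hj hij d ih =>
    have h1 := d.composable
    have h2 := (Disk.pass hs hi hj hij d).composable
    rw [(D.joins s hs i (by omega) i' (by omega) hi).2, (D.joins s hs j h1.2.1 j' h2.2.1 hj).2,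
      word, map_mul, map_mul, degree_baseMark, degree_baseMark, ih, one_mul, mul_one]
  | @cornerBelow s k i j hs h hi d ih =>
    have h1 := d.composable
    have h2 := (Disk.cornerBelow hs h hi d).composable
    subst hi
    have e1 := (D.joins s hs j h1.2.1 j h2.2.1 (by
      rw [h]; exact (Equiv.swap_apply_of_ne_of_ne (by omega) (by omega)).symm)).2
    have e2 := (D.joins s hs k (by omega) (k + 1) (by omega) (by
      rw [h]; exact (Equiv.swap_apply_left _ _).symm)).2
    rw [e1, e2, word, map_mul, ih, Word.degree_chord, ← ofAdd_add]
    simp only [Chord.degree, Chord.pos, Chord.idx, chordAt, h, FrontEvent.pos]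
    congr 1
    ring
  | @cornerAbove s k i j hs h hj d ih =>
    have h1 := d.composable
    have h2 := (Disk.cornerAbove hs h hj d).composable
    have hw := D.widths s hs
    rw [h] at hw
    obtain ⟨hw1, hw2⟩ := hw
    subst hj
    have e1 := (D.joins s hs i (by omega) i (by omega) (by
      rw [h]; exact (Equiv.swap_apply_of_ne_of_ne (by omega) (by omega)).symm)).2
    have e2 := (D.joins s hs (j + 1) (by omega) j (by omega) (by
      rw [h]; exact (Equiv.swap_apply_right _ _).symm)).2
    rw [e1, e2, word, map_mul, ih, Word.degree_chord, ← ofAdd_add]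
    simp only [Chord.degree, Chord.pos, Chord.idx, chordAt, h, FrontEvent.pos]
    congr 1
    ring
  | @cap s k i j i' j' p q hs h u v hi hj hp hq d d' ih ih' =>
    have h1 := d.composable
    have h1' := d'.composable
    have h2 := (Disk.cap hs h u v hi hj hp hq d d').composable
    have hk := (D.rightCusp s hs k h).2
    have e1 := (D.joins s hs i (by cases u <;> simp at hp <;> omega) i' (by omega)
      (by rw [h]; exact hi)).2
    have e2 := (D.joins s hs j h1'.2.1 j' h2.2.1 (by rw [h]; exact hj)).2
    rw [e1, e2, word]
    simp only [map_mul, map_pow, ih, ih', Word.degree_chord, ← ofAdd_add, ← ofAdd_nsmul]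
    simp only [Chord.degree, Chord.pos, Chord.idx, chordAt, h, FrontEvent.pos, hk]
    congr 1
    cases u <;> cases v <;> simp at hp hq <;> subst hp hq <;> simp [hk] <;> ring

theorem Disk.wordEval_congr {R : Type*} [Monoid R] {t : Fin m → Rˣ} {S S' : D.Chord → R} {s i j : ℕ}
    (d : Disk D s i j) (h : ∀ a : D.Chord, a.idx < s → S a = S' a) :
    wordEval t S d.word = wordEval t S' d.word := by
  have hbase : ∀ s i n, wordEval t S (D.baseMark s i n) = wordEval t S' (D.baseMark s i n) := by
    intro s i n
    have key : ∀ g, wordEval t S (Word.base (D := D) g) = wordEval t S' (Word.base g) := fun g => by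
      simp [wordEval, Word.base]
    unfold baseMark
    split
    · split_ifs
      · exact key _
      · exact key _
      · simp
    · simp
  induction d with
  | start => simp [word]
  | pass _ _ _ _ d ih =>
    rw [word, map_mul, map_mul, map_mul, map_mul, hbase, hbase, ih fun a ha => h a (by omega)]
  | cornerBelow hs _ _ d ih =>
    rw [word, map_mul, map_mul, wordEval_chord, wordEval_chord, ih fun a ha => h a (by omega),
      h _ (Nat.lt_succ_self _)]
  | cornerAbove hs _ _ d ih =>
    rw [word, map_mul, map_mul, wordEval_chord, wordEval_chord, ih fun a ha => h a (by omega),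
      h _ (Nat.lt_succ_self _)]
  | cap hs _ u v _ _ _ _ d d' ih ih' =>
    simp only [word, map_mul, map_pow, wordEval_chord]
    rw [ih fun a ha => h a (by omega), ih' fun a ha => h a (by omega), h _ (Nat.lt_succ_self _)]

section

variable {F : Type*} [CommRing F]

/-- The differential of a chord involves only chords further to the left. -/
theorem eval_chordDiff_congr {R : Type*} [Ring R] [Algebra F R] {t : Fin m → Rˣ}
    {S S' : D.Chord → R} (a : D.Chord) (h : ∀ b : D.Chord, b.idx < a.idx → S b = S' b) :
    eval F t S (chordDiff F a) = eval F t S' (chordDiff F a) := by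
  rw [eval_chordDiff, eval_chordDiff]
  congr 1
  exact finsum_congr fun d => by rw [d.wordEval_congr h]

theorem single_mem_gradedPart (w : D.Word) {n : ℤ} (h : Word.degree w = Multiplicative.ofAdd n) :
    (MonoidAlgebra.single w 1 : D.Alg F) ∈ D.gradedPart F n :=
  Submodule.subset_span ⟨w, h, rfl⟩

/-- The differential lowers the degree of a chord by one. -/
theorem chordDiff_mem_gradedPart (a : D.Chord) :
    chordDiff F a ∈ D.gradedPart F (a.degree - 1) := by
  refine Submodule.add_mem _ ?_ ?_
  · refine finsum_induction (· ∈ D.gradedPart F (a.degree - 1)) (Submodule.zero_mem _)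
      (fun _ _ => Submodule.add_mem _) fun d => ?_
    exact zsmul_mem (single_mem_gradedPart _ d.degree_word) _
  · split
    · next k h =>
      have hk := (D.rightCusp a.idx a.1.2 k h).2
      refine single_mem_gradedPart 1 ?_
      rw [map_one]
      simp [Chord.degree, Chord.pos, h, FrontEvent.pos, hk]
    · exact Submodule.zero_mem _

end

variable {F : Type*} [CommRing F]

/-! ### Tuples of augmentations as triangular representations -/

theorem single_word_mul (u v : D.Word) : (MonoidAlgebra.single (u * v) 1 : D.Alg F) =
    MonoidAlgebra.single u 1 * MonoidAlgebra.single v 1 := by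
  rw [MonoidAlgebra.single_mul_single, mul_one]

theorem diff_chord (a : D.Chord) :
    D.diff F (MonoidAlgebra.single (Word.chord a) 1) = chordDiff F a := by
  simp [diff, diffHom, Word.chord, MonoidAlgebra.lift_single]

section CopyEval

variable {n : ℕ}

/-- The diagonal matrix of the values of a tuple of augmentations on the invertible letter `t c`. -/
def augBase (ε : Fin n → D.Augmentation F) (c : Fin m) : (Matrix (Fin n) (Fin n) F)ˣ where
  val := Matrix.diagonal fun p => ((ε p).baseValue c : F)
  inv := Matrix.diagonal fun p => (((ε p).baseValue c)⁻¹ : Fˣ)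
  val_inv := by simp
  inv_val := by simp

/-- The upper triangular matrix with the values of the augmentations at the chord `a` on the
diagonal and the coefficients of the morphisms `κ` at `a` above it. -/
def augMatrix (ε : Fin n → D.Augmentation F) (κ : D.HomGen → Fin n → Fin n → F) (a : D.Chord) :
    Matrix (Fin n) (Fin n) F :=
  Matrix.of fun p q => if p = q then (ε p).toHom (MonoidAlgebra.single (Word.chord a) 1)
    else if p < q then κ (.chord a) p q else 0

/-- The strictly upper triangular matrix of the coefficients of the morphisms `κ` at the minimum on
the component `c`. -/
def minCoeff (κ : D.HomGen → Fin n → Fin n → F) (c : Fin m) : Matrix (Fin n) (Fin n) F :=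
  Matrix.of fun p q => if p < q then κ (.min c) p q else 0

/-- The representation of the algebra of the link by upper triangular matrices that is given by the
augmentations `ε p` on the diagonal and the chord coefficients of morphisms `κ · p q` from `ε p` to
`ε q` above it. -/
def copyEval (ε : Fin n → D.Augmentation F) (κ : D.HomGen → Fin n → Fin n → F) :
    D.Alg F →ₐ[F] Matrix (Fin n) (Fin n) F :=
  eval F (augBase ε) (augMatrix ε κ)

/-- The obstruction for the representation `copyEval ε κ`, with the minima acting by `minCoeff κ`.
Its entries are the values at `a` of the operations of the augmentation category. -/
def copyObstruction (ε : Fin n → D.Augmentation F) (κ : D.HomGen → Fin n → Fin n → F)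
    (a : D.Chord) : Matrix (Fin n) (Fin n) F :=
  obstruction F (augBase ε) (augMatrix ε κ) (minCoeff κ) a

variable (ε : Fin n → D.Augmentation F) (κ : D.HomGen → Fin n → Fin n → F)

theorem copyObstruction_eq (a : D.Chord) :
    copyObstruction ε κ a = copyEval ε κ (chordDiff F a) +
      minCoeff κ a.target * augMatrix ε κ a +
      (((-1 : ℤˣ) ^ (a.degree + 1) : ℤˣ) : ℤ) • (augMatrix ε κ a * minCoeff κ a.source) := rfl

theorem copyEval_single (w : D.Word) : copyEval ε κ (MonoidAlgebra.single w 1) =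
    wordEval (augBase ε) (augMatrix ε κ) w := eval_single _ _ _

theorem baseValue_val (ε : D.Augmentation F) (c : Fin m) :
    (ε.baseValue c : F) = ε.toHom (MonoidAlgebra.single (Word.base (FreeGroup.of c)) 1) := rfl

theorem baseValue_inv_val (ε : D.Augmentation F) (c : Fin m) :
    ((ε.baseValue c)⁻¹ : Fˣ) = ε.toHom (MonoidAlgebra.single (Word.base (FreeGroup.of c)⁻¹) 1) :=
  rfl

theorem augBase_val (c : Fin m) :
    (augBase ε c : Matrix (Fin n) (Fin n) F) = Matrix.diagonal fun p => ((ε p).baseValue c : F) :=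
  rfl

theorem augBase_inv_val (c : Fin m) : ((augBase ε c)⁻¹ : (Matrix (Fin n) (Fin n) F)ˣ).val =
    Matrix.diagonal fun p => (((ε p).baseValue c)⁻¹ : Fˣ).val := rfl

theorem Augmentation.single_mul (ε : D.Augmentation F) (u v : D.Word) :
    ε.toHom (MonoidAlgebra.single (u * v) 1) =
      ε.toHom (MonoidAlgebra.single u 1) * ε.toHom (MonoidAlgebra.single v 1) := by
  rw [single_word_mul, map_mul]

theorem wordEval_triangular (w : D.Word) (p q : Fin n) :
    (q < p → wordEval (augBase ε) (augMatrix ε κ) w p q = 0) ∧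
      (p = q → wordEval (augBase ε) (augMatrix ε κ) w p q =
        (ε p).toHom (MonoidAlgebra.single w 1)) := by
  induction w using Word.induction generalizing p q with
  | one =>
    rw [map_one]
    refine ⟨fun h => Matrix.one_apply_ne h.ne', ?_⟩
    rintro rfl
    rw [Matrix.one_apply_eq, ← MonoidAlgebra.one_def, map_one]
  | chord a =>
    rw [wordEval_chord]
    refine ⟨fun h => ?_, ?_⟩
    · simp [augMatrix, h.ne', h.not_gt]
    · rintro rfl
      simp [augMatrix]
  | base c =>
    rw [wordEval_base, augBase_val]
    refine ⟨fun h => Matrix.diagonal_apply_ne _ h.ne', ?_⟩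
    rintro rfl
    rw [Matrix.diagonal_apply_eq, baseValue_val]
  | base_inv c =>
    rw [wordEval_base_inv, augBase_inv_val]
    refine ⟨fun h => Matrix.diagonal_apply_ne _ h.ne', ?_⟩
    rintro rfl
    rw [Matrix.diagonal_apply_eq, baseValue_inv_val]
  | mul u v hu hv =>
    rw [map_mul, Matrix.mul_apply]
    refine ⟨fun h => Finset.sum_eq_zero fun r _ => ?_, ?_⟩
    · rcases lt_or_ge r p with hr | hr
      · rw [(hu p r).1 hr, zero_mul]
      · rw [(hv r q).1 (h.trans_le hr), mul_zero]
    · rintro rfl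
      rw [Finset.sum_eq_single p, (hu p p).2 rfl, (hv p p).2 rfl, Augmentation.single_mul]
      · intro r _ hr
        rcases lt_or_gt_of_ne hr with hr | hr
        · rw [(hu p r).1 hr, zero_mul]
        · rw [(hv r p).1 hr, mul_zero]
      · simp

theorem copyEval_of_gt (x : D.Alg F) {p q : Fin n} (h : q < p) : copyEval ε κ x p q = 0 := by
  induction x using MonoidAlgebra.induction_on with
  | of w => exact (copyEval_single ε κ w) ▸ (wordEval_triangular ε κ w p q).1 h
  | add x y hx hy => rw [map_add, Matrix.add_apply, hx, hy, add_zero]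
  | smul r x hx => rw [map_smul, Matrix.smul_apply, hx, smul_zero]

theorem copyEval_diag (x : D.Alg F) (p : Fin n) : copyEval ε κ x p p = (ε p).toHom x := by
  induction x using MonoidAlgebra.induction_on with
  | of w => exact (copyEval_single ε κ w) ▸ (wordEval_triangular ε κ w p p).2 rfl
  | add x y hx hy => rw [map_add, Matrix.add_apply, hx, hy, map_add]
  | smul r x hx => rw [map_smul, Matrix.smul_apply, hx, map_smul]

theorem Augmentation.degree_eq_zero (ε : D.Augmentation F) {w : D.Word}
    (h : ε.toHom (MonoidAlgebra.single w 1) ≠ 0) : Word.degree w = 1 := by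
  by_contra hw
  exact h (ε.degree_zero (Word.degree w).toAdd (fun h' => hw (toAdd_eq_zero.1 h')) _
    (single_mem_gradedPart _ rfl))

/-- If the chord part of `κ · p q` has `|·|₊`-degree `1 - (q - p)`, then the representation is
graded: the entry at `p q` is nonzero only on words of degree `p - q`. -/
theorem wordEval_graded (hκ : ∀ (a : D.Chord) (p q : Fin n), p < q → κ (.chord a) p q ≠ 0 →
    a.degree = (p : ℤ) - q) (w : D.Word) (p q : Fin n)
    (h : wordEval (augBase ε) (augMatrix ε κ) w p q ≠ 0) :
    Word.degree w = Multiplicative.ofAdd ((p : ℤ) - q) := by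
  induction w using Word.induction generalizing p q with
  | one =>
    rw [map_one, Matrix.one_apply] at h
    split_ifs at h with e
    · subst e; simp
    · exact absurd rfl h
  | chord a =>
    rw [wordEval_chord, augMatrix, Matrix.of_apply] at h
    split_ifs at h with e e'
    · subst e; rw [(ε p).degree_eq_zero h]; simp
    · rw [Word.degree_chord, hκ a p q e' h]
    · exact absurd rfl h
  | base c =>
    rw [wordEval_base, augBase_val, Matrix.diagonal_apply] at h
    split_ifs at h with e
    · subst e; rw [Word.degree_base]; simp
    · exact absurd rfl h
  | base_inv c =>
    rw [wordEval_base_inv, augBase_inv_val, Matrix.diagonal_apply] at h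
    split_ifs at h with e
    · subst e; rw [Word.degree_base]; simp
    · exact absurd rfl h
  | mul u v hu hv =>
    rw [map_mul, Matrix.mul_apply] at h
    obtain ⟨r, -, hr⟩ := Finset.exists_ne_zero_of_sum_ne_zero h
    rw [map_mul, hu p r (left_ne_zero_of_mul hr), hv r q (right_ne_zero_of_mul hr), ← ofAdd_add]
    congr 1
    ring

/-- The linear extension of `wordEval_graded` to homogeneous elements. -/
theorem copyEval_graded (hκ : ∀ (a : D.Chord) (p q : Fin n), p < q → κ (.chord a) p q ≠ 0 →
    a.degree = (p : ℤ) - q) {d : ℤ} {x : D.Alg F} (hx : x ∈ D.gradedPart F d) {p q : Fin n}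
    (hd : d ≠ (p : ℤ) - q) : copyEval ε κ x p q = 0 := by
  refine Submodule.span_induction ?_ (by simp) ?_ ?_ hx
  · rintro _ ⟨w, hw, rfl⟩
    by_contra h
    rw [copyEval_single] at h
    have := wordEval_graded ε κ hκ w p q h
    rw [hw] at this
    exact hd (Multiplicative.ofAdd.injective this)
  · intro a b _ _ ha hb
    rw [map_add, Matrix.add_apply, ha, hb, add_zero]
  · intro r a _ ha
    rw [map_smul, Matrix.smul_apply, ha, smul_zero]

theorem copyEval_congr {κ' : D.HomGen → Fin n → Fin n → F} (a : D.Chord)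
    (h : ∀ b : D.Chord, b.idx < a.idx → ∀ p q, κ (.chord b) p q = κ' (.chord b) p q) :
    copyEval ε κ (chordDiff F a) = copyEval ε κ' (chordDiff F a) :=
  eval_chordDiff_congr a fun b hb => by
    ext p q
    simp only [augMatrix, Matrix.of_apply, h b hb]

/-! ### Restriction to consecutive copies -/

variable {n' : ℕ} (e : Fin n' → Fin n)

/-- Passing to a block of consecutive indices is multiplicative on upper triangular matrices. -/
theorem mul_apply_interval (he : StrictMono e)
    (hc : ∀ p q r, e p ≤ r → r ≤ e q → r ∈ Set.range e)
    {A B : Matrix (Fin n) (Fin n) F} (hA : ∀ p q, q < p → A p q = 0)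
    (hB : ∀ p q, q < p → B p q = 0) (p q : Fin n') :
    (A * B) (e p) (e q) = (A.submatrix e e * B.submatrix e e) p q := by
  rw [Matrix.mul_apply, Matrix.mul_apply]
  refine (Fintype.sum_of_injective e he.injective _ _ (fun r hr => ?_) fun r => rfl).symm
  rcases lt_or_ge r (e p) with h | h
  · rw [hA _ _ h, zero_mul]
  · rcases lt_or_ge (e q) r with h' | h'
    · rw [hB _ _ h', mul_zero]
    · exact absurd (hc p q r h h') hr

theorem augMatrix_interval (he : StrictMono e) (a : D.Chord) :
    (augMatrix ε κ a).submatrix e e =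
      augMatrix (ε ∘ e) (fun g p q => κ g (e p) (e q)) a := by
  ext p q
  simp [augMatrix, he.injective.eq_iff, he.lt_iff_lt]

theorem minCoeff_interval (he : StrictMono e) (c : Fin m) :
    (minCoeff κ c).submatrix e e = minCoeff (fun g p q => κ g (e p) (e q)) c := by
  ext p q
  simp [minCoeff, he.lt_iff_lt]

theorem augMatrix_of_gt (a : D.Chord) (p q : Fin n) (h : q < p) : augMatrix ε κ a p q = 0 := by
  simp [augMatrix, h.ne', h.not_gt]

theorem minCoeff_of_gt (c : Fin m) (p q : Fin n) (h : q < p) : minCoeff κ c p q = 0 := by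
  simp [minCoeff, h.not_gt]

theorem copyEval_interval (he : StrictMono e)
    (hc : ∀ p q r, e p ≤ r → r ≤ e q → r ∈ Set.range e) (x : D.Alg F) (p q : Fin n') :
    copyEval ε κ x (e p) (e q) = copyEval (ε ∘ e) (fun g p q => κ g (e p) (e q)) x p q := by
  induction x using MonoidAlgebra.induction_on with
  | of w =>
    change copyEval ε κ (MonoidAlgebra.single w 1) _ _ =
      copyEval _ _ (MonoidAlgebra.single w 1) _ _
    rw [copyEval_single, copyEval_single]
    induction w using Word.induction generalizing p q with
    | one => simp [Matrix.one_apply, he.injective.eq_iff]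
    | chord a =>
      rw [wordEval_chord, wordEval_chord, ← augMatrix_interval ε κ e he]
      rfl
    | base c =>
      simp [augBase_val, Matrix.diagonal_apply, he.injective.eq_iff]
    | base_inv c =>
      rw [wordEval_base_inv, wordEval_base_inv, augBase_inv_val, augBase_inv_val]
      simp [Matrix.diagonal_apply, he.injective.eq_iff]
    | mul u v hu hv =>
      rw [map_mul, map_mul, mul_apply_interval e he hc
        (fun p q h => (wordEval_triangular ε κ u p q).1 h)
        (fun p q h => (wordEval_triangular ε κ v p q).1 h)]
      simp only [Matrix.mul_apply, Matrix.submatrix_apply, hu, hv]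
  | add x y hx hy => simp only [map_add, Matrix.add_apply, hx, hy]
  | smul r x hx => simp only [map_smul, Matrix.smul_apply, hx]

theorem copyObstruction_interval (he : StrictMono e)
    (hc : ∀ p q r, e p ≤ r → r ≤ e q → r ∈ Set.range e) (a : D.Chord) (p q : Fin n') :
    copyObstruction ε κ a (e p) (e q) =
      copyObstruction (ε ∘ e) (fun g p q => κ g (e p) (e q)) a p q := by
  rw [copyObstruction_eq, copyObstruction_eq]
  simp only [Matrix.add_apply, Matrix.smul_apply]
  rw [copyEval_interval ε κ e he hc,
    mul_apply_interval e he hc (minCoeff_of_gt κ _) (augMatrix_of_gt ε κ _),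
    mul_apply_interval e he hc (augMatrix_of_gt ε κ _) (minCoeff_of_gt κ _),
    augMatrix_interval ε κ e he, minCoeff_interval κ e he, minCoeff_interval κ e he]

theorem strictMono_interval {n n' k : ℕ} (h : n' + k ≤ n) :
    StrictMono (fun p : Fin n' => (⟨p + k, by omega⟩ : Fin n)) := fun p q hpq => by
  simp only [Fin.lt_def] at *
  omega

theorem ordConnected_interval {n n' k : ℕ} (h : n' + k ≤ n) (p q : Fin n') (r : Fin n)
    (hp : (⟨p + k, by omega⟩ : Fin n) ≤ r) (hq : r ≤ (⟨q + k, by omega⟩ : Fin n)) :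
    r ∈ Set.range (fun p : Fin n' => (⟨p + k, by omega⟩ : Fin n)) := by
  simp only [Fin.le_def] at hp hq
  exact ⟨⟨r - k, by omega⟩, Fin.ext (by simp; omega)⟩

theorem copyObstruction_congr {κ' : D.HomGen → Fin n → Fin n → F}
    (h : ∀ g p q, p < q → κ g p q = κ' g p q) (a : D.Chord) :
    copyObstruction ε κ a = copyObstruction ε κ' a := by
  have h1 : augMatrix ε κ = augMatrix ε κ' := by
    ext a p q
    simp only [augMatrix, Matrix.of_apply]
    split_ifs with _ hpq
    · rfl
    · exact h _ _ _ hpq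
    · rfl
  have h2 : minCoeff κ = minCoeff κ' := by
    ext a p q
    simp only [minCoeff, Matrix.of_apply]
    split_ifs with hpq
    · exact h _ _ _ hpq
    · rfl
  rw [copyObstruction, copyObstruction, h1, h2]

theorem copyObstruction_block {k : ℕ} {ε : Fin n → D.Augmentation F}
    {κ : D.HomGen → Fin n → Fin n → F} {ε' : Fin n' → D.Augmentation F}
    {κ' : D.HomGen → Fin n' → Fin n' → F} (hk : n' + k ≤ n)
    (hε : ∀ p : Fin n', ε ⟨p + k, by omega⟩ = ε' p)
    (hκ : ∀ g (p q : Fin n'), p < q → κ g ⟨p + k, by omega⟩ ⟨q + k, by omega⟩ = κ' g p q)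
    (a : D.Chord) (p q : Fin n') :
    copyObstruction ε κ a ⟨p + k, by omega⟩ ⟨q + k, by omega⟩ = copyObstruction ε' κ' a p q := by
  refine (copyObstruction_interval ε κ _ (strictMono_interval hk) (ordConnected_interval hk)
    a p q).trans ?_
  rw [copyObstruction_congr _ _ hκ]
  congr 1
  exact funext hε

end CopyEval

/-- The corner entry for three augmentations splits off the contribution of the morphism from the
first to the last: a word contributes by one step from `0` to `2` or by two steps through `1`. -/
theorem copyEval_corner (ε : Fin 3 → D.Augmentation F) (κ κ' : D.HomGen → Fin 3 → Fin 3 → F)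
    (h01 : ∀ g, κ' g 0 1 = κ g 0 1) (h12 : ∀ g, κ' g 1 2 = κ g 1 2) (h02 : ∀ g, κ' g 0 2 = 0)
    (x : D.Alg F) : copyEval ε κ x 0 2 = copyEval ε κ' x 0 2 +
      copyEval ![ε 0, ε 2] (fun g _ _ => κ g 0 2) x 0 1 := by
  set κ₂ : D.HomGen → Fin 2 → Fin 2 → F := fun g _ _ => κ g 0 2
  induction x using MonoidAlgebra.induction_on with
  | of w =>
    change copyEval ε κ (MonoidAlgebra.single w 1) 0 2 =
      copyEval ε κ' (MonoidAlgebra.single w 1) 0 2 +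
        copyEval ![ε 0, ε 2] κ₂ (MonoidAlgebra.single w 1) 0 1
    simp only [copyEval_single]
    have key : wordEval (augBase ε) (augMatrix ε κ) w 0 1 =
          wordEval (augBase ε) (augMatrix ε κ') w 0 1 ∧
        wordEval (augBase ε) (augMatrix ε κ) w 1 2 =
          wordEval (augBase ε) (augMatrix ε κ') w 1 2 ∧
        wordEval (augBase ε) (augMatrix ε κ) w 0 2 =
          wordEval (augBase ε) (augMatrix ε κ') w 0 2 +
            wordEval (augBase ![ε 0, ε 2]) (augMatrix ![ε 0, ε 2] κ₂) w 0 1 := by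
      induction w using Word.induction with
      | one => simp
      | chord a => simp [augMatrix, h01, h12, h02, κ₂]
      | base c => simp [augBase_val]
      | base_inv c =>
        rw [wordEval_base_inv, wordEval_base_inv, wordEval_base_inv, augBase_inv_val,
          augBase_inv_val]
        simp
      | mul u v hu hv =>
        obtain ⟨hu1, hu2, hu3⟩ := hu
        obtain ⟨hv1, hv2, hv3⟩ := hv
        have d : ∀ w p, wordEval (augBase ε) (augMatrix ε κ) w p p =
            wordEval (augBase ε) (augMatrix ε κ') w p p := fun w p => by
          rw [(wordEval_triangular ε κ w p p).2 rfl, (wordEval_triangular ε κ' w p p).2 rfl]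
        have d0 : ∀ w, wordEval (augBase ![ε 0, ε 2]) (augMatrix ![ε 0, ε 2] κ₂) w 0 0 =
            wordEval (augBase ε) (augMatrix ε κ') w 0 0 := fun w => by
          rw [(wordEval_triangular _ κ₂ w 0 0).2 rfl, (wordEval_triangular ε κ' w 0 0).2 rfl]
          rfl
        have d1 : ∀ w, wordEval (augBase ![ε 0, ε 2]) (augMatrix ![ε 0, ε 2] κ₂) w 1 1 =
            wordEval (augBase ε) (augMatrix ε κ') w 2 2 := fun w => by
          rw [(wordEval_triangular _ κ₂ w 1 1).2 rfl, (wordEval_triangular ε κ' w 2 2).2 rfl]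
          rfl
        have l : ∀ κ w (p q : Fin 3), q < p → wordEval (augBase ε) (augMatrix ε κ) w p q = 0 :=
          fun κ w p q h => (wordEval_triangular ε κ w p q).1 h
        simp only [map_mul, Matrix.mul_apply, Fin.sum_univ_three, Fin.sum_univ_two]
        simp only [hu1, hu2, hu3, hv1, hv2, hv3, d, d0, d1]
        rw [l κ u 1 0 (by decide), l κ' u 1 0 (by decide), l κ v 2 1 (by decide),
          l κ' v 2 1 (by decide)]
        refine ⟨by ring, by ring, by ring⟩
    exact key.2.2
  | add x y hx hy => simp only [map_add, Matrix.add_apply, hx, hy]; ring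
  | smul r x hx => simp only [map_smul, Matrix.smul_apply, hx, smul_add]

/-- The coefficient of the composition at a chord, corrected by the differential of a morphism from
the first to the last augmentation. -/
theorem copyObstruction_corner (ε : Fin 3 → D.Augmentation F) (κ κ' : D.HomGen → Fin 3 → Fin 3 → F)
    (h01 : ∀ g, κ' g 0 1 = κ g 0 1) (h12 : ∀ g, κ' g 1 2 = κ g 1 2) (h02 : ∀ g, κ' g 0 2 = 0)
    (a : D.Chord) : copyObstruction ε κ a 0 2 = copyObstruction ε κ' a 0 2 +
      copyObstruction ![ε 0, ε 2] (fun g _ _ => κ g 0 2) a 0 1 := by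
  simp only [copyObstruction_eq, Matrix.add_apply, Matrix.smul_apply,
    copyEval_corner ε κ κ' h01 h12 h02, Matrix.mul_apply, Fin.sum_univ_three, Fin.sum_univ_two]
  simp [minCoeff, augMatrix, h01, h12, h02]
  ring

/-! ### Inverting a homotopy -/

section Inverse

/-- The morphisms `f`, `g`, `f` between four copies, with units `α`, `α⁻¹`, `α` at the minima, and a
morphism `h` from the second copy to the fourth. -/
def zigzag (α : Fin m → Fˣ) (f g h : D.Chord → F) : D.HomGen → Fin 4 → Fin 4 → F
  | .chord a => !![0, f a, 0, 0; 0, 0, g a, h a; 0, 0, 0, f a; 0, 0, 0, 0]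
  | .max _ => 0
  | .min c => !![0, α c, 0, 0; 0, 0, ((α c)⁻¹ : Fˣ), 0; 0, 0, 0, α c; 0, 0, 0, 0]

variable {ε₁ ε₂ : D.Augmentation F} {α : Fin m → Fˣ} {f g h : D.Chord → F}

theorem zigzag_graded (hf : ∀ a, f a ≠ 0 → a.degree = -1) (hg : ∀ a, g a ≠ 0 → a.degree = -1)
    (hh : ∀ a, h a ≠ 0 → a.degree = -2) (a : D.Chord) (p q : Fin 4) (_ : p < q)
    (hne : zigzag α f g h (.chord a) p q ≠ 0) : a.degree = (p : ℤ) - q := by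
  fin_cases p <;> fin_cases q <;> simp [zigzag] at hne
  · rw [hf a hne]; rfl
  · rw [hg a hne]; rfl
  · rw [hh a hne]; rfl
  · rw [hf a hne]; rfl

theorem augMatrix_zigzag (a : D.Chord) : augMatrix ![ε₁, ε₂, ε₁, ε₂] (zigzag α f g h) a =
    !![ε₁.toHom (MonoidAlgebra.single (Word.chord a) 1), f a, 0, 0;
      0, ε₂.toHom (MonoidAlgebra.single (Word.chord a) 1), g a, h a;
      0, 0, ε₁.toHom (MonoidAlgebra.single (Word.chord a) 1), f a;
      0, 0, 0, ε₂.toHom (MonoidAlgebra.single (Word.chord a) 1)] := by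
  ext p q
  fin_cases p <;> fin_cases q <;> simp [augMatrix, zigzag]

theorem minCoeff_zigzag (c : Fin m) : minCoeff (zigzag (D := D) α f g h) c =
    !![0, (α c : F), 0, 0; 0, 0, ((α c)⁻¹ : Fˣ), 0; 0, 0, 0, α c; 0, 0, 0, 0] := by
  ext p q
  fin_cases p <;> fin_cases q <;> simp [minCoeff, zigzag]

theorem commute_zigzag (ht : ∀ c, ε₁.baseValue c = ε₂.baseValue c) (c : Fin m) :
    Commute (minCoeff (zigzag (D := D) α f g h) c)
      (augBase ![ε₁, ε₂, ε₁, ε₂] c : Matrix (Fin 4) (Fin 4) F) := by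
  have : (augBase ![ε₁, ε₂, ε₁, ε₂] c : Matrix (Fin 4) (Fin 4) F) =
      Matrix.scalar (Fin 4) (ε₁.baseValue c : F) := by
    rw [augBase_val, Matrix.scalar_apply]
    congr 1
    ext p
    fin_cases p <;> simp [ht]
  rw [this]
  exact (Matrix.scalar_commute _ (fun r => Commute.all _ r) _).symm

/-- The Bianchi identity for the obstruction `O` is `Y O ± O Y = Y² A - A Y²`. The right hand side
is zero in the entries `0 2` and `0 3`, since `Y²` shifts by two copies and `A` is invariant under
this; as the other entries of `O` are assumed to vanish, these two say `α O₁₂ = 0` and `α O₁₃ = 0`.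
-/
theorem zigzag_obstruction_eq_zero (ht : ∀ c, ε₁.baseValue c = ε₂.baseValue c) (a : D.Chord)
    (hlt : ∀ b : D.Chord, b.idx < a.idx →
      copyObstruction ![ε₁, ε₂, ε₁, ε₂] (zigzag α f g h) b = 0)
    (h01 : copyObstruction ![ε₁, ε₂, ε₁, ε₂] (zigzag α f g h) a 0 1 = 0)
    (h02 : copyObstruction ![ε₁, ε₂, ε₁, ε₂] (zigzag α f g h) a 0 2 = 0)
    (h03 : copyObstruction ![ε₁, ε₂, ε₁, ε₂] (zigzag α f g h) a 0 3 = 0)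
    (h23 : copyObstruction ![ε₁, ε₂, ε₁, ε₂] (zigzag α f g h) a 2 3 = 0) :
    copyObstruction ![ε₁, ε₂, ε₁, ε₂] (zigzag α f g h) a = 0 := by
  have hclosed := obstruction_closed (F := F) (augBase ![ε₁, ε₂, ε₁, ε₂])
    (augMatrix ![ε₁, ε₂, ε₁, ε₂] (zigzag α f g h)) (minCoeff (zigzag α f g h))
    (commute_zigzag ht) a hlt
  change _ * copyEval ![ε₁, ε₂, ε₁, ε₂] (zigzag α f g h) (chordDiff F a) = _ •
    (copyEval ![ε₁, ε₂, ε₁, ε₂] (zigzag α f g h) (chordDiff F a) * _) at hclosed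
  set ε := ![ε₁, ε₂, ε₁, ε₂]
  set κ := zigzag α f g h
  set O := copyObstruction ε κ a with hO
  have hlow : ∀ p q : Fin 4, q ≤ p → O p q = 0 := by
    intro p q hqp
    have e1 : (minCoeff κ a.target * augMatrix ε κ a) p q = 0 := by
      rw [Matrix.mul_apply]
      refine Finset.sum_eq_zero fun r _ => ?_
      by_cases hr : p < r
      · rw [augMatrix_of_gt _ _ _ _ _ (hqp.trans_lt hr), mul_zero]
      · simp [minCoeff, hr]
    have e2 : (augMatrix ε κ a * minCoeff κ a.source) p q = 0 := by
      rw [Matrix.mul_apply]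
      refine Finset.sum_eq_zero fun r _ => ?_
      by_cases hr : r < q
      · rw [augMatrix_of_gt _ _ _ _ _ (hr.trans_le hqp), zero_mul]
      · simp [minCoeff, hr]
    have e3 : copyEval ε κ (chordDiff F a) p q = 0 := by
      rcases hqp.lt_or_eq with h' | h'
      · exact copyEval_of_gt _ _ _ h'
      · subst h'
        rw [copyEval_diag, ← diff_chord, Augmentation.map_diff]
    rw [hO, copyObstruction_eq, Matrix.add_apply, Matrix.add_apply, Matrix.smul_apply, e1, e2, e3]
    simp
  have hcomm : minCoeff κ a.target * O - (((-1 : ℤˣ) ^ (a.degree + 1) : ℤˣ) : ℤ) •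
      (O * minCoeff κ a.source) =
      minCoeff κ a.target * minCoeff κ a.target * augMatrix ε κ a -
        augMatrix ε κ a * (minCoeff κ a.source * minCoeff κ a.source) := by
    rw [hO, copyObstruction_eq, mul_add, mul_add, hclosed]
    rcases Int.units_eq_one_or ((-1 : ℤˣ) ^ (a.degree + 1)) with h' | h' <;> rw [h'] <;>
      simp only [Units.val_one, Units.val_neg, one_smul, neg_smul] <;> noncomm_ring
  have e02 := congrFun (congrFun hcomm 0) 2
  have e03 := congrFun (congrFun hcomm 0) 3
  simp only [Matrix.sub_apply, Matrix.smul_apply, Matrix.mul_apply, Fin.sum_univ_four, κ, ε,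
    minCoeff_zigzag, augMatrix_zigzag] at e02 e03
  simp [h01, h02, hlow] at e02 e03
  ext p q
  by_cases hpq : q ≤ p
  · exact hlow p q hpq
  fin_cases p <;> fin_cases q <;> simp at hpq <;> simp <;> assumption

/-- A homotopy between augmentations has an inverse, up to the homotopy `h`. The values of `g` and
`h` are determined chord by chord from the left to the right by the entries `0 2` and `0 3` of the
obstruction. -/
theorem exists_zigzag (ht : ∀ c, ε₁.baseValue c = ε₂.baseValue c)
    (hf : ∀ a, f a ≠ 0 → a.degree = -1)
    (hO : ∀ a, copyObstruction ![ε₁, ε₂] (fun g _ _ => zigzag α f 0 0 g 0 1) a 0 1 = 0) :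
    ∃ g h : D.Chord → F, (∀ a, g a ≠ 0 → a.degree = -1) ∧ (∀ a, h a ≠ 0 → a.degree = -2) ∧
      ∀ a, copyObstruction ![ε₁, ε₂, ε₁, ε₂] (zigzag α f g h) a = 0 := by
  have h01 : ∀ g h a, copyObstruction ![ε₁, ε₂, ε₁, ε₂] (zigzag α f g h) a 0 1 = 0 := by
    intro g h a
    rw [← hO a]
    refine copyObstruction_block (n := 4) (n' := 2) (k := 0) (by decide) (fun p => ?_)
      (fun x p q hpq => ?_) a 0 1
    · fin_cases p <;> rfl
    · fin_cases p <;> fin_cases q <;> simp at hpq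
      cases x <;> rfl
  have h23 : ∀ g h a, copyObstruction ![ε₁, ε₂, ε₁, ε₂] (zigzag α f g h) a 2 3 = 0 := by
    intro g h a
    rw [← hO a]
    refine copyObstruction_block (n := 4) (n' := 2) (k := 2) (by decide) (fun p => ?_)
      (fun x p q hpq => ?_) a 0 1
    · fin_cases p <;> rfl
    · fin_cases p <;> fin_cases q <;> simp at hpq
      cases x <;> rfl
  suffices H : ∀ s : ℕ, ∃ g h : D.Chord → F, (∀ a, g a ≠ 0 → a.degree = -1) ∧
      (∀ a, h a ≠ 0 → a.degree = -2) ∧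
      ∀ a : D.Chord, a.idx < s →
        copyObstruction ![ε₁, ε₂, ε₁, ε₂] (zigzag α f g h) a = 0 by
    obtain ⟨g, h, hg, hh, H⟩ := H D.numEvents
    exact ⟨g, h, hg, hh, fun a => H a a.1.2⟩
  intro s
  induction s with
  | zero => exact ⟨0, 0, by simp, by simp, fun a ha => by omega⟩
  | succ s ih =>
    obtain ⟨g, h, hg, hh, H⟩ := ih
    let Z : D.Chord → Matrix (Fin 4) (Fin 4) F := fun a =>
      copyEval ![ε₁, ε₂, ε₁, ε₂] (zigzag α f g h) (chordDiff F a)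
    classical
    -- The entries `0 2` and `0 3` of the obstruction are `Z a 0 2 + α (g a) + f a * α⁻¹` and
    -- `Z a 0 3 + α (h a)` in the degrees where they can be nonzero, and `Z a` does not involve the
    -- values at `a`.
    let g' : D.Chord → F := fun a => if a.idx = s then
      (if a.degree = -1 then -((α a.target)⁻¹ : Fˣ) * (Z a 0 2 + f a * ((α a.source)⁻¹ : Fˣ))
        else 0) else g a
    let h' : D.Chord → F := fun a => if a.idx = s then
      (if a.degree = -2 then -((α a.target)⁻¹ : Fˣ) * Z a 0 3 else 0) else h a
    have hg' : ∀ a, g' a ≠ 0 → a.degree = -1 := by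
      intro a ha
      simp only [g'] at ha
      split_ifs at ha with h1 h2
      · exact h2
      · exact absurd rfl ha
      · exact hg a ha
    have hh' : ∀ a, h' a ≠ 0 → a.degree = -2 := by
      intro a ha
      simp only [h'] at ha
      split_ifs at ha with h1 h2
      · exact h2
      · exact absurd rfl ha
      · exact hh a ha
    have hagree : ∀ b : D.Chord, b.idx < s → ∀ p q,
        zigzag α f g' h' (.chord b) p q = zigzag α f g h (.chord b) p q := by
      intro b hb p q
      have : b.idx ≠ s := hb.ne
      simp only [zigzag, g', h', if_neg this]
    have hZ : ∀ a : D.Chord, a.idx ≤ s →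
        copyEval ![ε₁, ε₂, ε₁, ε₂] (zigzag α f g' h') (chordDiff F a) = Z a := fun a ha =>
      copyEval_congr _ _ a fun b hb => hagree b (by omega)
    have Hlt : ∀ a : D.Chord, a.idx < s →
        copyObstruction ![ε₁, ε₂, ε₁, ε₂] (zigzag α f g' h') a = 0 := by
      intro a ha
      rw [← H a ha, copyObstruction_eq, copyObstruction_eq, hZ a ha.le]
      have : augMatrix ![ε₁, ε₂, ε₁, ε₂] (zigzag α f g' h') a =
          augMatrix ![ε₁, ε₂, ε₁, ε₂] (zigzag α f g h) a := by
        ext p q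
        simp only [augMatrix, Matrix.of_apply, hagree a ha]
      rw [this, minCoeff_zigzag, minCoeff_zigzag, minCoeff_zigzag, minCoeff_zigzag]
    refine ⟨g', h', hg', hh', fun a ha => ?_⟩
    rcases (Nat.lt_succ_iff_lt_or_eq.1 ha) with ha | ha
    · exact Hlt a ha
    have hgr : ∀ p q : Fin 4, a.degree - 1 ≠ (p : ℤ) - q → Z a p q = 0 := fun p q =>
      copyEval_graded _ _ (zigzag_graded hf hg hh) (chordDiff_mem_gradedPart a)
    refine zigzag_obstruction_eq_zero ht a (fun b hb => Hlt b (by omega)) (h01 _ _ a) ?_ ?_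
      (h23 _ _ a)
    · rw [copyObstruction_eq, hZ a ha.le, minCoeff_zigzag, minCoeff_zigzag, augMatrix_zigzag]
      simp only [Matrix.add_apply, Matrix.smul_apply, Matrix.mul_apply, Fin.sum_univ_four]
      simp
      by_cases hd : a.degree = -1
      · simp only [g', if_pos ha, if_pos hd]
        rw [hd]
        simp
      · have h1 : f a = 0 := by_contra fun h => hd (hf a h)
        have h2 : g' a = 0 := by_contra fun h => hd (hg' a h)
        rw [h1, h2, hgr 0 2 (by simp; omega)]
        simp
    · rw [copyObstruction_eq, hZ a ha.le, minCoeff_zigzag, minCoeff_zigzag, augMatrix_zigzag]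
      simp only [Matrix.add_apply, Matrix.smul_apply, Matrix.mul_apply, Fin.sum_univ_four]
      simp
      by_cases hd : a.degree = -2
      · simp only [h', if_pos ha, if_pos hd]
        simp
      · have h2 : h' a = 0 := by_contra fun h => hd (hh' a h)
        rw [h2, hgr 0 3 (by simp; omega)]
        simp

end Inverse

/-! ### The operations of the augmentation category as entries of the obstruction -/

section Copies

variable {n : ℕ}

/-- The matrix units, with the identity matrix in place of the diagonal ones: the twist sends
`a^{pp}` to `a^{pp}` plus a scalar, and only the scalar is to survive the extraction of
coefficients. -/
def unitriangular (F : Type*) [CommRing F] (p q : Fin n) : Matrix (Fin n) (Fin n) F :=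
  if p = q then 1 else Matrix.single p q 1

theorem unitriangular_mul {p q r : Fin n} (h : p ≤ r) (h' : r ≤ q) :
    unitriangular F p r * unitriangular F r q = unitriangular F p q := by
  rcases h.eq_or_lt with rfl | h
  · simp [unitriangular]
  · rcases h'.eq_or_lt with rfl | h'
    · simp [unitriangular]
    · simp [unitriangular, h.ne, h'.ne, (h.trans h').ne]

/-- The matrix of matrices whose block at `p q` is `A p q` times the matrix unit at `p q`. -/
def blocks (A : Matrix (Fin n) (Fin n) F) : Matrix (Fin n) (Fin n) (Matrix (Fin n) (Fin n) F) :=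
  Matrix.of fun p q => A p q • unitriangular F p q

theorem blocks_mul {A B : Matrix (Fin n) (Fin n) F} (hA : ∀ p q, q < p → A p q = 0)
    (hB : ∀ p q, q < p → B p q = 0) : blocks A * blocks B = blocks (A * B) := by
  ext1 p q
  rw [Matrix.mul_apply, blocks, blocks, blocks, Matrix.of_apply, Matrix.mul_apply,
    Finset.sum_smul]
  refine Finset.sum_congr rfl fun r _ => ?_
  simp only [Matrix.of_apply]
  rcases lt_or_ge r p with h | h
  · rw [hA _ _ h]; simp
  · rcases lt_or_ge q r with h' | h'
    · rw [hB _ _ h']; simp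
    · rw [smul_mul_smul_comm, unitriangular_mul h h']

theorem blocks_add (A B : Matrix (Fin n) (Fin n) F) : blocks (A + B) = blocks A + blocks B := by
  ext1 p q
  simp [blocks, add_smul]

theorem blocks_sub (A B : Matrix (Fin n) (Fin n) F) : blocks (A - B) = blocks A - blocks B := by
  ext1 p q
  simp [blocks, sub_smul]

theorem blocks_zsmul (r : ℤ) (A : Matrix (Fin n) (Fin n) F) :
    blocks (r • A) = r • blocks A := by
  ext1 p q
  simp only [blocks, Matrix.of_apply, Matrix.smul_apply, smul_assoc]

theorem blocks_smul (r : F) (A : Matrix (Fin n) (Fin n) F) :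
    blocks (r • A) = r • blocks A := by
  ext1 p q
  simp only [blocks, Matrix.of_apply, Matrix.smul_apply, smul_assoc]

theorem blocks_diagonal (d : Fin n → F) :
    blocks (Matrix.diagonal d) = Matrix.diagonal fun p => d p • 1 := by
  ext1 p q
  by_cases h : p = q
  · subst h; simp [blocks, unitriangular]
  · simp [blocks, h]

theorem blocks_one : blocks (1 : Matrix (Fin n) (Fin n) F) = 1 := by
  rw [← Matrix.diagonal_one, blocks_diagonal]
  simp

/-- The strictly upper triangular matrix assigned to a generator of the `n`-copy by morphisms `κ`;
it has at most one nonzero entry. -/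
def genMatrix (κ : D.HomGen → Fin n → Fin n → F) : D.CopyGen n → Matrix (Fin n) (Fin n) F
  | .chord a p q => if p < q then Matrix.single p q (κ (.chord a) p q) else 0
  | .max c p q _ => Matrix.single p q (κ (.max c) p q)
  | .min c p q _ => Matrix.single p q (κ (.min c) p q)

/-- The homomorphism that extracts coefficients of words in the mixed generators: a word goes to the
product of multiples of matrix units, which is nonzero only if the letters form an increasing path
of copies. -/
def extract (κ : D.HomGen → Fin n → Fin n → F) :
    MonoidAlgebra F (FreeMonoid (D.CopyGen n)) →ₐ[F] Matrix (Fin n) (Fin n) F :=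
  MonoidAlgebra.lift F _ _ (FreeMonoid.lift (genMatrix κ))

variable (ε : Fin n → D.Augmentation F) (κ : D.HomGen → Fin n → Fin n → F)

theorem extract_single (w : FreeMonoid (D.CopyGen n)) (r : F) :
    extract κ (MonoidAlgebra.single w r) = r • FreeMonoid.lift (genMatrix κ) w := by
  rw [extract, MonoidAlgebra.lift_single]

/-- The homomorphism `extract κ` after the twist by a tuple of augmentations. -/
def twistExtract : D.CopyAlg n F →ₐ[F] Matrix (Fin n) (Fin n) F := (extract κ).comp (twist ε)

theorem twistExtract_chord (a : D.Chord) (p q : Fin n) :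
    twistExtract ε κ (D.copyGen F (.chord a p q)) =
      augMatrix ε κ a p q • unitriangular F p q := by
  rw [twistExtract, AlgHom.comp_apply, copyGen, twist, MonoidAlgebra.lift_single, one_smul,
    Monoid.Coprod.lift_apply_inl, FreeMonoid.lift_eval_of, map_add, extract_single, one_smul,
    FreeMonoid.lift_eval_of]
  rcases lt_trichotomy p q with h | h | h
  · simp [genMatrix, augMatrix, unitriangular, h, h.ne, Matrix.smul_single]
  · subst h
    simp [genMatrix, augMatrix, unitriangular, Algebra.algebraMap_eq_smul_one]
  · simp [genMatrix, augMatrix, h.ne', h.not_gt]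

theorem twistExtract_max (c : Fin m) (p q : Fin n) (h : p < q) :
    twistExtract ε κ (D.copyGen F (.max c p q h)) = Matrix.single p q (κ (.max c) p q) := by
  rw [twistExtract, AlgHom.comp_apply, copyGen, twist, MonoidAlgebra.lift_single, one_smul,
    Monoid.Coprod.lift_apply_inl, FreeMonoid.lift_eval_of, map_add, extract_single, one_smul,
    FreeMonoid.lift_eval_of]
  simp [genMatrix]

theorem twistExtract_min (c : Fin m) (p q : Fin n) (h : p < q) :
    twistExtract ε κ (D.copyGen F (.min c p q h)) = Matrix.single p q (κ (.min c) p q) := by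
  rw [twistExtract, AlgHom.comp_apply, copyGen, twist, MonoidAlgebra.lift_single, one_smul,
    Monoid.Coprod.lift_apply_inl, FreeMonoid.lift_eval_of, map_add, extract_single, one_smul,
    FreeMonoid.lift_eval_of]
  simp [genMatrix]

theorem twistExtract_base (c : Fin m) (p : Fin n) :
    twistExtract ε κ (D.copyBase F (FreeGroup.of (c, p))) =
      ((ε p).baseValue c : F) • (1 : Matrix (Fin n) (Fin n) F) := by
  rw [twistExtract, AlgHom.comp_apply, copyBase, twist, MonoidAlgebra.lift_single, one_smul,
    Monoid.Coprod.lift_apply_inr]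
  simp [Algebra.algebraMap_eq_smul_one]

theorem twistExtract_base_inv (c : Fin m) (p : Fin n) :
    twistExtract ε κ (D.copyBase F (FreeGroup.of (c, p))⁻¹) =
      (((ε p).baseValue c)⁻¹ : Fˣ).val • (1 : Matrix (Fin n) (Fin n) F) := by
  rw [twistExtract, AlgHom.comp_apply, copyBase, twist, MonoidAlgebra.lift_single, one_smul,
    Monoid.Coprod.lift_apply_inr]
  rw [MonoidHom.comp_apply, map_inv, FreeGroup.lift_apply_of, ← map_inv]
  simp [Algebra.algebraMap_eq_smul_one]

theorem mapMatrix_chordMatrix (a : D.Chord) :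
    (twistExtract ε κ).mapMatrix (D.chordMatrix F n a) = blocks (augMatrix ε κ a) := by
  ext1 p q
  simp [chordMatrix, blocks, twistExtract_chord]

theorem mapMatrix_minMatrix (c : Fin m) :
    (twistExtract ε κ).mapMatrix (D.minMatrix F n c) = blocks (minCoeff κ c) := by
  ext1 p q
  by_cases h : p < q
  · simp [minMatrix, minCoeff, blocks, twistExtract_min, h, unitriangular, h.ne,
      Matrix.smul_single]
  · simp [minMatrix, minCoeff, blocks, h]

theorem mapMatrix_baseMatrix (c : Fin m) :
    (twistExtract ε κ).mapMatrix (D.baseMatrix F n c).val = blocks (augBase ε c).val := by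
  rw [augBase_val, blocks_diagonal, baseMatrix]
  ext1 p q
  by_cases h : p = q
  · subst h; simp [twistExtract_base]
  · simp [h]

theorem mapMatrix_baseMatrix_inv (c : Fin m) :
    (twistExtract ε κ).mapMatrix (D.baseMatrix F n c)⁻¹.val = blocks (augBase ε c)⁻¹.val := by
  rw [augBase_inv_val, blocks_diagonal]
  change (twistExtract ε κ).mapMatrix
    (Matrix.diagonal fun p => D.copyBase F (FreeGroup.of (c, p))⁻¹) = _
  ext1 p q
  by_cases h : p = q
  · subst h; simp [twistExtract_base_inv]
  · simp [h]

variable {κ} (hκ : ∀ c p q, κ (.max c) p q = 0)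

include hκ

theorem map_unitMaxMatrix (c : Fin m) :
    Units.map (twistExtract ε κ).mapMatrix.toRingHom.toMonoidHom (D.unitMaxMatrix F n c) = 1 := by
  ext1
  change (twistExtract ε κ).mapMatrix (1 + D.maxMatrix F n c) = 1
  rw [map_add, map_one]
  have : (twistExtract ε κ).mapMatrix (D.maxMatrix F n c) = 0 := by
    ext1 p q
    by_cases h : p < q
    · simp [maxMatrix, h, twistExtract_max, hκ]
    · simp [maxMatrix, h]
  rw [this, add_zero]

theorem mapMatrix_copyHom (x : D.Alg F) :
    (twistExtract ε κ).mapMatrix (D.copyHom F n x) = blocks (copyEval ε κ x) := by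
  induction x using MonoidAlgebra.induction_on with
  | of w =>
    change (twistExtract ε κ).mapMatrix (D.copyHom F n (MonoidAlgebra.single w 1)) =
      blocks (copyEval ε κ (MonoidAlgebra.single w 1))
    rw [copyEval_single, copyHom, MonoidAlgebra.lift_single, one_smul]
    induction w using Word.induction with
    | one => rw [map_one, map_one, map_one, blocks_one]
    | chord a =>
      rw [wordEval_chord, Word.chord, Monoid.Coprod.lift_apply_inl, FreeMonoid.lift_eval_of,
        mapMatrix_chordMatrix]
    | base c =>
      rw [wordEval_base, Word.base, Monoid.Coprod.lift_apply_inr, ← mapMatrix_baseMatrix ε κ]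
      have := congrArg Units.val (map_unitMaxMatrix ε hκ c)
      change (twistExtract ε κ).mapMatrix (D.unitMaxMatrix F n c).val = 1 at this
      simp only [MonoidHom.comp_apply, FreeGroup.lift_apply_of, Units.coeHom_apply, map_mul, this,
        mul_one]
    | base_inv c =>
      rw [wordEval_base_inv, Word.base, Monoid.Coprod.lift_apply_inr,
        ← mapMatrix_baseMatrix_inv ε κ]
      have := congrArg (fun u => (u⁻¹ : Units _).val) (map_unitMaxMatrix ε hκ c)
      simp only [← map_inv, inv_one] at this
      change (twistExtract ε κ).mapMatrix (D.unitMaxMatrix F n c)⁻¹.val = 1 at this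
      simp only [MonoidHom.comp_apply, map_inv, FreeGroup.lift_apply_of, Units.coeHom_apply,
        mul_inv_rev, map_mul, this, one_mul]
    | mul u v hu hv =>
      rw [map_mul, map_mul, map_mul, hu, hv]
      exact blocks_mul (fun p q h => (wordEval_triangular ε κ u p q).1 h)
        (fun p q h => (wordEval_triangular ε κ v p q).1 h)
  | add x y hx hy => rw [map_add, map_add, map_add, hx, hy, blocks_add]
  | smul r x hx => rw [map_smul, map_smul, map_smul, hx, blocks_smul]

theorem twistExtract_copyDiff_chord (a : D.Chord) (p q : Fin n) :
    twistExtract ε κ (copyDiff F (.chord a p q)) =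
      copyObstruction ε κ a p q • unitriangular F p q := by
  change (twistExtract ε κ).mapMatrix _ p q = blocks (copyObstruction ε κ a) p q
  rw [map_add, map_add, map_zsmul, map_mul, map_mul, mapMatrix_copyHom ε hκ,
    mapMatrix_chordMatrix, mapMatrix_minMatrix, mapMatrix_minMatrix,
    blocks_mul (minCoeff_of_gt κ _) (augMatrix_of_gt ε κ _),
    blocks_mul (augMatrix_of_gt ε κ _) (minCoeff_of_gt κ _), copyObstruction_eq, blocks_add,
    blocks_add, blocks_zsmul]

theorem twistExtract_copyDiff_max (c : Fin m) (p q : Fin n) (h : p < q) :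
    twistExtract ε κ (copyDiff F (.max c p q h)) =
      (((augBase ε c)⁻¹.val * minCoeff κ c * (augBase ε c).val - minCoeff κ c) p q) •
        unitriangular F p q := by
  change (twistExtract ε κ).mapMatrix _ p q = blocks _ p q
  have := congrArg Units.val (map_unitMaxMatrix ε hκ c)
  change (twistExtract ε κ).mapMatrix (D.unitMaxMatrix F n c).val = 1 at this
  have h1 : ∀ p q : Fin n, q < p → (augBase ε c)⁻¹.val p q = 0 := fun p q h => by
    rw [augBase_inv_val]; exact Matrix.diagonal_apply_ne _ h.ne'
  have h2 : ∀ p q : Fin n, q < p → (augBase ε c).val p q = 0 := fun p q h => by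
    rw [augBase_val]; exact Matrix.diagonal_apply_ne _ h.ne'
  have h3 : ∀ p q : Fin n, q < p → ((augBase ε c)⁻¹.val * minCoeff κ c) p q = 0 :=
    fun p q h => by
      rw [augBase_inv_val, Matrix.diagonal_mul, minCoeff_of_gt _ _ _ _ h, mul_zero]
  rw [map_sub, map_mul, map_mul, map_mul, map_mul, this, mul_one, one_mul,
    mapMatrix_baseMatrix, mapMatrix_baseMatrix_inv, mapMatrix_minMatrix,
    blocks_mul h1 (minCoeff_of_gt κ _), blocks_mul h3 h2, blocks_sub]

omit hκ in
theorem twistExtract_copyDiff_min (c : Fin m) (p q : Fin n) (h : p < q) :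
    twistExtract ε κ (copyDiff F (.min c p q h)) =
      ((minCoeff κ c * minCoeff κ c) p q) • unitriangular F p q := by
  change (twistExtract ε κ).mapMatrix _ p q = blocks _ p q
  rw [map_mul, mapMatrix_minMatrix, blocks_mul (minCoeff_of_gt κ _) (minCoeff_of_gt κ _)]

end Copies

section Coefficients

variable {n : ℕ} (κ : D.HomGen → Fin n → Fin n → F)

theorem HomGen.copy_injective {p q : Fin n} (h : p < q) :
    Function.Injective fun b : D.HomGen => b.copy p q h := by
  intro b b' e
  cases b <;> cases b' <;> simp_all [HomGen.copy]

theorem genMatrix_copy (b : D.HomGen) {p q : Fin n} (h : p < q) :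
    genMatrix κ (b.copy p q h) = Matrix.single p q (κ b p q) := by
  cases b <;> simp [HomGen.copy, genMatrix, h]

theorem genMatrix_of_le (g : D.CopyGen n) {p q : Fin n} (h : q ≤ p) : genMatrix κ g p q = 0 := by
  cases g with
  | chord a r s =>
    rw [genMatrix]
    split_ifs with hrs
    · exact Matrix.single_apply_of_ne _ _ _ _ _ (by rintro ⟨rfl, rfl⟩; exact h.not_gt hrs)
    · rfl
  | max c r s hrs =>
    exact Matrix.single_apply_of_ne _ _ _ _ _ (by rintro ⟨rfl, rfl⟩; exact h.not_gt hrs)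
  | min c r s hrs =>
    exact Matrix.single_apply_of_ne _ _ _ _ _ (by rintro ⟨rfl, rfl⟩; exact h.not_gt hrs)

theorem genMatrix_apply [DecidableEq (D.CopyGen n)] (g : D.CopyGen n) {p q : Fin n} (h : p < q) :
    genMatrix κ g p q = ∑ b : D.HomGen, κ b p q * if g = b.copy p q h then 1 else 0 := by
  by_cases hg : ∃ b : D.HomGen, g = b.copy p q h
  · obtain ⟨b, rfl⟩ := hg
    rw [genMatrix_copy, Matrix.single_apply_same, Finset.sum_eq_single b]
    · simp
    · intro b' _ hb'
      rw [if_neg fun e => hb' (HomGen.copy_injective h e.symm), mul_zero]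
    · simp
  · rw [Finset.sum_eq_zero fun b _ => by rw [if_neg fun e => hg ⟨b, e⟩, mul_zero]]
    cases g with
    | chord a r s =>
      rw [genMatrix]
      split_ifs with hrs
      · refine Matrix.single_apply_of_ne _ _ _ _ _ ?_
        rintro ⟨rfl, rfl⟩
        exact hg ⟨.chord a, rfl⟩
      · rfl
    | max c r s hrs =>
      refine Matrix.single_apply_of_ne _ _ _ _ _ ?_
      rintro ⟨rfl, rfl⟩
      exact hg ⟨.max c, rfl⟩
    | min c r s hrs =>
      refine Matrix.single_apply_of_ne _ _ _ _ _ ?_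
      rintro ⟨rfl, rfl⟩
      exact hg ⟨.min c, rfl⟩

theorem lift_genMatrix_last [DecidableEq (FreeMonoid (D.CopyGen n))] {q : Fin n}
    (hq : ∀ r, r ≤ q) (w : FreeMonoid (D.CopyGen n)) :
    FreeMonoid.lift (genMatrix κ) w q q = if w = 1 then 1 else 0 := by
  cases w with
  | one => simp
  | of_mul g w =>
    rw [map_mul, FreeMonoid.lift_eval_of, Matrix.mul_apply, if_neg]
    · exact Finset.sum_eq_zero fun r _ => by rw [genMatrix_of_le κ g (hq r), zero_mul]
    · intro e
      simpa using congrArg FreeMonoid.length e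

theorem lift_genMatrix_next [DecidableEq (FreeMonoid (D.CopyGen n))] {p q : Fin n} (h : p < q)
    (hq : ∀ r, r ≤ q) (hp : ∀ r, p < r → r = q) (w : FreeMonoid (D.CopyGen n)) :
    FreeMonoid.lift (genMatrix κ) w p q =
      ∑ b : D.HomGen, κ b p q * if w = FreeMonoid.of (b.copy p q h) then 1 else 0 := by
  classical
  cases w with
  | one =>
    rw [map_one, Matrix.one_apply_ne h.ne, Finset.sum_eq_zero]
    intro b _
    rw [if_neg, mul_zero]
    intro e
    simpa using congrArg FreeMonoid.length e
  | of_mul g w =>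
    rw [map_mul, FreeMonoid.lift_eval_of, Matrix.mul_apply, Finset.sum_eq_single q,
      lift_genMatrix_last κ hq, genMatrix_apply κ g h, Finset.sum_mul]
    · refine Finset.sum_congr rfl fun b _ => ?_
      have : FreeMonoid.of g * w = FreeMonoid.of (b.copy p q h) ↔ g = b.copy p q h ∧ w = 1 := by
        constructor
        · intro e
          exact List.cons.inj e
        · rintro ⟨rfl, rfl⟩
          rfl
      simp only [this]
      by_cases h1 : g = b.copy p q h <;> by_cases h2 : w = 1 <;> simp [h1, h2]
    · intro r _ hr
      rw [genMatrix_of_le κ g (not_lt.1 fun e => hr (hp r e)), zero_mul]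
    · simp

/-- The entry of `extract κ` next to the diagonal in the last column picks out the coefficients of
the single letters. -/
theorem extract_next {p q : Fin n} (h : p < q) (hq : ∀ r, r ≤ q) (hp : ∀ r, p < r → r = q)
    (x : MonoidAlgebra F (FreeMonoid (D.CopyGen n))) :
    extract κ x p q = ∑ b : D.HomGen, κ b p q * x.coeff (FreeMonoid.of (b.copy p q h)) := by
  classical
  induction x using MonoidAlgebra.induction_linear with
  | zero => simp
  | add x y hx hy => simp [hx, hy, mul_add, Finset.sum_add_distrib]
  | single w r =>
    rw [extract_single, Matrix.smul_apply, lift_genMatrix_next κ h hq hp, smul_eq_mul,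
      Finset.mul_sum]
    refine Finset.sum_congr rfl fun b _ => ?_
    rw [MonoidAlgebra.coeff_single, Finsupp.single_apply]
    split_ifs <;> ring

end Coefficients

/-- The corner entry of `extract κ` for three copies picks out the coefficients of the words in two
letters. -/
theorem extract_corner {κ : D.HomGen → Fin 3 → Fin 3 → F} (hκ : ∀ b, κ b 0 2 = 0)
    (x : MonoidAlgebra F (FreeMonoid (D.CopyGen 3))) :
    extract κ x 0 2 = ∑ b₂ : D.HomGen, ∑ b₁ : D.HomGen, κ b₁ 0 1 * κ b₂ 1 2 *
      x.coeff (FreeMonoid.of (b₁.copy 0 1 (by decide)) *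
        FreeMonoid.of (b₂.copy 1 2 (by decide))) := by
  classical
  induction x using MonoidAlgebra.induction_linear with
  | zero => simp
  | add x y hx hy => simp [hx, hy, mul_add, Finset.sum_add_distrib]
  | single w r =>
    rw [extract_single, Matrix.smul_apply, smul_eq_mul]
    simp only [MonoidAlgebra.coeff_single, Finsupp.single_apply]
    cases w with
    | one =>
      rw [map_one, Matrix.one_apply_ne (by decide), mul_zero, Finset.sum_eq_zero]
      refine fun b₂ _ => Finset.sum_eq_zero fun b₁ _ => ?_
      rw [if_neg, mul_zero]
      intro e
      simpa using congrArg FreeMonoid.length e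
    | of_mul g w =>
      rw [map_mul, FreeMonoid.lift_eval_of, Matrix.mul_apply, Fin.sum_univ_three,
        genMatrix_of_le κ g le_rfl, genMatrix_apply κ g (p := 0) (q := 2) (by decide),
        Finset.sum_eq_zero fun b _ => by rw [hκ, zero_mul],
        lift_genMatrix_next κ (p := 1) (q := 2) (by decide) (by decide) (by decide),
        genMatrix_apply κ g (p := 0) (q := 1) (by decide), zero_mul, zero_mul, zero_add, add_zero,
        Finset.mul_sum, Finset.mul_sum]
      refine Finset.sum_congr rfl fun b₂ _ => ?_
      rw [Finset.sum_mul, Finset.mul_sum]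
      refine Finset.sum_congr rfl fun b₁ _ => ?_
      have : FreeMonoid.of g * w = FreeMonoid.of (b₁.copy 0 1 (by decide)) *
          FreeMonoid.of (b₂.copy 1 2 (by decide)) ↔ g = b₁.copy 0 1 (by decide) ∧
            w = FreeMonoid.of (b₂.copy 1 2 (by decide)) := by
        constructor
        · intro e
          exact List.cons.inj e
        · rintro ⟨rfl, rfl⟩
          rfl
      simp only [this, ite_and]
      split_ifs <;> ring

theorem IsHomogeneous.eq_zero {ε₁ ε₂ : D.Augmentation F} {f : HomPlus ε₁ ε₂} {d : ℤ}
    (hf : IsHomogeneous f d) {g : D.HomGen} (hg : g.degree ≠ d) : f g = 0 := by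
  by_contra h
  exact hg (hf g h)

section Operations

variable {ε₁ ε₂ ε₃ : D.Augmentation F}

theorem mOne_eq (f : HomPlus ε₁ ε₂) (a : D.HomGen) : mOne f a =
    twistExtract ![ε₁, ε₂] (fun g _ _ => f g) (copyDiff F (a.copy 0 1 (by decide))) 0 1 :=
  (extract_next (fun g _ _ => f g) (p := 0) (q := 1) (by decide) (by decide) (by decide) _).symm

theorem mOne_chord {f : HomPlus ε₁ ε₂} (hf : ∀ c, f (.max c) = 0) (a : D.Chord) :
    mOne f (.chord a) = copyObstruction ![ε₁, ε₂] (fun g _ _ => f g) a 0 1 := by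
  rw [mOne_eq]
  change twistExtract _ _ (copyDiff F (.chord a 0 1)) 0 1 = _
  rw [twistExtract_copyDiff_chord _ fun c _ _ => hf c]
  simp [unitriangular]

theorem mOne_max {f : HomPlus ε₁ ε₂} (hf : ∀ c, f (.max c) = 0) (c : Fin m) :
    mOne f (.max c) = (ε₁.baseValue c)⁻¹.val * f (.min c) * (ε₂.baseValue c).val - f (.min c) := by
  rw [mOne_eq]
  change twistExtract _ _ (copyDiff F (.max c 0 1 _)) 0 1 = _
  rw [twistExtract_copyDiff_max _ fun c _ _ => hf c]
  rw [augBase_val, augBase_inv_val]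
  simp [unitriangular, minCoeff]

theorem mOne_min (f : HomPlus ε₁ ε₂) (c : Fin m) : mOne f (.min c) = 0 := by
  rw [mOne_eq]
  change twistExtract _ _ (copyDiff F (.min c 0 1 _)) 0 1 = _
  rw [twistExtract_copyDiff_min]
  simp [unitriangular, minCoeff, Matrix.mul_apply]

/-- Two composable morphisms as coefficients for three copies. -/
def pairCoeff (f₁ f₂ : D.HomGen → F) : D.HomGen → Fin 3 → Fin 3 → F :=
  fun g => ![![0, f₁ g, 0], ![0, 0, f₂ g], ![0, 0, 0]]

/-- In degree `0` the sign of the composition is `-1`. -/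
theorem mTwo_eq {f₂ : HomPlus ε₂ ε₃} {f₁ : HomPlus ε₁ ε₂} (h₂ : IsHomogeneous f₂ 0)
    (h₁ : IsHomogeneous f₁ 0) (a : D.HomGen) : mTwo f₂ f₁ a =
      -twistExtract ![ε₁, ε₂, ε₃] (pairCoeff f₁ f₂) (copyDiff F (a.copy 0 2 (by decide))) 0 2 := by
  rw [mTwo]
  change _ = -extract (pairCoeff f₁ f₂) _ 0 2
  rw [extract_corner fun _ => rfl, ← Finset.sum_neg_distrib]
  refine Finset.sum_congr rfl fun b₂ _ => ?_
  rw [← Finset.sum_neg_distrib]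
  refine Finset.sum_congr rfl fun b₁ _ => ?_
  change _ = -(f₁ b₁ * f₂ b₂ * _)
  by_cases e₂ : f₂ b₂ = 0
  · rw [e₂]; ring
  by_cases e₁ : f₁ b₁ = 0
  · rw [e₁]; ring
  rw [h₂ b₂ e₂, h₁ b₁ e₁]
  simp
  ring

theorem pairCoeff_max {f₂ : HomPlus ε₂ ε₃} {f₁ : HomPlus ε₁ ε₂} (h₂ : IsHomogeneous f₂ 0)
    (h₁ : IsHomogeneous f₁ 0) (c : Fin m) (p q : Fin 3) : pairCoeff f₁ f₂ (.max c) p q = 0 := by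
  rw [pairCoeff, h₂.eq_zero (by simp [HomGen.degree]), h₁.eq_zero (by simp [HomGen.degree])]
  fin_cases p <;> fin_cases q <;> rfl

theorem mTwo_chord {f₂ : HomPlus ε₂ ε₃} {f₁ : HomPlus ε₁ ε₂} (h₂ : IsHomogeneous f₂ 0)
    (h₁ : IsHomogeneous f₁ 0) (a : D.Chord) : mTwo f₂ f₁ (.chord a) =
      -copyObstruction ![ε₁, ε₂, ε₃] (pairCoeff f₁ f₂) a 0 2 := by
  rw [mTwo_eq h₂ h₁]
  change -twistExtract _ _ (copyDiff F (.chord a 0 2)) 0 2 = _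
  rw [twistExtract_copyDiff_chord _ (pairCoeff_max h₂ h₁)]
  simp [unitriangular]

theorem mTwo_max {f₂ : HomPlus ε₂ ε₃} {f₁ : HomPlus ε₁ ε₂} (h₂ : IsHomogeneous f₂ 0)
    (h₁ : IsHomogeneous f₁ 0) (c : Fin m) : mTwo f₂ f₁ (.max c) = 0 := by
  rw [mTwo_eq h₂ h₁]
  change -twistExtract _ _ (copyDiff F (.max c 0 2 _)) 0 2 = _
  rw [twistExtract_copyDiff_max _ (pairCoeff_max h₂ h₁)]
  rw [augBase_val, augBase_inv_val]
  simp [unitriangular, minCoeff, pairCoeff]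

theorem mTwo_min {f₂ : HomPlus ε₂ ε₃} {f₁ : HomPlus ε₁ ε₂} (h₂ : IsHomogeneous f₂ 0)
    (h₁ : IsHomogeneous f₁ 0) (c : Fin m) :
    mTwo f₂ f₁ (.min c) = -(f₁ (.min c) * f₂ (.min c)) := by
  rw [mTwo_eq h₂ h₁]
  change -twistExtract _ _ (copyDiff F (.min c 0 2 _)) 0 2 = _
  rw [twistExtract_copyDiff_min]
  simp [unitriangular, minCoeff, pairCoeff, Matrix.mul_apply, Fin.sum_univ_three]

end Operations

/-! ### The differential on words -/

theorem diffHom_base (g : FreeGroup (Fin m)) :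
    D.diffHom F (MonoidAlgebra.single (Word.base g) 1) =
      Matrix.scalar (Fin 2) (MonoidAlgebra.single (Word.base g) 1) := by
  rw [diffHom, MonoidAlgebra.lift_single, one_smul, Word.base, Monoid.Coprod.lift_apply_inr]
  rfl

theorem diff_base (g : FreeGroup (Fin m)) :
    D.diff F (MonoidAlgebra.single (Word.base g) 1) = 0 := by
  change D.diffHom F (MonoidAlgebra.single (Word.base g) 1) 0 1 = 0
  rw [diffHom_base]
  simp

theorem diffHom_lower (w : D.Word) : D.diffHom F (MonoidAlgebra.single w 1) 1 0 = 0 ∧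
    D.diffHom F (MonoidAlgebra.single w 1) 1 1 = MonoidAlgebra.single w 1 := by
  induction w using Word.induction with
  | one => rw [← MonoidAlgebra.one_def, map_one]; simp
  | chord a => simp [diffHom, Word.chord, MonoidAlgebra.lift_single]
  | base c => rw [diffHom_base]; simp
  | base_inv c => rw [diffHom_base]; simp
  | mul u v hu hv =>
    rw [single_word_mul, map_mul, Matrix.mul_apply, Matrix.mul_apply, Fin.sum_univ_two,
      Fin.sum_univ_two, hu.1, hu.2, hv.1, hv.2]
    simp

/-- An augmentation does not see the signs in the Leibniz rule. -/
theorem Augmentation.map_diffHom (ε : D.Augmentation F) (w : D.Word) :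
    ε.toHom (D.diffHom F (MonoidAlgebra.single w 1) 0 0) =
      ε.toHom (MonoidAlgebra.single w 1) := by
  induction w using Word.induction with
  | one => rw [← MonoidAlgebra.one_def, map_one]; simp
  | chord a =>
    have h : D.diffHom F (MonoidAlgebra.single (Word.chord a) 1) 0 0 =
        (((-1 : Fˣ) ^ a.degree : Fˣ) : F) • MonoidAlgebra.single (Word.chord a) 1 := by
      simp [diffHom, Word.chord, MonoidAlgebra.lift_single]
    rw [h, map_smul, smul_eq_mul]
    by_cases h0 : ε.toHom (MonoidAlgebra.single (Word.chord a) 1) = 0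
    · rw [h0, mul_zero]
    · have := ε.degree_eq_zero h0
      rw [Word.degree_chord] at this
      have : a.degree = 0 := Multiplicative.ofAdd.injective this
      simp [this]
  | base c => rw [diffHom_base]; simp
  | base_inv c => rw [diffHom_base]; simp
  | mul u v hu hv =>
    rw [single_word_mul, map_mul, Matrix.mul_apply, Fin.sum_univ_two, (diffHom_lower v).1, mul_zero,
      add_zero, map_mul, map_mul, hu, hv]

theorem diff_mul (u v : D.Word) : D.diff F (MonoidAlgebra.single (u * v) 1) =
    D.diffHom F (MonoidAlgebra.single u 1) 0 0 * D.diff F (MonoidAlgebra.single v 1) +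
      D.diff F (MonoidAlgebra.single u 1) * MonoidAlgebra.single v 1 := by
  change D.diffHom F _ 0 1 = _ * D.diffHom F _ 0 1 + D.diffHom F _ 0 1 * _
  rw [single_word_mul, map_mul, Matrix.mul_apply, Fin.sum_univ_two, (diffHom_lower v).2]

/-! ### Closed morphisms and split-DGA homotopies -/

section Homotopy

variable {ε₁ ε₂ : D.Augmentation F}

theorem copyEval_mul_zero_one (κ : D.HomGen → Fin 2 → Fin 2 → F) (x y : D.Alg F) :
    copyEval ![ε₁, ε₂] κ (x * y) 0 1 = ε₁.toHom x * copyEval ![ε₁, ε₂] κ y 0 1 +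
      copyEval ![ε₁, ε₂] κ x 0 1 * ε₂.toHom y := by
  rw [map_mul, Matrix.mul_apply, Fin.sum_univ_two, copyEval_diag, copyEval_diag]
  rfl

/-- For two copies the obstruction is the homotopy equation at a chord; the sign plays no role,
since augmentations vanish on the chords of nonzero degree. -/
theorem copyObstruction_zero_one (κ : D.HomGen → Fin 2 → Fin 2 → F) (a : D.Chord) :
    copyObstruction ![ε₁, ε₂] κ a 0 1 = copyEval ![ε₁, ε₂] κ (chordDiff F a) 0 1 +
      κ (.min a.target) 0 1 * ε₂.toHom (MonoidAlgebra.single (Word.chord a) 1) -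
        κ (.min a.source) 0 1 * ε₁.toHom (MonoidAlgebra.single (Word.chord a) 1) := by
  rw [copyObstruction_eq, Matrix.add_apply, Matrix.add_apply, Matrix.smul_apply, Matrix.mul_apply,
    Matrix.mul_apply, Fin.sum_univ_two, Fin.sum_univ_two]
  simp only [minCoeff, augMatrix, Matrix.of_apply]
  by_cases h0 : ε₁.toHom (MonoidAlgebra.single (Word.chord a) 1) = 0
  · simp [h0]
  · have := ε₁.degree_eq_zero h0
    rw [Word.degree_chord] at this
    have : a.degree = 0 := Multiplicative.ofAdd.injective this
    simp [this]
    ring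

/-- A closed morphism satisfies the homotopy equation on all composable words. -/
theorem copyEval_diff {κ : D.HomGen → Fin 2 → Fin 2 → F} {α : Fin m → F}
    (hα : ∀ c, κ (.min c) 0 1 = α c) (ht : ∀ c, ε₁.baseValue c = ε₂.baseValue c)
    (hO : ∀ a, copyObstruction ![ε₁, ε₂] κ a 0 1 = 0) {i j : Fin m} {w : D.Word}
    (hw : Composable i j w) :
    α i * ε₁.toHom (MonoidAlgebra.single w 1) - α j * ε₂.toHom (MonoidAlgebra.single w 1) =
      copyEval ![ε₁, ε₂] κ (D.diff F (MonoidAlgebra.single w 1)) 0 1 := by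
  induction hw with
  | one j =>
    have : (MonoidAlgebra.single 1 1 : D.Alg F) = MonoidAlgebra.single (Word.base 1) 1 := by
      rw [Word.base, map_one]
    rw [← MonoidAlgebra.one_def] at this ⊢
    rw [map_one, map_one, this, diff_base]
    simp
  | chord a =>
    have := hO a
    rw [copyObstruction_zero_one, hα, hα] at this
    rw [diff_chord]
    linear_combination -this
  | base c =>
    rw [diff_base, ← baseValue_val, ← baseValue_val, ht]
    simp
  | base_inv c =>
    rw [diff_base, ← baseValue_inv_val, ← baseValue_inv_val, ht]
    simp
  | mul hu hv ihu ihv =>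
    rw [diff_mul, map_add, Matrix.add_apply, copyEval_mul_zero_one, copyEval_mul_zero_one,
      Augmentation.map_diffHom, Augmentation.map_diff, Augmentation.map_diff, ← ihu, ← ihv,
      Augmentation.single_mul, Augmentation.single_mul]
    ring

theorem splitDGAHomotopic_of_augEquivalent (h : AugEquivalent ε₁ ε₂) :
    SplitDGAHomotopic ε₁.split ε₂.split := by
  obtain ⟨f, g, hf, hf1, hg, -, ⟨h, -, hfg⟩, -⟩ := h
  have hmax : ∀ c, f (.max c) = 0 := fun c => hf.eq_zero (by simp [HomGen.degree])
  -- Coboundaries have no coefficient at the minima, so the composition is the unit there.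
  have hunit : ∀ c, f (.min c) * g (.min c) = 1 := by
    intro c
    have := congrFun hfg (.min c)
    rw [mOne_min, Pi.sub_apply, mTwo_min hf hg] at this
    change -(g (.min c) * f (.min c)) - (-1) = 0 at this
    linear_combination -this
  let α : Fin m → Fˣ := fun c => Units.mkOfMulEqOne _ _ (hunit c)
  -- This is closedness at the maxima, divided by `α c`.
  have ht : ∀ c, ε₁.baseValue c = ε₂.baseValue c := by
    intro c
    have := mOne_max hmax c
    rw [hf1] at this
    change 0 = _ * (α c : F) * _ - (α c : F) at this
    have h' : ((ε₁.baseValue c)⁻¹ * α c * ε₂.baseValue c : Fˣ) = α c := by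
      ext
      push_cast
      exact (sub_eq_zero.1 this.symm)
    rw [mul_assoc, mul_comm (α c), ← mul_assoc, mul_eq_right, inv_mul_eq_one] at h'
    exact h'
  let κ : D.HomGen → Fin 2 → Fin 2 → F := fun g _ _ => f g
  let K : D.Alg F →ₗ[F] F :=
    Matrix.entryLinearMap F F 0 1 ∘ₗ (copyEval ![ε₁, ε₂] κ).toLinearMap
  have hK : ∀ x, K x = copyEval ![ε₁, ε₂] κ x 0 1 := fun x => rfl
  have hO : ∀ a, copyObstruction ![ε₁, ε₂] κ a 0 1 = 0 := fun a => by
    rw [← mOne_chord hmax, hf1]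
    rfl
  refine ⟨α, fun i j => K ∘ₗ (D.splitPart F i j).subtype, ?_, ?_, ?_⟩
  · intro i j n hn x hx
    refine copyEval_graded _ _ (fun a p q hpq hne => ?_) hx ?_
    · have := hf _ hne
      rw [HomGen.degree] at this
      rw [Fin.lt_def] at hpq
      omega
    · simpa [eq_neg_iff_add_eq_zero] using hn
  · rintro i j ⟨x, hx⟩
    change (α i : F) * ε₁.toHom x - (α j : F) * ε₂.toHom x = K (D.diff F x)
    refine Submodule.span_induction ?_ (by simp) ?_ ?_ hx
    · rintro _ ⟨w, hw, rfl⟩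
      exact copyEval_diff (fun c => rfl) ht hO hw
    · intro x y _ _ hx hy
      rw [map_add, map_add, map_add, map_add, ← hx, ← hy]
      ring
    · intro r x _ hx
      rw [map_smul, map_smul, map_smul, map_smul, ← hx]
      simp only [smul_eq_mul]
      ring
  · rintro i j l n ⟨x, hx⟩ ⟨y, hy⟩ hn
    change K (x * y) = K x * ε₂.toHom y + _ * ε₁.toHom x * K y
    rw [hK, copyEval_mul_zero_one, ← hK, ← hK]
    -- The sign `(-1) ^ n` does not matter, since `ε₁` vanishes in nonzero degree.
    by_cases h0 : n = 0
    · subst h0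
      simp
      ring
    · rw [ε₁.degree_zero n h0 x hn]
      ring

/-- The morphism with prescribed coefficients at the chords and minima, and none at the maxima. -/
def morphism (α : Fin m → F) (f : D.Chord → F) : D.HomGen → F
  | .chord a => f a
  | .max _ => 0
  | .min c => α c

/-- The value of a split-DGA homotopy on a composable word is determined by the values on chords. -/
theorem homotopy_eq_copyEval {K : ∀ i j : Fin m, D.splitPart F i j →ₗ[F] F}
    (hdeg : ∀ (i j : Fin m) (n : ℤ), n + 1 ≠ 0 → ∀ x : D.splitPart F i j, x.1 ∈ D.gradedPart F n →
      K i j x = 0)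
    (hmul : ∀ (i j l : Fin m) (n : ℤ) (x : D.splitPart F j l) (y : D.splitPart F i j),
      x.1 ∈ D.gradedPart F n → K i l (splitMul x y) =
        K j l x * ε₂.split i j y + (((-1 : Fˣ) ^ n : Fˣ) : F) * ε₁.split j l x * K i j y)
    {κ : D.HomGen → Fin 2 → Fin 2 → F}
    (hκ : ∀ a : D.Chord, κ (.chord a) 0 1 =
      K a.source a.target ⟨_, single_mem_splitPart (.chord a) 1⟩)
    {i j : Fin m} (x : D.splitPart F i j) : K i j x = copyEval ![ε₁, ε₂] κ x.1 0 1 := by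
  have key : ∀ {i j : Fin m} {w : D.Word} (hw : Composable i j w),
      K i j ⟨_, single_mem_splitPart hw 1⟩ =
        copyEval ![ε₁, ε₂] κ (MonoidAlgebra.single w 1) 0 1 := by
    intro i j w hw
    induction hw with
    | one j =>
      rw [hdeg _ _ 0 (by decide) _ (single_mem_gradedPart 1 (map_one _)), copyEval_single, map_one]
      rfl
    | chord a =>
      rw [← hκ, copyEval_single, wordEval_chord]
      rfl
    | base c =>
      rw [hdeg _ _ 0 (by decide) _ (single_mem_gradedPart _ (Word.degree_base _)), copyEval_single,
        wordEval_base]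
      rfl
    | base_inv c =>
      rw [hdeg _ _ 0 (by decide) _ (single_mem_gradedPart _ (Word.degree_base _)), copyEval_single,
        wordEval_base_inv]
      rfl
    | @mul i j l u v hu hv ihu ihv =>
      have e := hmul i j l (Word.degree u).toAdd ⟨_, single_mem_splitPart hu 1⟩
        ⟨_, single_mem_splitPart hv 1⟩ (single_mem_gradedPart u rfl)
      have e' : splitMul (F := F) ⟨_, single_mem_splitPart hu 1⟩ ⟨_, single_mem_splitPart hv 1⟩ =
          ⟨_, single_mem_splitPart (hu.mul hv) 1⟩ :=
        Subtype.ext (single_word_mul u v).symm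
      rw [← e', e, single_word_mul, copyEval_mul_zero_one, ihu, ihv]
      change _ * ε₂.toHom (MonoidAlgebra.single v 1) +
        _ * ε₁.toHom (MonoidAlgebra.single u 1) * _ = _
      by_cases h0 : ε₁.toHom (MonoidAlgebra.single u 1) = 0
      · rw [h0]
        ring
      · rw [ε₁.degree_eq_zero h0]
        simp
        ring
  obtain ⟨x, hx⟩ := x
  refine Submodule.span_induction (p := fun x hx => K i j ⟨x, hx⟩ = copyEval ![ε₁, ε₂] κ x 0 1)
    ?_ ?_ ?_ ?_ hx
  · rintro _ ⟨w, hw, rfl⟩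
    exact key hw
  · rw [map_zero]
    exact map_zero _
  · intro x y hx hy ihx ihy
    rw [map_add, Matrix.add_apply, ← ihx, ← ihy, ← map_add]
    rfl
  · intro r x hx ih
    rw [map_smul, Matrix.smul_apply, ← ih, ← map_smul]
    rfl

theorem augEquivalent_of_splitDGAHomotopic (h : SplitDGAHomotopic ε₁.split ε₂.split) :
    AugEquivalent ε₁ ε₂ := by
  obtain ⟨α, K, hdeg, hhom, hmul⟩ := h
  let f : D.Chord → F := fun a => K a.source a.target ⟨_, single_mem_splitPart (.chord a) 1⟩
  have hf : ∀ a, f a ≠ 0 → a.degree = -1 := by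
    intro a ha
    by_contra hne
    exact ha (hdeg _ _ a.degree (fun e => hne (by omega)) _
      (single_mem_gradedPart _ (Word.degree_chord a)))
  have hK : ∀ {i j : Fin m} (x : D.splitPart F i j),
      K i j x = copyEval ![ε₁, ε₂] (fun g _ _ => zigzag α f 0 0 g 0 1) x.1 0 1 :=
    homotopy_eq_copyEval hdeg hmul fun a => rfl
  have ht : ∀ c, ε₁.baseValue c = ε₂.baseValue c := by
    -- The homotopy equation at `t c`, where `∂` vanishes.
    intro c
    have := hhom c c ⟨_, single_mem_splitPart (.base c) 1⟩
    rw [hK] at this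
    change (α c : F) * (ε₁.baseValue c : F) - (α c : F) * (ε₂.baseValue c : F) =
      copyEval _ _ (D.diff F (MonoidAlgebra.single (Word.base (FreeGroup.of c)) 1)) 0 1 at this
    rw [diff_base, map_zero, Matrix.zero_apply, sub_eq_zero] at this
    exact Units.ext ((α c).isUnit.mul_left_cancel this)
  have hO : ∀ a, copyObstruction ![ε₁, ε₂] (fun g _ _ => zigzag α f 0 0 g 0 1) a 0 1 = 0 := by
    intro a
    have := hhom _ _ ⟨_, single_mem_splitPart (.chord a) 1⟩
    rw [hK] at this
    change (α a.source : F) * ε₁.toHom (MonoidAlgebra.single (Word.chord a) 1) -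
      (α a.target : F) * ε₂.toHom (MonoidAlgebra.single (Word.chord a) 1) =
        copyEval _ _ (D.diff F (MonoidAlgebra.single (Word.chord a) 1)) 0 1 at this
    rw [diff_chord] at this
    rw [copyObstruction_zero_one]
    change _ + (α a.target : F) * _ - (α a.source : F) * _ = 0
    linear_combination -this
  obtain ⟨g, h, hg, hh, H⟩ := exists_zigzag ht hf hO
  let φ : HomPlus ε₁ ε₂ := morphism (fun c => α c) f
  let γ : HomPlus ε₂ ε₁ := morphism (fun c => ((α c)⁻¹ : Fˣ)) g
  let η : HomPlus ε₂ ε₂ := morphism 0 h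
  have hφ : IsHomogeneous φ 0 := by
    rintro (a | c | c) hne
    · rw [HomGen.degree, hf a hne]; rfl
    · exact absurd rfl hne
    · rfl
  have hγ : IsHomogeneous γ 0 := by
    rintro (a | c | c) hne
    · rw [HomGen.degree, hg a hne]; rfl
    · exact absurd rfl hne
    · rfl
  have hη : IsHomogeneous η (-1) := by
    rintro (a | c | c) hne
    · rw [HomGen.degree, hh a hne]; rfl
    · exact absurd rfl hne
    · exact absurd rfl hne
  refine ⟨φ, γ, hφ, ?_, hγ, ?_, ⟨η, hη, ?_⟩, ⟨0, fun _ hne => absurd rfl hne, ?_⟩⟩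
  · funext x
    rcases x with a | c | c
    · rw [mOne_chord fun c => rfl]
      refine (congrFun (congrFun (copyObstruction_congr _ _ (fun x p q hpq => ?_) a) 0) 1).trans
        (hO a)
      cases x <;> rfl
    · rw [mOne_max fun c => rfl, ht, mul_right_comm, Units.inv_mul, one_mul, sub_self]
      rfl
    · exact mOne_min _ _
  · funext x
    rcases x with a | c | c
    · rw [mOne_chord fun c => rfl]
      refine (copyObstruction_block (n := 4) (n' := 2) (k := 1) (by decide) (fun p => ?_)
        (fun x p q hpq => ?_) a 0 1).symm.trans (congrFun (congrFun (H a) 1) 2)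
      · fin_cases p <;> rfl
      · fin_cases p <;> fin_cases q <;> simp at hpq
        cases x <;> rfl
    · rw [mOne_max fun c => rfl, ht, mul_right_comm, Units.inv_mul, one_mul, sub_self]
      rfl
    · exact mOne_min _ _
  · funext x
    rw [Pi.sub_apply]
    rcases x with a | c | c
    · rw [mTwo_chord hφ hγ, mOne_chord fun c => rfl]
      change _ - 0 = _
      let κ : D.HomGen → Fin 3 → Fin 3 → F := fun x =>
        ![![0, γ x, η x], ![0, 0, φ x], ![0, 0, 0]]
      -- The block of the last three copies contains `h` in its corner.
      have h1 : copyObstruction ![ε₂, ε₁, ε₂] κ a 0 2 = 0 := by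
        refine (copyObstruction_block (n := 4) (n' := 3) (k := 1) (by decide) (fun p => ?_)
          (fun x p q hpq => ?_) a 0 2).symm.trans (congrFun (congrFun (H a) 1) 3)
        · fin_cases p <;> rfl
        · fin_cases p <;> fin_cases q <;> simp at hpq <;> cases x <;> rfl
      rw [copyObstruction_corner _ κ (pairCoeff γ φ) (fun _ => rfl) (fun _ => rfl) fun _ => rfl]
        at h1
      rw [sub_zero, neg_eq_iff_add_eq_zero]
      exact h1
    · rw [mTwo_max hφ hγ, mOne_max fun c => rfl]
      simp [unit, η, morphism]
    · rw [mTwo_min hφ hγ, mOne_min]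
      simp [unit, γ, φ, morphism]
  · have : mOne (0 : HomPlus ε₁ ε₁) = 0 := by
      funext x
      simp [mOne]
    rw [this]
    funext x
    rw [Pi.sub_apply]
    rcases x with a | c | c
    · rw [mTwo_chord hγ hφ]
      change _ - 0 = 0
      rw [sub_zero, neg_eq_zero]
      refine (copyObstruction_block (n := 4) (n' := 3) (k := 0) (by decide) (fun p => ?_)
        (fun x p q hpq => ?_) a 0 2).symm.trans (congrFun (congrFun (H a) 0) 2)
      · fin_cases p <;> rfl
      · fin_cases p <;> fin_cases q <;> simp at hpq <;> cases x <;> rfl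
    · rw [mTwo_max hγ hφ]
      simp [unit]
    · rw [mTwo_min hγ hφ]
      simp [unit, γ, φ, morphism]

end Homotopy

end FrontDiagram

end Legendrian

end

theorem mainTheorem8 {m : ℕ} (Λ : Legendrian.Link m) (D : Legendrian.FrontDiagram m)
    (hD : D.IsFrontOf Λ) {F : Type*} [CommRing F] (ε₁ ε₂ : D.Augmentation F) :
    Legendrian.FrontDiagram.AugEquivalent ε₁ ε₂ ↔
      Legendrian.FrontDiagram.SplitDGAHomotopic ε₁.split ε₂.split :=
  ⟨Legendrian.FrontDiagram.splitDGAHomotopic_of_augEquivalent,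
    Legendrian.FrontDiagram.augEquivalent_of_splitDGAHomotopic⟩
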